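/- Let $G=\mathrm{SU}(2)$, let $D\subset\mathbb R^2$ and $B\subset\mathbb R^3$ be the closed unit balls with their standard orientations, and let $S^2=\partial B$ carry the boundary orientation. Let $G^D=C^\infty(D;G)$ with pointwise product, and let $G^D_{S^1}$ be the subgroup of those $g\in G^D$ with $g=1$ on $\partial D=S^1$. For $g,h\in G^D$ put $$C(g,h)=\frac1{8\pi^2}\int_D \mathrm{tr}\,(g^{-1}dg\wedge dh\,h^{-1})\in\mathbb R ,$$ and for a smooth map $\bar g:B\to G$ put $$\Lambda(\bar g)=-\frac1{24\pi^2}\int_B \mathrm{tr}\,(\bar g^{-1}d\bar g)^{\wedge 3}\in\mathbb R .$$ Call a smooth, orientation-preserving embedding $q$ of the open disk $\mathring D$ onto an open subset of $S^2$ a collapse if for every $g\in G^D_{S^1}$ the map $\tilde g:S^2\to G$ with $\tilde g(q(x))=g(x)$ for $x\in\mathring D$ and $\tilde g=1$ on $S^2\setminus q(\mathring D)$ is smooth. (If $S^2\setminus q(\mathring D)$ is one point, $q$ is an identification of $D/\partial D$ with $S^2$.) Collapses exist. For every collapse $q$, each $\tilde g$ with $g\in G^D_{S^1}$ extends to a smooth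 map $\bar g:B\to G$, and $\Lambda(\bar g)\bmod\mathbb Z$ does not depend on the extension; so there is a well-defined map $\Lambda:G^D_{S^1}\to\mathbb R/\mathbb Z$, $\Lambda(g)=\Lambda(\bar g)\bmod\mathbb Z$. With $\delta\Lambda(g,h)=\Lambda(h)-\Lambda(gh)+\Lambda(g)$, all $g,h\in G^D_{S^1}$ satisfy $$-\delta\Lambda(g,h)=C(g,h)\bmod\mathbb Z .$$ -/

import Mathlib

open scoped ContDiff

namespace Mickelsson

noncomputable section

/-- Euclidean `n`-space with its standard inner product and standard basis. -/
abbrev E (n : ℕ) : Type := EuclideanSpace ℝ (Fin n)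

/-- The complex `2 × 2` matrices. -/
abbrev M : Type := Matrix (Fin 2) (Fin 2) ℂ

/-- The compact Lie group `SU(2)`. -/
abbrev SU2 : Type := Matrix.specialUnitaryGroup (Fin 2) ℂ

/-- The closed unit disk `D` (for `n = 2`) and the closed unit ball `B` (for `n = 3`). -/
abbrev Ball (n : ℕ) : Set (E n) := Metric.closedBall 0 1

/-- The unit sphere `S²` in `ℝ³`. -/
abbrev S2 : Set (E 3) := Metric.sphere 0 1

-- `M` is a finite-dimensional real vector space, so that smoothness and derivatives do not depend
-- on the norm that is chosen here.
attribute [local instance] Matrix.linftyOpNormedRing Matrix.linftyOpNormedAlgebra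

lemma contDiff_conjTranspose : ContDiff ℝ ∞ (fun A : M => A.conjTranspose) := by
  let L : M →ₗ[ℝ] M :=
    { toFun := fun A => A.conjTranspose
      map_add' := fun A B => Matrix.conjTranspose_add A B
      map_smul' := fun c A => by
        ext i j
        simp }
  exact (LinearMap.toContinuousLinearMap L).contDiff

/-- The group `C^∞(S; SU(2))` with pointwise product. A map on a closed subset `S` of `ℝⁿ` (here a
closed ball or a sphere) is smooth if it is the restriction of a smooth map on `ℝⁿ`. Smoothness
into `SU(2)` is the same as smoothness into the ambient space of matrices. -/
def smoothMaps {n : ℕ} (S : Set (E n)) : Subgroup (S → SU2) where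
  carrier := {g | ∃ F : E n → M, ContDiff ℝ ∞ F ∧ ∀ x : S, F x = (g x : M)}
  mul_mem' := by
    rintro a b ⟨F, hF, hFa⟩ ⟨F', hF', hFb⟩
    exact ⟨fun x => F x * F' x, hF.mul hF', fun x => by simp [hFa, hFb]⟩
  one_mem' := ⟨fun _ => 1, contDiff_const, fun x => by simp⟩
  inv_mem' := by
    rintro a ⟨F, hF, hFa⟩
    refine ⟨fun x => (F x).conjTranspose, contDiff_conjTranspose.comp hF, fun x => ?_⟩
    simp only [hFa, Pi.inv_apply]
    rfl

/-- `G^D = C^∞(D; SU(2))`. -/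
abbrev GD : Subgroup (Ball 2 → SU2) := smoothMaps (Ball 2)

/-- `C^∞(B; SU(2))`. -/
abbrev GB : Subgroup (Ball 3 → SU2) := smoothMaps (Ball 3)

/-- `G^D_{S¹}`, the maps in `G^D` that are `1` on the boundary circle. -/
def GDS1 : Subgroup GD where
  carrier := {g | ∀ x : Ball 2, ‖(x : E 2)‖ = 1 → (g : Ball 2 → SU2) x = 1}
  mul_mem' := by
    intro a b ha hb x hx
    simp [ha x hx, hb x hx]
  one_mem' := fun x _ => by simp
  inv_mem' := by
    intro a ha x hx
    simp [ha x hx]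

open Classical in
/-- A map `S → SU(2)` as a matrix-valued function on `ℝⁿ`, with the value `0` off `S`. -/
def extendZero {n : ℕ} {S : Set (E n)} (g : S → SU2) (x : E n) : M :=
  if h : x ∈ S then (g ⟨x, h⟩ : M) else 0

/-- The differential `dg` at `x`, applied to the tangent vector `v` (for `S` a closed ball). -/
def diff {n : ℕ} {S : Set (E n)} (g : S → SU2) (x v : E n) : M :=
  fderivWithin ℝ (extendZero g) S x v

/-- The matrix-valued 1-form `g⁻¹ dg`. -/
def leftForm {n : ℕ} {S : Set (E n)} (g : S → SU2) (x v : E n) : M :=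
  extendZero g⁻¹ x * diff g x v

/-- The matrix-valued 1-form `dg g⁻¹`. -/
def rightForm {n : ℕ} {S : Set (E n)} (g : S → SU2) (x v : E n) : M :=
  diff g x v * extendZero g⁻¹ x

/-- The value `tr(η₁ ∧ ⋯ ∧ ηₙ)(e₁, …, eₙ)` on the standard basis of `ℝⁿ` at the point `x`, for
matrix-valued 1-forms `η₁, …, ηₙ`, with the wedge product
`(η₁ ∧ ⋯ ∧ ηₙ)(v₁, …, vₙ) = ∑_σ sgn(σ) η₁(v_{σ 1}) ⋯ ηₙ(v_{σ n})`. -/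
def traceWedge {n : ℕ} (η : Fin n → E n → E n → M) (x : E n) : ℂ :=
  ∑ σ : Equiv.Perm (Fin n), ((Equiv.Perm.sign σ : ℤ) : ℂ) *
    Matrix.trace (List.ofFn fun i => η i x (EuclideanSpace.basisFun (Fin n) ℝ (σ i))).prod

/-- `∫ tr(η₁ ∧ ⋯ ∧ ηₙ)` over the closed unit ball of `ℝⁿ` with its standard orientation. For the
forms below, `n` is `2` or `3` and the `ηᵢ` are skew-Hermitian, so that the `n`-form is real. -/
def integralTrace {n : ℕ} (η : Fin n → E n → E n → M) : ℝ :=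
  ∫ x in Ball n, (traceWedge η x).re

/-- `C(g, h) = (1 / 8π²) ∫_D tr(g⁻¹ dg ∧ dh h⁻¹)`. -/
def cocycle (g h : GD) : ℝ :=
  1 / (8 * Real.pi ^ 2) * integralTrace ![leftForm (g : Ball 2 → SU2), rightForm (h : Ball 2 → SU2)]

/-- `Λ(ḡ) = -(1 / 24π²) ∫_B tr((ḡ⁻¹ dḡ)^{∧ 3})` for a smooth map `ḡ : B → SU(2)`. -/
def ballIntegral (G : GB) : ℝ :=
  -(1 / (24 * Real.pi ^ 2)) * integralTrace fun _ : Fin 3 => leftForm (G : Ball 3 → SU2)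

/-- `u : S² → SU(2)` is the map that `g` induces on the sphere when the open disk is put into the
sphere by `q` and the rest of the sphere is collapsed to the boundary: `u (q x) = g x` for `x` in
the open disk, and `u = 1` off the image of the open disk. -/
def Induces (q : E 2 → E 3) (g : GDS1) (u : S2 → SU2) : Prop :=
  ∀ y : S2,
    (∀ x : Ball 2, ‖(x : E 2)‖ < 1 → q x = y → u y = ((g : GD) : Ball 2 → SU2) x) ∧
    ((y : E 3) ∉ q '' Metric.ball 0 1 → u y = 1)

/-- A collapse of the sphere onto `D/∂D`: an orientation-preserving smooth embedding `q` of the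
open disk as an open subset of `S²` (the sphere is oriented as the boundary of `B`, outward normal
first), through which every `g` in `G^D_{S¹}` induces a smooth map on `S²`. If the image of `q` is
`S²` without one point, `q` is an identification of `D/∂D` with `S²`. -/
structure IsCollapse (q : E 2 → E 3) : Prop where
  smooth : ContDiffOn ℝ ∞ q (Metric.ball 0 1)
  mapsTo : Set.MapsTo q (Metric.ball 0 1) S2
  injOn : Set.InjOn q (Metric.ball 0 1)
  oriented : ∀ x ∈ Metric.ball (0 : E 2) 1,
    0 < Matrix.det (Matrix.of ![(q x).ofLp,
      (fderiv ℝ q x (EuclideanSpace.basisFun (Fin 2) ℝ 0)).ofLp,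
      (fderiv ℝ q x (EuclideanSpace.basisFun (Fin 2) ℝ 1)).ofLp])
  smooth_induced : ∀ g : GDS1, ∃ u ∈ smoothMaps S2, Induces q g u

/-- `ḡ : B → SU(2)` restricts on `S² = ∂B` to the map that is induced by `g`. -/
def IsFilling (q : E 2 → E 3) (g : GDS1) (G : GB) : Prop :=
  Induces q g fun y => (G : Ball 3 → SU2) ⟨y, Metric.sphere_subset_closedBall y.2⟩

open Classical in
/-- The 1-cochain `Λ : G^D_{S¹} → ℝ/ℤ`, `Λ(g) = Λ(ḡ) mod ℤ` for a filling `ḡ` of `g`. -/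
def wzCochain (q : E 2 → E 3) (g : GDS1) : AddCircle (1 : ℝ) :=
  if h : ∃ G : GB, IsFilling q g G then ((ballIntegral h.choose : ℝ) : AddCircle (1 : ℝ)) else 0

/-- The group coboundary of a 1-cochain with coefficients in a trivial module. -/
def coboundary {Γ A : Type*} [Group Γ] [AddCommGroup A] (c : Γ → A) (g h : Γ) : A :=
  c h - c (g * h) + c g

end

end Mickelsson

/-!
Write `w(F)` for the density of `tr (F⁻¹dF)^{∧ 3}`. It is the pull-back under `F` of a bi-invariant
volume form of `SU(2)`, and it satisfies the Polyakov–Wiegmann identity: `w(GH) - w(G) - w(H)` is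
the exterior derivative of a multiple of `tr (G⁻¹dG ∧ dH H⁻¹)`.

If two fillings `G₁` and `G₂` agree on the sphere, then `F = G₁ G₂⁻¹`, continued by `1`, is defined
on `ℝ³`, and the identity reduces `Λ(G₁) - Λ(G₂)` to the integral of `w(F)`. That integral is an
integer multiple of `24π²`. Indeed the functional `f ↦ ∫ f(F) w(F)` on functions on `SU(2)` is
bi-invariant, hence proportional to the one that belongs to a model map of degree one, for which
`∫ w = 24π²`. When `f` is concentrated near a regular value of `F`, the factor of proportionality is
a local degree, a sum of signs over the fibre.

The map `g̃` misses some `-c`, because the smooth image of a surface has measure zero in `SU(2)`, so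
contracting `SU(2) ∖ {-c}` along the rays of the ball gives a filling. The product of such fillings
of `g̃` and `h̃` is a filling for `gh`, and in the coordinates `(r, x) ↦ r q(x)` of the cone over
the image of `q`, the theorem of Stokes turns the integral of the exact term into the cocycle.

Throughout, maps on the closed disk or ball are composed with a smooth map `flat` of `ℝⁿ` onto the
closed unit ball that is a diffeomorphism of a smaller open ball onto the open unit ball and maps
the rest to the sphere. The compositions are `SU(2)`-valued on all of `ℝⁿ`, and a map that is `1` on
the unit sphere becomes `1` off a bounded set.
-/

open scoped ContDiff

namespace Mickelsson

noncomputable section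

attribute [local instance] Matrix.linftyOpNormedRing Matrix.linftyOpNormedAlgebra

open MeasureTheory Matrix Topology

/-! ### The Wess–Zumino density -/

/-- The standard basis vectors. -/
abbrev ee {n : ℕ} (i : Fin n) : E n := EuclideanSpace.basisFun (Fin n) ℝ i

/-- The multilinear map `(v₁, …, vₙ) ↦ tr(α₁(v₁) ⋯ αₙ(vₙ))`. -/
def traceMultilinear {n : ℕ} (α : Fin n → E n →L[ℝ] M) :
    MultilinearMap ℝ (fun _ : Fin n => E n) ℂ :=
  ((Matrix.traceLinearMap (Fin 2) ℝ ℂ).compMultilinearMap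
    (MultilinearMap.mkPiAlgebraFin ℝ n M)).compLinearMap fun i => α i

/-- The real alternating form `Re tr(α₁ ∧ ⋯ ∧ αₙ)`. -/
def reTraceWedge {n : ℕ} (α : Fin n → E n →L[ℝ] M) : E n [⋀^Fin n]→ₗ[ℝ] ℝ :=
  Complex.reLm.compAlternatingMap (MultilinearMap.alternatization (traceMultilinear α))

section reTraceWedge

variable {n : ℕ}

lemma re_traceWedge (α : Fin n → E n → E n →L[ℝ] M) (x : E n) :
    (traceWedge (fun i y v => α i y v) x).re = reTraceWedge (fun i => α i x) ee := by
  simp only [reTraceWedge, traceWedge, LinearMap.compAlternatingMap_apply, Complex.reLm_coe,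
    MultilinearMap.alternatization_apply, traceMultilinear]
  congr 1
  refine Finset.sum_congr rfl fun σ _ => ?_
  simp [MultilinearMap.mkPiAlgebraFin_apply, Units.smul_def]

lemma reTraceWedge_comp (α : Fin n → E n →L[ℝ] M) (A : E n →L[ℝ] E n) :
    reTraceWedge (fun i => (α i).comp A) ee = A.det * reTraceWedge α ee := by
  let b := (EuclideanSpace.basisFun (Fin n) ℝ).toBasis
  have hb : (b : Fin n → E n) = ee := by ext1 i; simp [b]
  have hcomp : reTraceWedge (fun i => (α i).comp A) ee = reTraceWedge α (A ∘ b) := by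
    simp [reTraceWedge, hb, MultilinearMap.alternatization_apply, traceMultilinear, Units.smul_def]
  have hdet : b.det (A ∘ b) = A.det := by
    simpa [b.det_self] using b.det_comp (A : E n →ₗ[ℝ] E n) b
  rw [hcomp, (reTraceWedge α).eq_smul_basis_det b, AlternatingMap.smul_apply,
    AlternatingMap.smul_apply, hdet, ← hb, b.det_self, smul_eq_mul, smul_eq_mul, mul_one, mul_comm]

lemma reTraceWedge_two (α : Fin 2 → E 2 →L[ℝ] M) :
    reTraceWedge α ee =
      (trace (α 0 (ee 0) * α 1 (ee 1) - α 0 (ee 1) * α 1 (ee 0))).re := by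
  have huniv : (Finset.univ : Finset (Equiv.Perm (Fin 2))) = {1, Equiv.swap 0 1} := by decide
  rw [← re_traceWedge (fun i _ => α i) 0, traceWedge, huniv, Finset.sum_pair (by decide)]
  simp [sub_eq_add_neg]

lemma reTraceWedge_three (α : E 3 →L[ℝ] M) :
    reTraceWedge (fun _ => α) ee =
      3 * (trace (α (ee 0) * ⁅α (ee 1), α (ee 2)⁆)).re := by
  have huniv : (Finset.univ : Finset (Equiv.Perm (Fin 3))) = {1, Equiv.swap 0 1, Equiv.swap 0 2,
    Equiv.swap 1 2, Equiv.swap 0 1 * Equiv.swap 1 2, Equiv.swap 1 2 * Equiv.swap 0 1} := by decide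
  have swap_two : Equiv.swap (0 : Fin 3) 1 2 = 2 := by decide
  have swap_one : Equiv.swap (0 : Fin 3) 2 1 = 1 := by decide
  have swap_zero : Equiv.swap (1 : Fin 3) 2 0 = 0 := by decide
  rw [← re_traceWedge (fun _ _ => α) 0, traceWedge, huniv]
  repeat rw [Finset.sum_insert (by decide)]
  rw [Finset.sum_singleton]
  simp only [List.ofFn_succ, List.ofFn_zero, List.prod_cons, List.prod_nil, mul_one,
    Fin.succ_zero_eq_one, Fin.succ_one_eq_two, Equiv.Perm.coe_mul, Function.comp_apply,
    Equiv.swap_apply_left, Equiv.swap_apply_right, swap_zero, swap_one, swap_two,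
    Equiv.Perm.coe_one, id_eq]
  simp [Ring.lie_def, trace_fin_two, mul_apply, Fin.sum_univ_two]
  ring

end reTraceWedge

lemma setIntegral_image_of_det_pos {V : Type*} [NormedAddCommGroup V] [NormedSpace ℝ V]
    [FiniteDimensional ℝ V] [MeasurableSpace V] [BorelSpace V] (μ : Measure V)
    [μ.IsAddHaarMeasure] {U : Set V} (hU : MeasurableSet U) {φ : V → V} {φ' : V → V →L[ℝ] V}
    (hφ : ∀ x ∈ U, HasFDerivAt φ (φ' x) x) (hinj : Set.InjOn φ U)
    (hdet : ∀ x ∈ U, 0 < (φ' x).det) {f g : V → ℝ}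
    (hfg : ∀ x ∈ U, g x = (φ' x).det * f (φ x)) :
    ∫ y in φ '' U, f y ∂μ = ∫ x in U, g x ∂μ := by
  rw [integral_image_eq_integral_abs_det_fderiv_smul μ hU
    (fun x hx => (hφ x hx).hasFDerivWithinAt) hinj]
  refine setIntegral_congr_fun hU fun x hx => ?_
  rw [abs_of_pos (hdet x hx), smul_eq_mul, hfg x hx]

/-- The left Maurer–Cartan form `F⁻¹ dF` of a function with unitary values, the inverse being
written as the adjoint. -/
def leftMC {n : ℕ} (F : E n → M) (x : E n) : E n →L[ℝ] M :=
  (ContinuousLinearMap.mul ℝ M (F x)ᴴ).comp (fderiv ℝ F x)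

/-- The right Maurer–Cartan form `dF F⁻¹` of a function with unitary values, the inverse being
written as the adjoint. -/
def rightMC {n : ℕ} (F : E n → M) (x : E n) : E n →L[ℝ] M :=
  ((ContinuousLinearMap.mul ℝ M).flip (F x)ᴴ).comp (fderiv ℝ F x)

/-- The coefficient of the Wess–Zumino form `Re tr (F⁻¹dF)^{∧ 3}` on `ℝ³`. -/
def wzDensity (F : E 3 → M) (x : E 3) : ℝ := reTraceWedge (fun _ => leftMC F x) ee

/-- The coefficient of the form `Re tr (F⁻¹dF ∧ dK K⁻¹)` on `ℝ²`. -/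
def crossDensity (F K : E 2 → M) (x : E 2) : ℝ := reTraceWedge ![leftMC F x, rightMC K x] ee

section changeOfVariables

variable {n m : ℕ} {F : E m → M} {K : E n → M} {φ : E n → E m} {A : E n →L[ℝ] E m} {x : E n}

lemma leftMC_comp (hF : DifferentiableAt ℝ F (φ x)) (hφ : HasFDerivAt φ A x)
    (hK : K =ᶠ[𝓝 x] F ∘ φ) : leftMC K x = (leftMC F (φ x)).comp A := by
  have hfderiv : HasFDerivAt K ((fderiv ℝ F (φ x)).comp A) x :=
    (hF.hasFDerivAt.comp x hφ).congr_of_eventuallyEq hK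
  ext1 v
  change (K x)ᴴ * fderiv ℝ K x v = (F (φ x))ᴴ * fderiv ℝ F (φ x) (A v)
  rw [hfderiv.fderiv, hK.eq_of_nhds]
  rfl

lemma rightMC_comp (hF : DifferentiableAt ℝ F (φ x)) (hφ : HasFDerivAt φ A x)
    (hK : K =ᶠ[𝓝 x] F ∘ φ) : rightMC K x = (rightMC F (φ x)).comp A := by
  have hfderiv : HasFDerivAt K ((fderiv ℝ F (φ x)).comp A) x :=
    (hF.hasFDerivAt.comp x hφ).congr_of_eventuallyEq hK
  ext1 v
  change fderiv ℝ K x v * (K x)ᴴ = fderiv ℝ F (φ x) (A v) * (F (φ x))ᴴ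
  rw [hfderiv.fderiv, hK.eq_of_nhds]
  rfl

lemma wzDensity_comp {F K : E 3 → M} {φ : E 3 → E 3} {A : E 3 →L[ℝ] E 3} {x : E 3}
    (hF : DifferentiableAt ℝ F (φ x)) (hφ : HasFDerivAt φ A x) (hK : K =ᶠ[𝓝 x] F ∘ φ) :
    wzDensity K x = A.det * wzDensity F (φ x) := by
  rw [wzDensity, leftMC_comp hF hφ hK, reTraceWedge_comp (fun _ => leftMC F (φ x)), wzDensity]

lemma crossDensity_comp {F₁ F₂ K₁ K₂ : E 2 → M} {φ : E 2 → E 2} {A : E 2 →L[ℝ] E 2} {x : E 2}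
    (hF₁ : DifferentiableAt ℝ F₁ (φ x)) (hF₂ : DifferentiableAt ℝ F₂ (φ x))
    (hφ : HasFDerivAt φ A x) (hK₁ : K₁ =ᶠ[𝓝 x] F₁ ∘ φ) (hK₂ : K₂ =ᶠ[𝓝 x] F₂ ∘ φ) :
    crossDensity K₁ K₂ x = A.det * crossDensity F₁ F₂ (φ x) := by
  rw [crossDensity, crossDensity, ← reTraceWedge_comp, leftMC_comp hF₁ hφ hK₁,
    rightMC_comp hF₂ hφ hK₂]
  congr 2
  ext1 i
  fin_cases i <;> rfl

lemma setIntegral_wzDensity_image {F K : E 3 → M} {U : Set (E 3)} (hU : IsOpen U)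
    {φ : E 3 → E 3} {φ' : E 3 → E 3 →L[ℝ] E 3} (hφ : ∀ x ∈ U, HasFDerivAt φ (φ' x) x)
    (hinj : Set.InjOn φ U) (hdet : ∀ x ∈ U, 0 < (φ' x).det) (hF : Differentiable ℝ F)
    (hK : ∀ x ∈ U, K x = F (φ x)) :
    ∫ y in φ '' U, wzDensity F y = ∫ x in U, wzDensity K x :=
  setIntegral_image_of_det_pos volume hU.measurableSet hφ hinj hdet fun x hx =>
    wzDensity_comp (hF _) (hφ x hx) (Filter.eventually_of_mem (hU.mem_nhds hx) hK)

lemma setIntegral_crossDensity_image {F₁ F₂ K₁ K₂ : E 2 → M} {U : Set (E 2)} (hU : IsOpen U)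
    {φ : E 2 → E 2} {φ' : E 2 → E 2 →L[ℝ] E 2} (hφ : ∀ x ∈ U, HasFDerivAt φ (φ' x) x)
    (hinj : Set.InjOn φ U) (hdet : ∀ x ∈ U, 0 < (φ' x).det) (hF₁ : Differentiable ℝ F₁)
    (hF₂ : Differentiable ℝ F₂) (hK₁ : ∀ x ∈ U, K₁ x = F₁ (φ x))
    (hK₂ : ∀ x ∈ U, K₂ x = F₂ (φ x)) :
    ∫ y in φ '' U, crossDensity F₁ F₂ y = ∫ x in U, crossDensity K₁ K₂ x :=
  setIntegral_image_of_det_pos volume hU.measurableSet hφ hinj hdet fun x hx =>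
    crossDensity_comp (hF₁ _) (hF₂ _) (hφ x hx)
      (Filter.eventually_of_mem (hU.mem_nhds hx) hK₁)
      (Filter.eventually_of_mem (hU.mem_nhds hx) hK₂)

end changeOfVariables

section ball

variable {n : ℕ} {g : Ball n → SU2} {F : E n → M} {x : E n}

lemma extendZero_of_mem {S : Set (E n)} (g : S → SU2) (hx : x ∈ S) :
    extendZero g x = (g ⟨x, hx⟩ : M) := by
  simp [extendZero, hx]

lemma diff_eq_fderiv (hg : ∀ x : Ball n, F x = (g x : M)) (hx : x ∈ Metric.ball (0 : E n) 1)
    (v : E n) : diff g x v = fderiv ℝ F x v := by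
  have hB : Ball n ∈ 𝓝 x := Filter.mem_of_superset (Metric.isOpen_ball.mem_nhds hx)
    Metric.ball_subset_closedBall
  have hgF : extendZero g =ᶠ[𝓝 x] F := by
    filter_upwards [hB] with y hy
    rw [extendZero_of_mem g hy, hg ⟨y, hy⟩]
  rw [diff, fderivWithin_of_mem_nhds hB, hgF.fderiv_eq]

lemma extendZero_inv (hg : ∀ x : Ball n, F x = (g x : M)) (hx : x ∈ Metric.ball (0 : E n) 1) :
    extendZero g⁻¹ x = (F x)ᴴ := by
  rw [extendZero_of_mem _ (Metric.ball_subset_closedBall hx),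
    hg ⟨x, Metric.ball_subset_closedBall hx⟩]
  rfl

lemma leftForm_eq_leftMC (hg : ∀ x : Ball n, F x = (g x : M)) (hx : x ∈ Metric.ball (0 : E n) 1)
    (v : E n) : leftForm g x v = leftMC F x v := by
  rw [leftForm, diff_eq_fderiv hg hx, extendZero_inv hg hx]
  rfl

lemma rightForm_eq_rightMC (hg : ∀ x : Ball n, F x = (g x : M))
    (hx : x ∈ Metric.ball (0 : E n) 1) (v : E n) : rightForm g x v = rightMC F x v := by
  rw [rightForm, diff_eq_fderiv hg hx, extendZero_inv hg hx]
  rfl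

lemma ball_ae_eq_openBall [NeZero n] : Ball n =ᵐ[volume] Metric.ball (0 : E n) 1 := by
  have hsphere : volume (Metric.sphere (0 : E n) 1) = 0 := Measure.addHaar_sphere _ _ _
  rw [Ball, ← Metric.ball_union_sphere]
  exact union_ae_eq_left_of_ae_eq_empty (ae_eq_empty.2 hsphere)

lemma integralTrace_eq_of_eqOn [NeZero n] {η : Fin n → E n → E n → M}
    {α : Fin n → E n → E n →L[ℝ] M}
    (h : ∀ i, ∀ x ∈ Metric.ball (0 : E n) 1, ∀ v, η i x v = α i x v) :
    integralTrace η = ∫ x in Metric.ball (0 : E n) 1, reTraceWedge (fun i => α i x) ee := by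
  rw [integralTrace, setIntegral_congr_set ball_ae_eq_openBall]
  refine setIntegral_congr_fun Metric.isOpen_ball.measurableSet fun x hx => ?_
  simp only [← re_traceWedge, traceWedge, h _ x hx]

lemma ballIntegral_eq (G : GB) {F : E 3 → M}
    (hF : ∀ x : Ball 3, F x = ((G : Ball 3 → SU2) x : M)) :
    ballIntegral G =
      -(1 / (24 * Real.pi ^ 2)) * ∫ x in Metric.ball (0 : E 3) 1, wzDensity F x := by
  rw [ballIntegral, integralTrace_eq_of_eqOn (α := fun _ => leftMC F)
    fun _ x hx v => leftForm_eq_leftMC hF hx v]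
  rfl

lemma cocycle_eq (g h : GD) {F K : E 2 → M} (hF : ∀ x : Ball 2, F x = ((g : Ball 2 → SU2) x : M))
    (hK : ∀ x : Ball 2, K x = ((h : Ball 2 → SU2) x : M)) :
    cocycle g h =
      1 / (8 * Real.pi ^ 2) * ∫ x in Metric.ball (0 : E 2) 1, crossDensity F K x := by
  rw [cocycle, integralTrace_eq_of_eqOn (α := ![leftMC F, rightMC K]) fun i x hx v => ?_]
  · have hform : ∀ x, (fun i => (![leftMC F, rightMC K] : Fin 2 → E 2 → E 2 →L[ℝ] M) i x) =
        ![leftMC F x, rightMC K x] := fun x => by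
      ext1 i
      fin_cases i <;> rfl
    simp only [hform, crossDensity]
  · fin_cases i
    · exact leftForm_eq_leftMC hF hx v
    · exact rightForm_eq_rightMC hK hx v

end ball

/-! ### The Polyakov–Wiegmann identity -/

/-- The partial derivative in the direction of a standard basis vector. -/
def pderiv {n : ℕ} {V : Type*} [NormedAddCommGroup V] [NormedSpace ℝ V] (i : Fin n)
    (F : E n → V) (x : E n) : V :=
  fderiv ℝ F x (ee i)

section pderiv

variable {n : ℕ} {V : Type*} [NormedAddCommGroup V] [NormedSpace ℝ V]

lemma contDiff_pderiv {F : E n → V} (hF : ContDiff ℝ ∞ F) (i : Fin n) :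
    ContDiff ℝ ∞ (pderiv i F) :=
  (hF.fderiv_right (m := ∞) (by norm_cast)).clm_apply contDiff_const

lemma pderiv_comm {F : E n → V} (hF : ContDiff ℝ ∞ F) (i j : Fin n) (x : E n) :
    pderiv i (pderiv j F) x = pderiv j (pderiv i F) x := by
  have hd : DifferentiableAt ℝ (fderiv ℝ F) x :=
    ((hF.fderiv_right (m := ∞) (by norm_cast)).differentiable (by simp)) x
  have hsecond : ∀ k l : Fin n,
      pderiv k (pderiv l F) x = fderiv ℝ (fderiv ℝ F) x (ee k) (ee l) := by
    intro k l
    have h : HasFDerivAt (pderiv l F) ((fderiv ℝ (fderiv ℝ F) x).flip (ee l)) x :=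
      hd.hasFDerivAt.clm_apply (hasFDerivAt_const (ee l) x) |>.congr_fderiv (by ext; simp)
    rw [pderiv, h.fderiv]
    rfl
  rw [hsecond, hsecond]
  exact (hF.contDiffAt (x := x)).isSymmSndFDerivAt
    (by simp only [minSmoothness_of_isRCLikeNormedField]; exact WithTop.coe_le_coe.2 le_top)
    (ee i) (ee j)

lemma pderiv_sub {A B : E n → V} {x : E n} (hA : DifferentiableAt ℝ A x)
    (hB : DifferentiableAt ℝ B x) (i : Fin n) :
    pderiv i (fun y => A y - B y) x = pderiv i A x - pderiv i B x := by
  rw [pderiv, fderiv_fun_sub hA hB]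
  rfl

lemma pderiv_mul {A B : E n → M} {x : E n} (hA : DifferentiableAt ℝ A x)
    (hB : DifferentiableAt ℝ B x) (i : Fin n) :
    pderiv i (fun y => A y * B y) x = pderiv i A x * B x + A x * pderiv i B x := by
  have h := hA.hasFDerivAt.mul' hB.hasFDerivAt
  exact (congrArg (fun L => L (ee i)) h.fderiv).trans
    (add_comm (A x * pderiv i B x) (pderiv i A x * B x))

lemma pderiv_clm_comp {W : Type*} [NormedAddCommGroup W] [NormedSpace ℝ W] (L : V →L[ℝ] W)
    {F : E n → V} {x : E n} (hF : DifferentiableAt ℝ F x) (i : Fin n) :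
    pderiv i (fun y => L (F y)) x = L (pderiv i F x) :=
  congrArg (fun A => A (ee i)) (L.hasFDerivAt.comp x hF.hasFDerivAt).fderiv

lemma integrable_pderiv {f : E n → ℝ} (hf : ContDiff ℝ 1 f) (hc : HasCompactSupport f)
    (i : Fin n) : Integrable (pderiv i f) :=
  ((hf.continuous_fderiv (by simp)).clm_apply
    continuous_const).integrable_of_hasCompactSupport (hc.fderiv_apply (𝕜 := ℝ) (ee i))

lemma integral_pderiv_eq_zero {f : E n → ℝ} (hf : ContDiff ℝ 1 f) (hc : HasCompactSupport f)
    (i : Fin n) : ∫ x, pderiv i f x = 0 := by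
  have hint : Integrable fun x => fderiv ℝ f x (ee i) := integrable_pderiv hf hc i
  simpa [pderiv] using
    integral_mul_fderiv_eq_neg_fderiv_mul_of_integrable (μ := volume) (𝕜 := ℝ)
      (f := fun _ : E n => (1 : ℝ)) (g := f) (v := ee i) (by simp) (by simpa using hint)
      (by simpa using hf.continuous.integrable_of_hasCompactSupport hc)
      (fun x _ => differentiableAt_const _) (fun x _ => (hf.differentiable (by simp)) x)

/-- The divergence of a vector field on `ℝⁿ`. -/
def divergence (v : Fin n → E n → ℝ) (x : E n) : ℝ := ∑ i, pderiv i (v i) x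

lemma integral_divergence_eq_zero {v : Fin n → E n → ℝ} (hv : ∀ i, ContDiff ℝ 1 (v i))
    (hc : ∀ i, HasCompactSupport (v i)) : ∫ x, divergence v x = 0 := by
  simp only [divergence]
  rw [integral_finsetSum _ fun i _ => integrable_pderiv (hv i) (hc i) i]
  exact Finset.sum_eq_zero fun i _ => integral_pderiv_eq_zero (hv i) (hc i) i

end pderiv

/-- Taking adjoints, as a continuous real linear map. -/
def conjTransposeCLM : M →L[ℝ] M :=
  LinearMap.toContinuousLinearMap
    { toFun := fun A => Aᴴ
      map_add' := fun A B => Matrix.conjTranspose_add A B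
      map_smul' := fun c A => by ext i j; simp }

/-- The real part of the trace, as a continuous real linear map. -/
def reTraceCLM : M →L[ℝ] ℝ :=
  LinearMap.toContinuousLinearMap (Complex.reLm ∘ₗ traceLinearMap (Fin 2) ℝ ℂ)

lemma conjTranspose_mul_self_of_mem {A : M} (h : A ∈ specialUnitaryGroup (Fin 2) ℂ) :
    Aᴴ * A = 1 :=
  h.1.1

lemma mul_conjTranspose_self_of_mem {A : M} (h : A ∈ specialUnitaryGroup (Fin 2) ℂ) :
    A * Aᴴ = 1 :=
  h.1.2

lemma conjTranspose_mem {A : M} (h : A ∈ specialUnitaryGroup (Fin 2) ℂ) :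
    Aᴴ ∈ specialUnitaryGroup (Fin 2) ℂ :=
  (star (⟨A, h⟩ : SU2)).2

/-- `G` is a smooth map from `ℝⁿ` to `SU(2)`, regarded as a matrix-valued function. -/
structure SmoothSU2 {n : ℕ} (G : E n → M) : Prop where
  smooth : ContDiff ℝ ∞ G
  mem : ∀ x, G x ∈ specialUnitaryGroup (Fin 2) ℂ

namespace SmoothSU2

variable {n : ℕ} {G H : E n → M}

lemma mul (hG : SmoothSU2 G) (hH : SmoothSU2 H) : SmoothSU2 fun x => G x * H x :=
  ⟨hG.smooth.mul hH.smooth, fun x => mul_mem (hG.mem x) (hH.mem x)⟩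

lemma conjTranspose (hG : SmoothSU2 G) : SmoothSU2 fun x => (G x)ᴴ :=
  ⟨contDiff_conjTranspose.comp hG.smooth, fun x => conjTranspose_mem (hG.mem x)⟩

lemma differentiable (hG : SmoothSU2 G) : Differentiable ℝ G := hG.smooth.differentiable (by simp)

lemma conjTranspose_mul_self (hG : SmoothSU2 G) (x : E n) : (G x)ᴴ * G x = 1 :=
  conjTranspose_mul_self_of_mem (hG.mem x)

lemma mul_conjTranspose_self (hG : SmoothSU2 G) (x : E n) : G x * (G x)ᴴ = 1 :=
  mul_conjTranspose_self_of_mem (hG.mem x)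

lemma pderiv_conjTranspose (hG : SmoothSU2 G) (i : Fin n) (x : E n) :
    pderiv i (fun y => (G y)ᴴ) x = -((G x)ᴴ * pderiv i G x * (G x)ᴴ) := by
  have hprod := pderiv_mul (hG.conjTranspose.differentiable x) (hG.differentiable x) i
  have hone : (fun y => (G y)ᴴ * G y) = fun _ => 1 := funext hG.conjTranspose_mul_self
  have hzero : pderiv i (fun _ : E n => (1 : M)) x = 0 := by simp [pderiv]
  rw [hone, hzero] at hprod
  calc pderiv i (fun y => (G y)ᴴ) x = pderiv i (fun y => (G y)ᴴ) x * G x * (G x)ᴴ := by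
        rw [Matrix.mul_assoc, hG.mul_conjTranspose_self, Matrix.mul_one]
    _ = -((G x)ᴴ * pderiv i G x * (G x)ᴴ) := by
        rw [eq_neg_of_add_eq_zero_left hprod.symm, Matrix.neg_mul]

lemma contDiff_leftMC (hG : SmoothSU2 G) (i : Fin n) :
    ContDiff ℝ ∞ fun x => leftMC G x (ee i) :=
  hG.conjTranspose.smooth.mul (contDiff_pderiv hG.smooth i)

lemma contDiff_rightMC (hG : SmoothSU2 G) (i : Fin n) :
    ContDiff ℝ ∞ fun x => rightMC G x (ee i) :=
  (contDiff_pderiv hG.smooth i).mul hG.conjTranspose.smooth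

lemma pderiv_leftMC (hG : SmoothSU2 G) (i j : Fin n) (x : E n) :
    pderiv i (fun y => leftMC G y (ee j)) x =
      (G x)ᴴ * pderiv i (pderiv j G) x - leftMC G x (ee i) * leftMC G x (ee j) := by
  change pderiv i (fun y => (G y)ᴴ * pderiv j G y) x =
    _ - (G x)ᴴ * pderiv i G x * ((G x)ᴴ * pderiv j G x)
  rw [pderiv_mul (hG.conjTranspose.differentiable x)
    ((contDiff_pderiv hG.smooth j).differentiable (by simp) x), hG.pderiv_conjTranspose]
  noncomm_ring

lemma pderiv_rightMC (hG : SmoothSU2 G) (i j : Fin n) (x : E n) :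
    pderiv i (fun y => rightMC G y (ee j)) x =
      pderiv i (pderiv j G) x * (G x)ᴴ - rightMC G x (ee j) * rightMC G x (ee i) := by
  change pderiv i (fun y => pderiv j G y * (G y)ᴴ) x =
    _ - pderiv j G x * (G x)ᴴ * (pderiv i G x * (G x)ᴴ)
  rw [pderiv_mul ((contDiff_pderiv hG.smooth j).differentiable (by simp) x)
    (hG.conjTranspose.differentiable x), hG.pderiv_conjTranspose]
  noncomm_ring

lemma maurerCartan_left (hG : SmoothSU2 G) (i j : Fin n) (x : E n) :
    pderiv i (fun y => leftMC G y (ee j)) x - pderiv j (fun y => leftMC G y (ee i)) x =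
      -⁅leftMC G x (ee i), leftMC G x (ee j)⁆ := by
  rw [hG.pderiv_leftMC, hG.pderiv_leftMC, pderiv_comm hG.smooth i j, Ring.lie_def]
  abel

lemma maurerCartan_right (hG : SmoothSU2 G) (i j : Fin n) (x : E n) :
    pderiv i (fun y => rightMC G y (ee j)) x - pderiv j (fun y => rightMC G y (ee i)) x =
      ⁅rightMC G x (ee i), rightMC G x (ee j)⁆ := by
  rw [hG.pderiv_rightMC, hG.pderiv_rightMC, pderiv_comm hG.smooth i j, Ring.lie_def]
  abel

lemma leftMC_mul (hG : SmoothSU2 G) (hH : SmoothSU2 H) (i : Fin n) (x : E n) :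
    leftMC (fun y => G y * H y) x (ee i) =
      (H x)ᴴ * (leftMC G x (ee i) + rightMC H x (ee i)) * H x := by
  change (G x * H x)ᴴ * pderiv i (fun y => G y * H y) x =
    (H x)ᴴ * ((G x)ᴴ * pderiv i G x + pderiv i H x * (H x)ᴴ) * H x
  rw [pderiv_mul (hG.differentiable x) (hH.differentiable x), conjTranspose_mul]
  calc (H x)ᴴ * (G x)ᴴ * (pderiv i G x * H x + G x * pderiv i H x)
      = (H x)ᴴ * (G x)ᴴ * pderiv i G x * H x +
          (H x)ᴴ * ((G x)ᴴ * G x) * pderiv i H x := by noncomm_ring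
    _ = (H x)ᴴ * (G x)ᴴ * pderiv i G x * H x +
          (H x)ᴴ * pderiv i H x * ((H x)ᴴ * H x) := by
        rw [hH.conjTranspose_mul_self, hG.conjTranspose_mul_self]; noncomm_ring
    _ = (H x)ᴴ * ((G x)ᴴ * pderiv i G x + pderiv i H x * (H x)ᴴ) * H x := by noncomm_ring

lemma rightMC_eq_conj (hG : SmoothSU2 G) (i : Fin n) (x : E n) :
    rightMC G x (ee i) = G x * leftMC G x (ee i) * (G x)ᴴ := by
  change pderiv i G x * (G x)ᴴ = G x * ((G x)ᴴ * pderiv i G x) * (G x)ᴴ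
  rw [← Matrix.mul_assoc, hG.mul_conjTranspose_self, Matrix.one_mul]

lemma leftMC_conjTranspose (hG : SmoothSU2 G) (i : Fin n) (x : E n) :
    leftMC (fun y => (G y)ᴴ) x (ee i) = -rightMC G x (ee i) := by
  change (G x)ᴴᴴ * pderiv i (fun y => (G y)ᴴ) x = -(pderiv i G x * (G x)ᴴ)
  rw [hG.pderiv_conjTranspose, conjTranspose_conjTranspose]
  calc G x * -((G x)ᴴ * pderiv i G x * (G x)ᴴ)
      = -(G x * (G x)ᴴ * (pderiv i G x * (G x)ᴴ)) := by noncomm_ring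
    _ = -(pderiv i G x * (G x)ᴴ) := by rw [hG.mul_conjTranspose_self, Matrix.one_mul]

end SmoothSU2

/-- The cubic form `Re tr (A [B, C])`, the structure constants of the Lie algebra of `SU(2)`. -/
def triple (A B C : M) : ℝ := (trace (A * ⁅B, C⁆)).re

lemma triple_conj {U A B C : M} (hU : U * Uᴴ = 1) :
    triple (Uᴴ * A * U) (Uᴴ * B * U) (Uᴴ * C * U) = triple A B C := by
  have hconj : Uᴴ * A * U * ⁅Uᴴ * B * U, Uᴴ * C * U⁆ = Uᴴ * (A * ⁅B, C⁆) * U := by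
    simp only [Ring.lie_def]
    calc Uᴴ * A * U * (Uᴴ * B * U * (Uᴴ * C * U) - Uᴴ * C * U * (Uᴴ * B * U))
        = Uᴴ * A * (U * Uᴴ) * B * (U * Uᴴ) * C * U -
            Uᴴ * A * (U * Uᴴ) * C * (U * Uᴴ) * B * U := by noncomm_ring
      _ = Uᴴ * (A * (B * C - C * B)) * U := by rw [hU]; noncomm_ring
  rw [triple, hconj, trace_mul_comm, ← Matrix.mul_assoc, hU, Matrix.one_mul, triple]

lemma triple_neg (A B C : M) : triple (-A) (-B) (-C) = -triple A B C := by
  simp [triple, Ring.lie_def]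

lemma triple_add (a b : Fin 3 → M) :
    triple (a 0 + b 0) (a 1 + b 1) (a 2 + b 2) =
      triple (a 0) (a 1) (a 2) + triple (b 0) (b 1) (b 2) +
        ∑ k, (trace (⁅a k, a (k + 1)⁆ * b (k + 2) + a k * ⁅b (k + 1), b (k + 2)⁆)).re := by
  simp only [Fin.sum_univ_three, Fin.isValue, Fin.reduceAdd, triple, Ring.lie_def,
    ← Complex.add_re]
  congr 1
  simp only [trace_fin_two, mul_apply, Fin.sum_univ_two, Matrix.sub_apply, Matrix.add_apply]
  ring

lemma wzDensity_eq_triple (F : E 3 → M) (x : E 3) :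
    wzDensity F x = 3 * triple (leftMC F x (ee 0)) (leftMC F x (ee 1)) (leftMC F x (ee 2)) :=
  reTraceWedge_three _

/-- The coefficients of the 2-form `Re tr (G⁻¹dG ∧ dH H⁻¹)` on `ℝⁿ`. -/
def crossCoeff {n : ℕ} (G H : E n → M) (i j : Fin n) (x : E n) : ℝ :=
  (trace (leftMC G x (ee i) * rightMC H x (ee j) - leftMC G x (ee j) * rightMC H x (ee i))).re

lemma crossDensity_eq_crossCoeff (F K : E 2 → M) (x : E 2) :
    crossDensity F K x = crossCoeff F K 0 1 x :=
  reTraceWedge_two _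

namespace SmoothSU2

lemma wzDensity_eq_triple_rightMC {G : E 3 → M} (hG : SmoothSU2 G) (x : E 3) :
    wzDensity G x =
      3 * triple (rightMC G x (ee 0)) (rightMC G x (ee 1)) (rightMC G x (ee 2)) := by
  have h := triple_conj (U := (G x)ᴴ) (A := leftMC G x (ee 0)) (B := leftMC G x (ee 1))
    (C := leftMC G x (ee 2)) (by simpa using hG.conjTranspose_mul_self x)
  simp only [conjTranspose_conjTranspose] at h
  simp only [wzDensity_eq_triple, hG.rightMC_eq_conj, h]

lemma wzDensity_conjTranspose {G : E 3 → M} (hG : SmoothSU2 G) (x : E 3) :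
    wzDensity (fun y => (G y)ᴴ) x = -wzDensity G x := by
  rw [wzDensity_eq_triple, hG.wzDensity_eq_triple_rightMC]
  simp only [hG.leftMC_conjTranspose, triple_neg, mul_neg]

variable {n : ℕ} {G H : E n → M}

lemma contDiff_crossCoeff (hG : SmoothSU2 G) (hH : SmoothSU2 H) (i j : Fin n) :
    ContDiff ℝ ∞ (crossCoeff G H i j) :=
  reTraceCLM.contDiff.comp
    (((hG.contDiff_leftMC i).mul (hH.contDiff_rightMC j)).sub
      ((hG.contDiff_leftMC j).mul (hH.contDiff_rightMC i)))

lemma pderiv_crossCoeff (hG : SmoothSU2 G) (hH : SmoothSU2 H) (k i j : Fin n) (x : E n) :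
    pderiv k (crossCoeff G H i j) x = (trace (
      pderiv k (fun y => leftMC G y (ee i)) x * rightMC H x (ee j) +
      leftMC G x (ee i) * pderiv k (fun y => rightMC H y (ee j)) x -
      (pderiv k (fun y => leftMC G y (ee j)) x * rightMC H x (ee i) +
      leftMC G x (ee j) * pderiv k (fun y => rightMC H y (ee i)) x))).re := by
  have hleft : ∀ i, DifferentiableAt ℝ (fun y => leftMC G y (ee i)) x := fun i =>
    (hG.contDiff_leftMC i).differentiable (by simp) x
  have hright : ∀ i, DifferentiableAt ℝ (fun y => rightMC H y (ee i)) x := fun i =>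
    (hH.contDiff_rightMC i).differentiable (by simp) x
  have hij := (hleft i).fun_mul (hright j)
  have hji := (hleft j).fun_mul (hright i)
  refine (pderiv_clm_comp reTraceCLM (hij.fun_sub hji) k).trans ?_
  rw [pderiv_sub hij hji, pderiv_mul (hleft i) (hright j), pderiv_mul (hleft j) (hright i)]
  rfl

lemma divergence_crossCoeff {G H : E 3 → M} (hG : SmoothSU2 G) (hH : SmoothSU2 H) (x : E 3) :
    divergence (fun k => crossCoeff G H (k + 1) (k + 2)) x =
      -∑ k : Fin 3, (trace (
        ⁅leftMC G x (ee k), leftMC G x (ee (k + 1))⁆ * rightMC H x (ee (k + 2)) +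
        leftMC G x (ee k) * ⁅rightMC H x (ee (k + 1)), rightMC H x (ee (k + 2))⁆)).re := by
  simp only [← neg_eq_iff_eq_neg.2 (hG.maurerCartan_left _ _ x), ← hH.maurerCartan_right,
    divergence, pderiv_crossCoeff hG hH, Fin.sum_univ_three, Fin.isValue, Fin.reduceAdd,
    ← Complex.add_re, ← Complex.neg_re, ← trace_add, ← trace_neg]
  congr 2
  noncomm_ring

/-- The Polyakov–Wiegmann identity. -/
lemma wzDensity_mul {G H : E 3 → M} (hG : SmoothSU2 G) (hH : SmoothSU2 H) (x : E 3) :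
    wzDensity (fun y => G y * H y) x = wzDensity G x + wzDensity H x -
      3 * divergence (fun k => crossCoeff G H (k + 1) (k + 2)) x := by
  rw [divergence_crossCoeff hG hH, wzDensity_eq_triple, hG.leftMC_mul hH, hG.leftMC_mul hH,
    hG.leftMC_mul hH, triple_conj (hH.mul_conjTranspose_self x),
    triple_add (fun i => leftMC G x (ee i)) fun i => rightMC H x (ee i), wzDensity_eq_triple,
    hH.wzDensity_eq_triple_rightMC]
  ring

end SmoothSU2

/-! ### The flattening map -/

/-- The denominator `t + e(t)` of the flattening map, with a smooth `e ≥ 0` that is positive exactly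
for `t < 1/2`: the quotient `t / (t + e(t))` increases from `0` to `1` on `[0, 1/2]` and then stays
`1`. -/
def flatDenom (t : ℝ) : ℝ := t + expNegInvGlue (1 / 2 - t)

lemma flatDenom_pos {t : ℝ} (ht : 0 ≤ t) : 0 < flatDenom t := by
  rcases ht.eq_or_lt with rfl | h
  · simpa [flatDenom] using expNegInvGlue.pos_of_pos (by norm_num : (0 : ℝ) < 2⁻¹)
  · exact add_pos_of_pos_of_nonneg h (expNegInvGlue.nonneg _)

lemma contDiff_flatDenom : ContDiff ℝ ∞ flatDenom :=
  contDiff_id.add (expNegInvGlue.contDiff.comp (contDiff_const.sub contDiff_id))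

lemma deriv_flatDenom_le (t : ℝ) : deriv flatDenom t ≤ 1 := by
  have hd : DifferentiableAt ℝ flatDenom t := contDiff_flatDenom.differentiable (by simp) t
  have hmono : Monotone fun s => s - flatDenom s := by
    intro s s' h
    have := expNegInvGlue.monotone (by linarith : 1 / 2 - s' ≤ 1 / 2 - s)
    simp only [flatDenom]
    linarith
  have hderiv : deriv (fun s => s - flatDenom s) t = 1 - deriv flatDenom t :=
    ((hasDerivAt_id t).sub hd.hasDerivAt).deriv
  linarith [hmono.deriv_nonneg (x := t)]

/-- The scaling factor of the flattening map. -/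
def flatScale (t : ℝ) : ℝ := (Real.sqrt (flatDenom t))⁻¹

lemma flatScale_pos {t : ℝ} (ht : 0 ≤ t) : 0 < flatScale t :=
  inv_pos.2 (Real.sqrt_pos.2 (flatDenom_pos ht))

lemma contDiffAt_flatScale {t : ℝ} (ht : 0 ≤ t) : ContDiffAt ℝ ∞ flatScale t :=
  (contDiff_flatDenom.contDiffAt.sqrt (flatDenom_pos ht).ne').inv
    (Real.sqrt_pos.2 (flatDenom_pos ht)).ne'

lemma flatScale_sq {t : ℝ} (ht : 0 ≤ t) : flatScale t ^ 2 = (flatDenom t)⁻¹ := by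
  rw [flatScale, inv_pow, Real.sq_sqrt (flatDenom_pos ht).le]

lemma deriv_flatScale {t : ℝ} (ht : 0 ≤ t) :
    deriv flatScale t = -deriv flatDenom t * flatScale t ^ 3 / 2 := by
  have hpos := flatDenom_pos ht
  have hsqrt : 0 < Real.sqrt (flatDenom t) := Real.sqrt_pos.2 hpos
  have hd : HasDerivAt flatScale
      (-(deriv flatDenom t / (2 * Real.sqrt (flatDenom t))) / Real.sqrt (flatDenom t) ^ 2) t :=
    ((contDiff_flatDenom.differentiable (by simp) t).hasDerivAt.sqrt hpos.ne').inv hsqrt.ne'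
  rw [hd.deriv, flatScale]
  field_simp

lemma flatScale_radial_pos {t : ℝ} (h0 : 0 ≤ t) (h1 : t < 1 / 2) :
    0 < flatScale t + 2 * t * deriv flatScale t := by
  have hsq : flatScale t ^ 2 * flatDenom t = 1 := by
    rw [flatScale_sq h0, inv_mul_cancel₀ (flatDenom_pos h0).ne']
  have hfactor : flatScale t + 2 * t * deriv flatScale t =
      flatScale t ^ 3 * (flatDenom t - t * deriv flatDenom t) := by
    rw [deriv_flatScale h0]
    linear_combination (-flatScale t) * hsq
  rw [hfactor]
  refine mul_pos (pow_pos (flatScale_pos h0) 3) ?_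
  have hderiv : t * deriv flatDenom t ≤ t * 1 :=
    mul_le_mul_of_nonneg_left (deriv_flatDenom_le t) h0
  have hglue := expNegInvGlue.pos_of_pos (by linarith : (0 : ℝ) < 1 / 2 - t)
  simp only [flatDenom] at hderiv ⊢
  linarith

section flat

variable {n : ℕ}

/-- A smooth map of `ℝⁿ` onto the closed unit ball. It maps `{‖x‖² < 1/2}` diffeomorphically onto
the open unit ball and everything else to the unit sphere. -/
def flat (x : E n) : E n := flatScale (‖x‖ ^ 2) • x

/-- The open ball that `flat` maps diffeomorphically onto the open unit ball. -/
def core (n : ℕ) : Set (E n) := {x | ‖x‖ ^ 2 < 1 / 2}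

lemma isOpen_core : IsOpen (core n) := isOpen_lt (by fun_prop) (by fun_prop)

lemma contDiff_flat : ContDiff ℝ ∞ (flat : E n → E n) := by
  suffices h : ContDiff ℝ ∞ fun x : E n => flatScale (‖x‖ ^ 2) from h.smul contDiff_id
  rw [contDiff_iff_contDiffAt]
  intro x
  exact ContDiffAt.comp x (g := flatScale) (f := fun x : E n => ‖x‖ ^ 2)
    (contDiffAt_flatScale (sq_nonneg _)) (contDiff_norm_sq ℝ).contDiffAt

lemma norm_flat_sq (x : E n) : ‖flat x‖ ^ 2 = ‖x‖ ^ 2 / flatDenom (‖x‖ ^ 2) := by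
  rw [flat, norm_smul, mul_pow, Real.norm_eq_abs, sq_abs, flatScale_sq (sq_nonneg _)]
  ring

lemma norm_flat_le (x : E n) : ‖flat x‖ ≤ 1 := by
  rw [← sq_le_one_iff₀ (norm_nonneg _), norm_flat_sq, div_le_one (flatDenom_pos (sq_nonneg _)),
    flatDenom]
  linarith [expNegInvGlue.nonneg (1 / 2 - ‖x‖ ^ 2)]

lemma norm_flat_lt_one_iff {x : E n} : ‖flat x‖ < 1 ↔ x ∈ core n := by
  rw [← sq_lt_one_iff₀ (norm_nonneg _), norm_flat_sq, div_lt_one (flatDenom_pos (sq_nonneg _)),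
    flatDenom]
  constructor
  · intro h
    by_contra h'
    rw [expNegInvGlue.zero_of_nonpos (by simp only [core, Set.mem_ofPred_eq] at h'; linarith)] at h
    linarith
  · intro h
    have := expNegInvGlue.pos_of_pos (sub_pos.2 h)
    linarith

lemma norm_flat_eq_one {x : E n} (hx : x ∉ core n) : ‖flat x‖ = 1 :=
  le_antisymm (norm_flat_le x) (not_lt.1 fun h => hx (norm_flat_lt_one_iff.1 h))

lemma strictMonoOn_div_flatDenom : StrictMonoOn (fun t => t / flatDenom t) (Set.Ico 0 (1 / 2)) := by
  intro s hs t ht h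
  change s / flatDenom s < t / flatDenom t
  rw [div_lt_div_iff₀ (flatDenom_pos hs.1) (flatDenom_pos ht.1), flatDenom, flatDenom]
  have hanti := mul_le_mul_of_nonneg_left
    (expNegInvGlue.monotone (by linarith : 1 / 2 - t ≤ 1 / 2 - s)) hs.1
  have hpos := expNegInvGlue.pos_of_pos (by linarith [hs.2] : (0 : ℝ) < 1 / 2 - s)
  nlinarith

lemma injOn_flat : Set.InjOn (flat : E n → E n) (core n) := by
  intro x hx y hy h
  have hnorm : ‖x‖ ^ 2 = ‖y‖ ^ 2 := by
    refine strictMonoOn_div_flatDenom.injOn ⟨sq_nonneg _, hx⟩ ⟨sq_nonneg _, hy⟩ ?_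
    rw [← norm_flat_sq, ← norm_flat_sq, h]
  rw [flat, flat, hnorm] at h
  exact smul_right_injective _ (flatScale_pos (sq_nonneg _)).ne' h

lemma exists_div_flatDenom_eq {s : ℝ} (h0 : 0 ≤ s) (h1 : s < 1) :
    ∃ t, 0 ≤ t ∧ t / flatDenom t = s := by
  have hcont : ContinuousOn (fun t => t / flatDenom t) (Set.Icc 0 (1 / 2)) :=
    continuousOn_id.div contDiff_flatDenom.continuous.continuousOn
      fun t ht => (flatDenom_pos ht.1).ne'
  have hhalf : flatDenom (1 / 2) = 1 / 2 := by simp [flatDenom]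
  obtain ⟨t, ht, hts⟩ := intermediate_value_Icc (by norm_num) hcont (show s ∈ _ by
    simp only [hhalf, zero_div]; exact ⟨h0, by norm_num; linarith⟩)
  exact ⟨t, ht.1, hts⟩

lemma image_flat : flat '' core n = Metric.ball (0 : E n) 1 := by
  ext y
  rw [mem_ball_zero_iff]
  refine ⟨fun ⟨x, hx, hxy⟩ => hxy ▸ norm_flat_lt_one_iff.2 hx, fun hy => ?_⟩
  obtain ⟨t, ht, hty⟩ :=
    exists_div_flatDenom_eq (sq_nonneg ‖y‖) ((sq_lt_one_iff₀ (norm_nonneg _)).2 hy)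
  have hnorm : ‖(flatScale t)⁻¹ • y‖ ^ 2 = t := by
    rw [norm_smul, mul_pow, ← hty, Real.norm_eq_abs, sq_abs, inv_pow, flatScale_sq ht, inv_inv,
      mul_div_cancel₀ _ (flatDenom_pos ht).ne']
  have hflat : flat ((flatScale t)⁻¹ • y) = y := by
    rw [flat, hnorm, smul_smul, mul_inv_cancel₀ (flatScale_pos ht).ne', one_smul]
  exact ⟨_, norm_flat_lt_one_iff.1 (by rwa [hflat]), hflat⟩

/-- The derivative of `flat`. -/
def flatDeriv (x : E n) : E n →L[ℝ] E n :=
  flatScale (‖x‖ ^ 2) • ContinuousLinearMap.id ℝ (E n) +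
    ((deriv flatScale (‖x‖ ^ 2) * 2) • innerSL ℝ x).smulRight x

lemma hasFDerivAt_flat (x : E n) : HasFDerivAt flat (flatDeriv x) x := by
  have hnorm : HasFDerivAt (fun y : E n => ‖y‖ ^ 2) (2 • innerSL ℝ x) x :=
    (hasStrictFDerivAt_norm_sq x).hasFDerivAt
  have hscale : HasDerivAt flatScale (deriv flatScale (‖x‖ ^ 2)) (‖x‖ ^ 2) :=
    ((contDiffAt_flatScale (sq_nonneg _)).differentiableAt (by simp)).hasDerivAt
  refine ((hscale.comp_hasFDerivAt x hnorm).smul (hasFDerivAt_id x)).congr_fderiv ?_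
  ext v
  simp [flatDeriv, mul_assoc, two_mul]

lemma det_smul_id_add_smulRight {V : Type*} [NormedAddCommGroup V] [NormedSpace ℝ V]
    [FiniteDimensional ℝ V] {c : ℝ} (hc : c ≠ 0) (f : V →L[ℝ] ℝ) (v : V) :
    (c • ContinuousLinearMap.id ℝ V + f.smulRight v).det =
      c ^ Module.finrank ℝ V * (1 + f v / c) := by
  have hfactor : ((c • ContinuousLinearMap.id ℝ V + f.smulRight v : V →L[ℝ] V) : V →ₗ[ℝ] V) =
      c • LinearMap.transvection (c⁻¹ • (f : Module.Dual ℝ V)) v := by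
    ext w
    simp [LinearMap.transvection, smul_smul, hc]
  rw [ContinuousLinearMap.det, hfactor, LinearMap.det_smul, LinearMap.transvection.det]
  simp [div_eq_inv_mul]

lemma det_flatDeriv_pos {x : E n} (hx : x ∈ core n) : 0 < (flatDeriv x).det := by
  have hscale := flatScale_pos (sq_nonneg ‖x‖)
  rw [flatDeriv, det_smul_id_add_smulRight hscale.ne']
  refine mul_pos (pow_pos hscale _) ?_
  have hradial := div_pos (flatScale_radial_pos (sq_nonneg ‖x‖) hx) hscale
  rw [add_div, div_self hscale.ne'] at hradial
  convert hradial using 3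
  simp only [_root_.smul_apply, innerSL_apply_apply, real_inner_self_eq_norm_sq,
    smul_eq_mul]
  ring

lemma smoothSU2_comp_flat {g : Ball n → SU2} {F : E n → M} (hF : ContDiff ℝ ∞ F)
    (hg : ∀ x : Ball n, F x = (g x : M)) : SmoothSU2 fun x => F (flat x) :=
  ⟨hF.comp contDiff_flat, fun x => by
    rw [hg ⟨flat x, by simpa using norm_flat_le x⟩]; exact (g _).2⟩

lemma setIntegral_wzDensity_flat {F : E 3 → M} (hF : Differentiable ℝ F) :
    ∫ x in Metric.ball (0 : E 3) 1, wzDensity F x =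
      ∫ x in core 3, wzDensity (fun y => F (flat y)) x := by
  rw [← image_flat]
  exact setIntegral_wzDensity_image isOpen_core (fun x _ => hasFDerivAt_flat x) injOn_flat
    (fun _ => det_flatDeriv_pos) hF fun _ _ => rfl

lemma setIntegral_crossDensity_flat {F K : E 2 → M} (hF : Differentiable ℝ F)
    (hK : Differentiable ℝ K) :
    ∫ x in Metric.ball (0 : E 2) 1, crossDensity F K x =
      ∫ x in core 2, crossDensity (fun y => F (flat y)) (fun y => K (flat y)) x := by
  rw [← image_flat]
  exact setIntegral_crossDensity_image isOpen_core (fun x _ => hasFDerivAt_flat x) injOn_flat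
    (fun _ => det_flatDeriv_pos) hF hK (fun _ _ => rfl) fun _ _ => rfl

end flat

/-! ### Quaternions -/

/-- The complex `2 × 2` matrix of the quaternion `a + b i + c j + d k`. -/
def quat (a b c d : ℝ) : M := !![⟨a, b⟩, ⟨-c, d⟩; ⟨c, d⟩, ⟨a, -b⟩]

section quat

variable (a b c d a' b' c' d' : ℝ)

lemma quat_one : quat 1 0 0 0 = 1 := by
  ext i j
  fin_cases i <;> fin_cases j <;> apply Complex.ext <;> simp [quat]

lemma quat_add : quat a b c d + quat a' b' c' d' = quat (a + a') (b + b') (c + c') (d + d') := by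
  ext i j
  fin_cases i <;> fin_cases j <;> apply Complex.ext <;> simp [quat, add_comm]

lemma smul_quat (s : ℝ) : s • quat a b c d = quat (s * a) (s * b) (s * c) (s * d) := by
  ext i j
  fin_cases i <;> fin_cases j <;> apply Complex.ext <;> simp [quat]

lemma quat_mul : quat a b c d * quat a' b' c' d' =
    quat (a * a' - b * b' - c * c' - d * d') (a * b' + b * a' - c * d' + d * c')
      (a * c' + b * d' + c * a' - d * b') (a * d' - b * c' + c * b' + d * a') := by
  ext i j
  fin_cases i <;> fin_cases j <;> apply Complex.ext <;>
    simp [quat, mul_apply, Fin.sum_univ_two] <;> ring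

lemma conjTranspose_quat : (quat a b c d)ᴴ = quat a (-b) (-c) (-d) := by
  ext i j
  fin_cases i <;> fin_cases j <;> apply Complex.ext <;> simp [quat]

lemma det_quat : (quat a b c d).det = ((a ^ 2 + b ^ 2 + c ^ 2 + d ^ 2 : ℝ) : ℂ) := by
  rw [det_fin_two]
  apply Complex.ext
  · simp only [Complex.ofReal_re]; simp [quat]; ring
  · simp only [Complex.ofReal_im]; simp [quat]; ring

lemma adjugate_quat : (quat a b c d).adjugate = (quat a b c d)ᴴ := by
  rw [adjugate_fin_two]
  ext i j
  fin_cases i <;> fin_cases j <;> apply Complex.ext <;> simp [quat]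

lemma triple_quat (p q r p' q' r' p'' q'' r'' : ℝ) :
    triple (quat 0 p q r) (quat 0 p' q' r') (quat 0 p'' q'' r'') =
      4 * det !![p, q, r; p', q', r'; p'', q'', r''] := by
  simp [triple, Ring.lie_def, trace_fin_two, quat, det_fin_three]
  ring

variable {a b c d}

lemma quat_mem_iff :
    quat a b c d ∈ specialUnitaryGroup (Fin 2) ℂ ↔ a ^ 2 + b ^ 2 + c ^ 2 + d ^ 2 = 1 := by
  constructor
  · intro h
    have hdet : (quat a b c d).det = 1 := h.2
    rw [det_quat] at hdet
    exact_mod_cast hdet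
  · intro h
    have hdet : (quat a b c d).det = 1 := by rw [det_quat, h, Complex.ofReal_one]
    refine ⟨⟨?_, ?_⟩, hdet⟩
    · rw [star_eq_conjTranspose, ← adjugate_quat, adjugate_mul, hdet, one_smul]
    · rw [star_eq_conjTranspose, ← adjugate_quat, mul_adjugate, hdet, one_smul]

end quat

/-- The real algebra of quaternions, as a subalgebra of the complex `2 × 2` matrices. -/
def quaternions : Subalgebra ℝ M where
  carrier := {A | ∃ a b c d, A = quat a b c d}
  mul_mem' := by
    rintro _ _ ⟨a, b, c, d, rfl⟩ ⟨a', b', c', d', rfl⟩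
    exact ⟨_, _, _, _, quat_mul ..⟩
  add_mem' := by
    rintro _ _ ⟨a, b, c, d, rfl⟩ ⟨a', b', c', d', rfl⟩
    exact ⟨_, _, _, _, quat_add ..⟩
  algebraMap_mem' s := ⟨s, 0, 0, 0, by
    rw [Algebra.algebraMap_eq_smul_one, ← quat_one, smul_quat, mul_one, mul_zero]⟩

lemma mem_quaternions_of_mem {A : M} (h : A ∈ specialUnitaryGroup (Fin 2) ℂ) :
    A ∈ quaternions := by
  have hadj : Aᴴ = A.adjugate := by
    calc Aᴴ = Aᴴ * (A * A.adjugate) := by rw [mul_adjugate, show A.det = 1 from h.2]; simp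
      _ = A.adjugate := by
        rw [← Matrix.mul_assoc, conjTranspose_mul_self_of_mem h, Matrix.one_mul]
  rw [adjugate_fin_two] at hadj
  have h01 : star (A 1 0) = -A 0 1 := congrFun (congrFun hadj 0) 1
  have h00 : star (A 0 0) = A 1 1 := congrFun (congrFun hadj 0) 0
  refine ⟨(A 0 0).re, (A 0 0).im, (A 1 0).re, (A 1 0).im, ?_⟩
  ext i j
  fin_cases i <;> fin_cases j
  · rfl
  · simp only [Fin.zero_eta, Fin.mk_one, show A 0 1 = -star (A 1 0) by rw [h01, neg_neg]]
    apply Complex.ext <;> simp [quat]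
  · rfl
  · simp only [Fin.mk_one, ← h00]
    apply Complex.ext <;> simp [quat]

lemma conjTranspose_mem_quaternions {A : M} (h : A ∈ quaternions) : Aᴴ ∈ quaternions := by
  obtain ⟨a, b, c, d, rfl⟩ := h
  exact ⟨_, _, _, _, conjTranspose_quat ..⟩

/-- The imaginary quaternions, that is, the Lie algebra `su(2)`. -/
def IsImQuat (A : M) : Prop := ∃ p q r, A = quat 0 p q r

lemma IsImQuat.of_mem_quaternions {A : M} (hA : A ∈ quaternions) (h : Aᴴ = -A) : IsImQuat A := by
  obtain ⟨a, b, c, d, rfl⟩ := hA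
  have h00 := congrArg Complex.re (congrFun (congrFun h 0) 0)
  simp only [conjTranspose_quat, Matrix.neg_apply, Complex.neg_re] at h00
  have ha : a = -a := h00
  obtain rfl : a = 0 := by linarith
  exact ⟨b, c, d, rfl⟩

lemma triple_cramer {X : M} {a : Fin 3 → M} (hX : IsImQuat X) (ha : ∀ i, IsImQuat (a i)) :
    ∑ k, triple X (a (k + 1)) (a (k + 2)) • a k = triple (a 0) (a 1) (a 2) • X := by
  obtain ⟨p, q, r, rfl⟩ := hX
  choose u v w huvw using ha
  simp only [Fin.sum_univ_three, Fin.isValue, Fin.reduceAdd, huvw, triple_quat, det_fin_three,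
    smul_quat, quat_add]
  simp only [of_apply, cons_val', cons_val_zero, cons_val_one, cons_val_fin_one, cons_val,
    mul_zero, add_zero]
  congr 1 <;> ring

section

variable {n : ℕ}

lemma pderiv_mem {V : Type*} [NormedAddCommGroup V] [NormedSpace ℝ V] (S : Submodule ℝ V)
    [FiniteDimensional ℝ S] {F : E n → V} (hF : Differentiable ℝ F) (hS : ∀ x, F x ∈ S)
    (i : Fin n) (x : E n) : pderiv i F x ∈ S := by
  have hline : pderiv i F x ∈ Set.range (deriv fun t : ℝ => F (x + t • ee i)) :=
    ⟨0, (hF x).lineDeriv_eq_fderiv⟩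
  refine closure_minimal ?_ S.closed_of_finiteDimensional
    (range_deriv_subset_closure_span_image _ dense_univ hline)
  refine Submodule.span_le.2 ?_
  rintro _ ⟨t, -, rfl⟩
  exact hS _

namespace SmoothSU2

variable {G H : E n → M}

lemma mem_quaternions (hG : SmoothSU2 G) (x : E n) : G x ∈ quaternions :=
  mem_quaternions_of_mem (hG.mem x)

lemma pderiv_mem_quaternions (hG : SmoothSU2 G) (i : Fin n) (x : E n) :
    pderiv i G x ∈ quaternions :=
  pderiv_mem quaternions.toSubmodule hG.differentiable hG.mem_quaternions i x

lemma isImQuat_leftMC (hG : SmoothSU2 G) (i : Fin n) (x : E n) : IsImQuat (leftMC G x (ee i)) := by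
  refine .of_mem_quaternions (mul_mem (conjTranspose_mem_quaternions (hG.mem_quaternions x))
    (hG.pderiv_mem_quaternions i x)) ?_
  have hderiv : (pderiv i G x)ᴴ = -((G x)ᴴ * pderiv i G x * (G x)ᴴ) :=
    (pderiv_clm_comp conjTransposeCLM (hG.differentiable x) i).symm.trans
      (hG.pderiv_conjTranspose i x)
  change ((G x)ᴴ * pderiv i G x)ᴴ = -((G x)ᴴ * pderiv i G x)
  rw [conjTranspose_mul, conjTranspose_conjTranspose, hderiv, Matrix.neg_mul,
    Matrix.mul_assoc, hG.conjTranspose_mul_self, Matrix.mul_one]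

lemma pderiv_eq_mul_leftMC (hG : SmoothSU2 G) (i : Fin n) (x : E n) :
    pderiv i G x = G x * leftMC G x (ee i) := by
  change _ = G x * ((G x)ᴴ * pderiv i G x)
  rw [← Matrix.mul_assoc, hG.mul_conjTranspose_self, Matrix.one_mul]

end SmoothSU2

end

/-! ### Bi-invariance of the volume form -/

section

variable {n : ℕ}

lemma divergence_mul {f : E n → ℝ} {v : Fin n → E n → ℝ} {x : E n} (hf : DifferentiableAt ℝ f x)
    (hv : ∀ i, DifferentiableAt ℝ (v i) x) :
    divergence (fun i y => f y * v i y) x = ∑ i, pderiv i f x * v i x + f x * divergence v x := by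
  rw [divergence, divergence, Finset.mul_sum, ← Finset.sum_add_distrib]
  refine Finset.sum_congr rfl fun i _ => ?_
  rw [pderiv, fderiv_fun_mul hf (hv i)]
  change f x * pderiv i (v i) x + v i x * pderiv i f x = _
  ring

lemma hasCompactSupport_pderiv {V : Type*} [NormedAddCommGroup V] [NormedSpace ℝ V] {F : E n → V}
    (hc : HasCompactSupport (fderiv ℝ F)) (i : Fin n) : HasCompactSupport (pderiv i F) :=
  hc.comp_left (g := fun L : E n →L[ℝ] V => L (ee i)) rfl

lemma hasCompactSupport_fderiv_clm_comp {V W : Type*} [NormedAddCommGroup V] [NormedSpace ℝ V]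
    [NormedAddCommGroup W] [NormedSpace ℝ W] (L : V →L[ℝ] W) {F : E n → V}
    (hF : Differentiable ℝ F) (hc : HasCompactSupport (fderiv ℝ F)) :
    HasCompactSupport (fderiv ℝ fun x => L (F x)) := by
  have hcomp : (fderiv ℝ fun x => L (F x)) = (fun A => L.comp A) ∘ fderiv ℝ F :=
    funext fun x => (L.hasFDerivAt.comp x (hF x).hasFDerivAt).fderiv
  rw [hcomp]
  exact hc.comp_left L.comp_zero

lemma hasCompactSupport_leftMC {G : E n → M} (hc : HasCompactSupport (fderiv ℝ G)) (i : Fin n) :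
    HasCompactSupport fun x => leftMC G x (ee i) :=
  (hasCompactSupport_pderiv hc i).mul_left (f := fun x => (G x)ᴴ)

lemma hasCompactSupport_wzDensity {G : E 3 → M} (hc : HasCompactSupport (fderiv ℝ G)) :
    HasCompactSupport (wzDensity G) :=
  (hasCompactSupport_leftMC hc 0).mono fun x hx (h0 : leftMC G x (ee 0) = 0) => hx <| by
    rw [wzDensity_eq_triple, h0, triple, Matrix.zero_mul, trace_zero, Complex.zero_re, mul_zero]

end

/-- The curl of a vector field on `ℝ³`, with cyclic indices. -/
def curl (v : Fin 3 → E 3 → ℝ) (i : Fin 3) (x : E 3) : ℝ :=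
  pderiv (i + 1) (v (i + 2)) x - pderiv (i + 2) (v (i + 1)) x

section curl

variable {v : Fin 3 → E 3 → ℝ}

lemma contDiff_curl (hv : ∀ i, ContDiff ℝ ∞ (v i)) (i : Fin 3) : ContDiff ℝ ∞ (curl v i) :=
  (contDiff_pderiv (hv _) _).sub (contDiff_pderiv (hv _) _)

lemma hasCompactSupport_curl (hv : ∀ i, HasCompactSupport (v i)) (i : Fin 3) :
    HasCompactSupport (curl v i) :=
  (hasCompactSupport_pderiv ((hv _).fderiv (𝕜 := ℝ)) _).sub
    (hasCompactSupport_pderiv ((hv _).fderiv (𝕜 := ℝ)) _)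

lemma divergence_curl (hv : ∀ i, ContDiff ℝ ∞ (v i)) (x : E 3) : divergence (curl v) x = 0 := by
  have hpderiv : ∀ i, pderiv i (curl v i) x =
      pderiv i (pderiv (i + 1) (v (i + 2))) x - pderiv i (pderiv (i + 2) (v (i + 1))) x := fun i =>
    pderiv_sub ((contDiff_pderiv (hv _) _).differentiable (by simp) x)
      ((contDiff_pderiv (hv _) _).differentiable (by simp) x) i
  have hcomm := fun i j k : Fin 3 => pderiv_comm (hv k) i j x
  simp only [divergence, hpderiv, Fin.sum_univ_three, Fin.isValue, Fin.reduceAdd]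
  rw [hcomm 1 2 0, hcomm 0 2 1, hcomm 0 1 2]
  ring

end curl

/-- The components of the real 1-form `Re tr (X G⁻¹dG)`. -/
def leftComponent {n : ℕ} (X : M) (G : E n → M) (i : Fin n) (x : E n) : ℝ :=
  (trace (X * leftMC G x (ee i))).re

lemma hasCompactSupport_leftComponent {n : ℕ} {G : E n → M}
    (hc : HasCompactSupport (fderiv ℝ G)) (X : M) (i : Fin n) :
    HasCompactSupport (leftComponent X G i) :=
  (hasCompactSupport_leftMC hc i).mono fun x hx (h0 : leftMC G x (ee i) = 0) => hx <| by
    rw [leftComponent, h0, Matrix.mul_zero, trace_zero, Complex.zero_re]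

namespace SmoothSU2

section

variable {n : ℕ} {G : E n → M}

lemma contDiff_leftComponent (hG : SmoothSU2 G) (X : M) (i : Fin n) :
    ContDiff ℝ ∞ (leftComponent X G i) :=
  reTraceCLM.contDiff.comp (contDiff_const.mul (hG.contDiff_leftMC i))

lemma pderiv_leftComponent (hG : SmoothSU2 G) (X : M) (i j : Fin n) (x : E n) :
    pderiv i (leftComponent X G j) x =
      (trace (X * pderiv i (fun y => leftMC G y (ee j)) x)).re :=
  pderiv_clm_comp (reTraceCLM.comp (ContinuousLinearMap.mul ℝ M X))
    ((hG.contDiff_leftMC j).differentiable (by simp) x) i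

lemma pderiv_comp (hG : SmoothSU2 G) {F : M → ℝ} (hF : Differentiable ℝ F) (i : Fin n)
    (x : E n) : pderiv i (fun y => F (G y)) x = fderiv ℝ F (G x) (G x * leftMC G x (ee i)) := by
  rw [← hG.pderiv_eq_mul_leftMC]
  exact congrArg (fun L => L (ee i))
    ((hF (G x)).hasFDerivAt.comp x (hG.differentiable x).hasFDerivAt).fderiv

lemma mul_const (hG : SmoothSU2 G) {A : M} (hA : A ∈ specialUnitaryGroup (Fin 2) ℂ) :
    SmoothSU2 fun x => G x * A :=
  hG.mul ⟨contDiff_const, fun _ => hA⟩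

lemma leftMC_mul_const (hG : SmoothSU2 G) {A : M} (hA : A ∈ specialUnitaryGroup (Fin 2) ℂ)
    (i : Fin n) (x : E n) :
    leftMC (fun y => G y * A) x (ee i) = Aᴴ * leftMC G x (ee i) * A := by
  have hzero : rightMC (fun _ : E n => A) x (ee i) = 0 := by
    change fderiv ℝ (fun _ => A) x (ee i) * Aᴴ = 0
    rw [fderiv_const_apply]
    exact Matrix.zero_mul Aᴴ
  rw [hG.leftMC_mul (H := fun _ => A) ⟨contDiff_const, fun _ => hA⟩, hzero, add_zero]

end

variable {G H K : E 3 → M}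

lemma continuous_wzDensity (hG : SmoothSU2 G) : Continuous (wzDensity G) := by
  have hcont := fun i => (hG.contDiff_leftMC i).continuous
  rw [funext (wzDensity_eq_triple G)]
  simp only [triple, Ring.lie_def]
  exact continuous_const.mul (reTraceCLM.continuous.comp ((hcont 0).mul
    (((hcont 1).mul (hcont 2)).sub ((hcont 2).mul (hcont 1)))))

lemma wzDensity_mul_const (hG : SmoothSU2 G) {A : M} (hA : A ∈ specialUnitaryGroup (Fin 2) ℂ)
    (x : E 3) : wzDensity (fun y => G y * A) x = wzDensity G x := by
  simp only [wzDensity_eq_triple, hG.leftMC_mul_const hA,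
    triple_conj (mul_conjTranspose_self_of_mem hA)]

lemma curl_leftComponent (hG : SmoothSU2 G) (X : M) (i : Fin 3) (x : E 3) :
    curl (leftComponent X G) i x =
      -triple X (leftMC G x (ee (i + 1))) (leftMC G x (ee (i + 2))) := by
  rw [curl, hG.pderiv_leftComponent, hG.pderiv_leftComponent, ← Complex.sub_re, ← trace_sub,
    ← Matrix.mul_sub, hG.maurerCartan_left, Matrix.mul_neg, trace_neg, Complex.neg_re, triple]

/-- `tr (G⁻¹dG)³` is proportional to a bi-invariant volume form, so contracting it with the
left-invariant field of `X` gives, up to a constant, the exact 2-form `d Re tr (X G⁻¹dG)`. -/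
lemma fderiv_mul_wzDensity (hG : SmoothSU2 G) {F : M → ℝ} (hF : ContDiff ℝ ∞ F) {X : M}
    (hX : IsImQuat X) (x : E 3) :
    fderiv ℝ F (G x) (G x * X) * wzDensity G x =
      -3 * divergence (fun i y => F (G y) * curl (leftComponent X G) i y) x := by
  have hcurl := contDiff_curl (hG.contDiff_leftComponent X)
  rw [divergence_mul (f := fun y => F (G y)) ((hF.comp hG.smooth).differentiable (by simp) x)
    fun i => (hcurl i).differentiable (by simp) x, divergence_curl (hG.contDiff_leftComponent X),
    mul_zero, add_zero, wzDensity_eq_triple]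
  have hcramer := congrArg (fun A => fderiv ℝ F (G x) (G x * A))
    (triple_cramer (a := fun i => leftMC G x (ee i)) hX fun i => hG.isImQuat_leftMC i x)
  simp only [Finset.mul_sum, mul_smul_comm, map_sum, map_smul, smul_eq_mul] at hcramer
  simp only [hG.pderiv_comp (hF.differentiable (by simp)), hG.curl_leftComponent, mul_neg,
    Finset.sum_neg_distrib]
  simp only [mul_comm (fderiv ℝ F (G x) (G x * leftMC G x _)), hcramer]
  ring

lemma integral_fderiv_mul_wzDensity (hG : SmoothSU2 G) (hc : HasCompactSupport (fderiv ℝ G))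
    {F : M → ℝ} (hF : ContDiff ℝ ∞ F) {X : M} (hX : IsImQuat X) :
    ∫ x, fderiv ℝ F (G x) (G x * X) * wzDensity G x = 0 := by
  have hcurl := contDiff_curl (hG.contDiff_leftComponent X)
  have hcurl_supp := hasCompactSupport_curl (hasCompactSupport_leftComponent hc X)
  simp only [hG.fderiv_mul_wzDensity hF hX]
  rw [integral_const_mul, integral_divergence_eq_zero (v := fun i y => F (G y) * _)
    (fun i => ((hF.comp hG.smooth).mul (hcurl i)).of_le (by simp)) fun i => (hcurl_supp i).mul_left,
    mul_zero]

end SmoothSU2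

/-- The imaginary quaternions of norm one. -/
def IsUnitImQuat (N : M) : Prop := ∃ p q r : ℝ, p ^ 2 + q ^ 2 + r ^ 2 = 1 ∧ N = quat 0 p q r

lemma IsUnitImQuat.isImQuat {N : M} (hN : IsUnitImQuat N) : IsImQuat N :=
  let ⟨p, q, r, _, h⟩ := hN
  ⟨p, q, r, h⟩

lemma IsUnitImQuat.mul_self {N : M} (hN : IsUnitImQuat N) : N * N = -1 := by
  obtain ⟨p, q, r, hpqr, rfl⟩ := hN
  rw [quat_mul, ← neg_one_smul ℝ (1 : M), ← quat_one, smul_quat]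
  congr 1
  · linear_combination -hpqr
  all_goals ring

/-- The one-parameter subgroup `exp (θ N)` of a matrix `N` with `N² = -1`. -/
def rotation (N : M) (θ : ℝ) : M := Real.cos θ • (1 : M) + Real.sin θ • N

lemma rotation_zero (N : M) : rotation N 0 = 1 := by simp [rotation]

lemma rotation_quat (p q r θ : ℝ) : rotation (quat 0 p q r) θ =
    quat (Real.cos θ) (Real.sin θ * p) (Real.sin θ * q) (Real.sin θ * r) := by
  simp only [rotation, ← quat_one, smul_quat, quat_add, mul_one, mul_zero, add_zero, zero_add]

lemma IsUnitImQuat.rotation_mem {N : M} (hN : IsUnitImQuat N) (θ : ℝ) :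
    rotation N θ ∈ specialUnitaryGroup (Fin 2) ℂ := by
  obtain ⟨p, q, r, hpqr, rfl⟩ := hN
  rw [rotation_quat, quat_mem_iff]
  linear_combination Real.sin θ ^ 2 * hpqr + Real.sin_sq_add_cos_sq θ

lemma hasDerivAt_rotation {N : M} (hN : N * N = -1) (θ : ℝ) :
    HasDerivAt (rotation N) (rotation N θ * N) θ := by
  have hcos := (Real.hasDerivAt_cos θ).smul_const (1 : M)
  have hsin := (Real.hasDerivAt_sin θ).smul_const N
  refine (hcos.add hsin).congr_deriv ?_
  simp only [rotation, add_mul, smul_mul_assoc, one_mul, hN, smul_neg]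
  module

lemma exists_unit_mul_eq (b c d : ℝ) :
    ∃ p q r : ℝ, p ^ 2 + q ^ 2 + r ^ 2 = 1 ∧ b = √(b ^ 2 + c ^ 2 + d ^ 2) * p ∧
      c = √(b ^ 2 + c ^ 2 + d ^ 2) * q ∧ d = √(b ^ 2 + c ^ 2 + d ^ 2) * r := by
  have hsq : √(b ^ 2 + c ^ 2 + d ^ 2) ^ 2 = b ^ 2 + c ^ 2 + d ^ 2 := Real.sq_sqrt (by positivity)
  generalize √(b ^ 2 + c ^ 2 + d ^ 2) = s at hsq ⊢
  rcases eq_or_ne s 0 with rfl | hs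
  · refine ⟨1, 0, 0, by norm_num, ?_, ?_, ?_⟩ <;>
      nlinarith [sq_nonneg b, sq_nonneg c, sq_nonneg d]
  · refine ⟨b / s, c / s, d / s, ?_, ?_, ?_, ?_⟩
    · field_simp
      exact hsq.symm
    all_goals field_simp

lemma exists_rotation_eq {A : M} (hA : A ∈ specialUnitaryGroup (Fin 2) ℂ) :
    ∃ N θ, IsUnitImQuat N ∧ rotation N θ = A := by
  obtain ⟨a, b, c, d, rfl⟩ := mem_quaternions_of_mem hA
  have hnorm := quat_mem_iff.1 hA
  obtain ⟨p, q, r, hpqr, hb, hc, hd⟩ := exists_unit_mul_eq b c d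
  have ha : a ^ 2 ≤ 1 := by nlinarith [sq_nonneg b, sq_nonneg c, sq_nonneg d]
  have hcos : Real.cos (Real.arccos a) = a :=
    Real.cos_arccos (abs_le_one_iff_mul_self_le_one.2 (by linarith [sq a]) |> abs_le.1 |>.1)
      (abs_le_one_iff_mul_self_le_one.2 (by linarith [sq a]) |> abs_le.1 |>.2)
  have hsin : Real.sin (Real.arccos a) = √(b ^ 2 + c ^ 2 + d ^ 2) := by
    rw [Real.sin_arccos]
    congr 1
    linarith
  refine ⟨quat 0 p q r, Real.arccos a, ⟨p, q, r, hpqr, rfl⟩, ?_⟩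
  rw [rotation_quat, hcos, hsin, ← hb, ← hc, ← hd]

lemma integral_intervalIntegral_swap_of_hasCompactSupport {X : Type*} [TopologicalSpace X]
    [MeasurableSpace X] [OpensMeasurableSpace X] [T2Space X] [SecondCountableTopology X]
    {μ : Measure X} [SFinite μ] [IsFiniteMeasureOnCompacts μ] {g : ℝ → X → ℝ}
    (hg : Continuous (Function.uncurry g)) {w : X → ℝ} (hw : Continuous w)
    (hc : HasCompactSupport w) (a b : ℝ) :
    ∫ s in a..b, ∫ x, g s x * w x ∂μ = ∫ x, (∫ s in a..b, g s x) * w x ∂μ := by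
  have hcont : Continuous (Function.uncurry fun s x => g s x * w x) :=
    hg.mul (hw.comp continuous_snd)
  have hcompact : IntegrableOn (Function.uncurry fun s x => g s x * w x)
      (Set.uIcc a b ×ˢ tsupport w) (volume.prod μ) :=
    hcont.continuousOn.integrableOn_compact (isCompact_uIcc.prod hc.isCompact)
  have hint : Integrable (Function.uncurry fun s x => g s x * w x)
      ((volume.restrict (Set.uIoc a b)).prod μ) := by
    rw [← Measure.restrict_univ (μ := μ), Measure.prod_restrict]
    refine (hcompact.mono_set (Set.prod_mono_left
      Set.uIoc_subset_uIcc)).of_forall_sdiff_eq_zero (measurableSet_uIoc.prod .univ) ?_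
    rintro ⟨s, x⟩ ⟨⟨hs, -⟩, hx⟩
    simp [Function.uncurry, image_eq_zero_of_notMem_tsupport fun h => hx ⟨hs, h⟩]
  rw [intervalIntegral_integral_swap hint]
  simp only [intervalIntegral.integral_mul_const]

namespace SmoothSU2

variable {G H K : E 3 → M} {F : M → ℝ}

lemma integrable_comp_mul_wzDensity (hG : SmoothSU2 G) (hc : HasCompactSupport (fderiv ℝ G))
    (hK : Continuous K) (hF : Continuous F) : Integrable fun x => F (K x) * wzDensity G x :=
  ((hF.comp hK).mul hG.continuous_wzDensity).integrable_of_hasCompactSupport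
    (hasCompactSupport_wzDensity hc).mul_left

lemma intervalIntegral_fderiv_rotation (hF : ContDiff ℝ ∞ F) {N : M} (hN : IsUnitImQuat N)
    (A : M) (θ : ℝ) :
    ∫ s in (0 : ℝ)..θ, fderiv ℝ F (A * rotation N s) (A * rotation N s * N) =
      F (A * rotation N θ) - F A := by
  have hderiv : ∀ s, HasDerivAt (fun s => A * rotation N s) (A * rotation N s * N) s := by
    intro s
    rw [mul_assoc]
    exact (hasDerivAt_rotation hN.mul_self s).const_mul A
  have hcont : Continuous fun s => A * rotation N s :=
    continuous_iff_continuousAt.2 fun s => (hderiv s).continuousAt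
  have hcont' : Continuous fun s => fderiv ℝ F (A * rotation N s) (A * rotation N s * N) :=
    ((hF.continuous_fderiv (by simp)).comp hcont).clm_apply (hcont.mul continuous_const)
  refine (intervalIntegral.integral_eq_sub_of_hasDerivAt (f := fun s => F (A * rotation N s))
    (fun s _ => (hF.differentiable (by simp) _).hasFDerivAt.comp_hasDerivAt s (hderiv s))
    (hcont'.intervalIntegrable _ _)).trans ?_
  rw [rotation_zero, mul_one]

lemma integral_fderiv_rotation_mul_wzDensity (hG : SmoothSU2 G)
    (hc : HasCompactSupport (fderiv ℝ G)) (hF : ContDiff ℝ ∞ F) {N : M} (hN : IsUnitImQuat N)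
    (s : ℝ) :
    ∫ x, fderiv ℝ F (G x * rotation N s) (G x * rotation N s * N) * wzDensity G x = 0 := by
  have hR := hN.rotation_mem s
  have hc' : HasCompactSupport (fderiv ℝ fun x => G x * rotation N s) :=
    hasCompactSupport_fderiv_clm_comp ((ContinuousLinearMap.mul ℝ M).flip (rotation N s))
      hG.differentiable hc
  simpa only [hG.wzDensity_mul_const hR] using
    (hG.mul_const hR).integral_fderiv_mul_wzDensity hc' hF hN.isImQuat

lemma integral_comp_mul_right (hG : SmoothSU2 G) (hc : HasCompactSupport (fderiv ℝ G))
    (hF : ContDiff ℝ ∞ F) {A : M} (hA : A ∈ specialUnitaryGroup (Fin 2) ℂ) :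
    ∫ x, F (G x * A) * wzDensity G x = ∫ x, F (G x) * wzDensity G x := by
  obtain ⟨N, θ, hN, rfl⟩ := exists_rotation_eq hA
  have hrot : Continuous (rotation N) := by unfold rotation; fun_prop
  have hmul : Continuous fun z : ℝ × E 3 => G z.2 * rotation N z.1 :=
    (hG.smooth.continuous.comp continuous_snd).mul (hrot.comp continuous_fst)
  have hcont : Continuous (Function.uncurry fun s x =>
      fderiv ℝ F (G x * rotation N s) (G x * rotation N s * N)) :=
    ((hF.continuous_fderiv (by simp)).comp hmul).clm_apply (hmul.mul continuous_const)
  have hswap := integral_intervalIntegral_swap_of_hasCompactSupport (μ := (volume : Measure (E 3)))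
    hcont hG.continuous_wzDensity (hasCompactSupport_wzDensity hc) 0 θ
  simp only [hG.integral_fderiv_rotation_mul_wzDensity hc hF hN,
    intervalIntegral_fderiv_rotation hF hN, intervalIntegral.integral_zero, sub_mul] at hswap
  rw [integral_sub
    (hG.integrable_comp_mul_wzDensity hc (hG.mul_const hA).smooth.continuous hF.continuous)
    (hG.integrable_comp_mul_wzDensity hc hG.smooth.continuous hF.continuous)] at hswap
  exact sub_eq_zero.1 hswap.symm

lemma integral_comp_mul_left (hG : SmoothSU2 G) (hc : HasCompactSupport (fderiv ℝ G))
    (hF : ContDiff ℝ ∞ F) {A : M} (hA : A ∈ specialUnitaryGroup (Fin 2) ℂ) :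
    ∫ x, F (A * G x) * wzDensity G x = ∫ x, F (G x) * wzDensity G x := by
  have hadj := hG.conjTranspose.integral_comp_mul_right
    (hasCompactSupport_fderiv_clm_comp conjTransposeCLM hG.differentiable hc)
    (F := fun B => F Bᴴ) (hF.comp conjTransposeCLM.contDiff) (conjTranspose_mem hA)
  simpa only [hG.wzDensity_conjTranspose, conjTranspose_mul,
    conjTranspose_conjTranspose, mul_neg, integral_neg, neg_inj] using hadj

/-- Both sides are the double integral of `F (H x * K y)`. -/
lemma integral_mul_wzDensity_proportional (hH : SmoothSU2 H) (hK : SmoothSU2 K)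
    (hHc : HasCompactSupport (fderiv ℝ H)) (hKc : HasCompactSupport (fderiv ℝ K))
    (hF : ContDiff ℝ ∞ F) :
    (∫ x, F (H x) * wzDensity H x) * ∫ x, wzDensity K x =
      (∫ x, F (K x) * wzDensity K x) * ∫ x, wzDensity H x := by
  have hcont : Continuous (Function.uncurry fun x y =>
      F (H x * K y) * (wzDensity H x * wzDensity K y)) :=
    (hF.continuous.comp ((hH.smooth.continuous.comp continuous_fst).mul
      (hK.smooth.continuous.comp continuous_snd))).mul
      ((hH.continuous_wzDensity.comp continuous_fst).mul
        (hK.continuous_wzDensity.comp continuous_snd))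
  have hsupp : HasCompactSupport (Function.uncurry fun x y =>
      F (H x * K y) * (wzDensity H x * wzDensity K y)) := by
    refine .intro ((hasCompactSupport_wzDensity hHc).isCompact.prod
      (hasCompactSupport_wzDensity hKc).isCompact) ?_
    rintro ⟨x, y⟩ hxy
    rcases not_and_or.1 hxy with hx | hy
    · simp [Function.uncurry, image_eq_zero_of_notMem_tsupport hx]
    · simp [Function.uncurry, image_eq_zero_of_notMem_tsupport hy]
  have hswap := integral_integral_swap_of_hasCompactSupport (μ := (volume : Measure (E 3)))
    (ν := (volume : Measure (E 3))) hcont hsupp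
  have hleft : ∀ x, ∫ y, F (H x * K y) * (wzDensity H x * wzDensity K y) =
      (∫ y, F (K y) * wzDensity K y) * wzDensity H x := by
    intro x
    rw [← hK.integral_comp_mul_left hKc hF (hH.mem x), ← integral_mul_const]
    congr! 2
    ring
  have hright : ∀ y, ∫ x, F (H x * K y) * (wzDensity H x * wzDensity K y) =
      (∫ x, F (H x) * wzDensity H x) * wzDensity K y := by
    intro y
    rw [← hH.integral_comp_mul_right hHc hF (hK.mem y), ← integral_mul_const]
    congr! 2
    ring
  simp only [hleft, hright, integral_const_mul] at hswap
  exact hswap.symm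

end SmoothSU2

/-! ### Local degree -/

section degree

variable {n : ℕ}

lemma exists_isOpen_injOn_det_sign {h : E n → E n} (hh : ContDiff ℝ 1 h) {x : E n}
    (hx : (fderiv ℝ h x).det ≠ 0) :
    ∃ U : Set (E n), IsOpen U ∧ x ∈ U ∧ Set.InjOn h U ∧ (∀ V ∈ 𝓝 x, h '' V ∈ 𝓝 (h x)) ∧
      ∃ s : ℤ, ∀ y ∈ U, (fderiv ℝ h y).det = s * |(fderiv ℝ h y).det| := by
  let e := (fderiv ℝ h x).toContinuousLinearEquivOfDetNeZero hx
  have hstrict : HasStrictFDerivAt h (e : E n →L[ℝ] E n) x :=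
    (hh.contDiffAt.hasStrictFDerivAt (by simp)).congr_fderiv (by ext v; simp [e])
  have hdet : Continuous fun y => (fderiv ℝ h y).det :=
    ContinuousLinearMap.continuous_det.comp (hh.continuous_fderiv (by simp))
  have himage : ∀ V ∈ 𝓝 x, h '' V ∈ 𝓝 (h x) := fun V hV => by
    rw [← hstrict.map_nhds_eq_of_equiv]
    exact Filter.image_mem_map hV
  let φ := hstrict.toOpenPartialHomeomorph h
  have hxφ : x ∈ φ.source := hstrict.mem_toOpenPartialHomeomorph_source
  rcases lt_or_gt_of_ne hx with hneg | hpos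
  · refine ⟨φ.source ∩ {y | (fderiv ℝ h y).det < 0},
      φ.open_source.inter (isOpen_lt hdet continuous_const), ⟨hxφ, hneg⟩,
      φ.injOn.mono Set.inter_subset_left, himage, -1, fun y hy => ?_⟩
    rw [abs_of_neg hy.2]
    simp
  · refine ⟨φ.source ∩ {y | 0 < (fderiv ℝ h y).det},
      φ.open_source.inter (isOpen_lt continuous_const hdet), ⟨hxφ, hpos⟩,
      φ.injOn.mono Set.inter_subset_left, himage, 1, fun y hy => ?_⟩
    rw [abs_of_pos hy.2]
    simp

lemma exists_isOpen_setIntegral_comp_mul_det {h : E n → E n} (hh : ContDiff ℝ 1 h) {x : E n}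
    (hx : (fderiv ℝ h x).det ≠ 0) :
    ∃ U : Set (E n), IsOpen U ∧ x ∈ U ∧ Set.InjOn h U ∧ ∃ s : ℤ, ∀ V ⊆ U, IsOpen V → x ∈ V →
      ∀ᶠ ε in 𝓝[>] 0, ∀ η : E n → ℝ, Function.support η ⊆ Metric.ball (h x) ε →
        ∫ y in V, η (h y) * (fderiv ℝ h y).det = s * ∫ z, η z := by
  obtain ⟨U, hU, hxU, hinj, himage, s, hs⟩ := exists_isOpen_injOn_det_sign hh hx
  refine ⟨U, hU, hxU, hinj, s, fun V hVU hV hxV => ?_⟩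
  obtain ⟨ε₀, hε₀, hball⟩ := Metric.mem_nhds_iff.1 (himage V (hV.mem_nhds hxV))
  filter_upwards [Ioc_mem_nhdsGT hε₀] with ε hε η hη
  rw [← setIntegral_eq_integral_of_forall_compl_eq_zero fun z hz => Function.notMem_support.1
      fun hne => hz (hball (Metric.ball_subset_ball hε.2 (hη hne))),
    integral_image_eq_integral_abs_det_fderiv_smul volume hV.measurableSet
      (fun y _ => (hh.differentiable (by simp) y).hasFDerivAt.hasFDerivWithinAt)
      (hinj.mono hVU) η, ← integral_const_mul]
  refine setIntegral_congr_fun hV.measurableSet fun y hy => ?_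
  simp only [smul_eq_mul]
  linear_combination η (h y) * hs y (hVU hy)

lemma finite_fiber_of_locally_injOn {X Y : Type*} [TopologicalSpace X] {h : X → Y} {P : Set X}
    {v : Y} (hP : IsCompact P) (hv : ∀ x ∈ P, h x = v)
    (hinj : ∀ x ∈ P, ∃ U, IsOpen U ∧ x ∈ U ∧ Set.InjOn h U) : P.Finite := by
  choose! U hU hxU hinj using hinj
  obtain ⟨t, ht, hcover⟩ := hP.elim_nhds_subcover U fun x hx => (hU x hx).mem_nhds (hxU x hx)
  refine t.finite_toSet.subset fun x hx => ?_
  obtain ⟨y, hy, hxy⟩ := Set.mem_iUnion₂.1 (hcover hx)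
  have hy' := ht y hy
  rwa [hinj y hy' hxy (hxU y hy') ((hv x hx).trans (hv y hy').symm)]

lemma eventually_preimage_ball_subset {X Y : Type*} [TopologicalSpace X] [MetricSpace Y]
    {h : X → Y} (hh : Continuous h) {K O : Set X} (hK : IsCompact K) (hO : IsOpen O) {v : Y}
    (hKO : ∀ x ∈ K, h x = v → x ∈ O) :
    ∀ᶠ ε in 𝓝[>] 0, ∀ x ∈ K, h x ∈ Metric.ball v ε → x ∈ O := by
  have hv : v ∈ (h '' (K \ O))ᶜ := fun ⟨x, hx, hxv⟩ => hx.2 (hKO x hx.1 hxv)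
  obtain ⟨ε₀, hε₀, hball⟩ :=
    Metric.isOpen_iff.1 ((hK.diff hO).image hh).isClosed.isOpen_compl v hv
  filter_upwards [Ioc_mem_nhdsGT hε₀] with ε hε x hx hxb
  exact by_contra fun hxO =>
    hball (Metric.ball_subset_ball hε.2 hxb) ⟨x, ⟨hx, hxO⟩, rfl⟩

lemma setIntegral_eq_sum_of_disjoint {X ι : Type*} [TopologicalSpace X] [T2Space X]
    [MeasurableSpace X] [OpensMeasurableSpace X] {μ : Measure X} [IsFiniteMeasureOnCompacts μ]
    {f : X → ℝ} (hf : Continuous f) {K W : Set X} (hK : IsCompact K) (hW : MeasurableSet W)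
    {t : Finset ι} {V : ι → Set X} (hV : ∀ i ∈ t, MeasurableSet (V i)) (hVW : ∀ i ∈ t, V i ⊆ W)
    (hdisj : (t : Set ι).PairwiseDisjoint V)
    (hsupp : ∀ x ∈ W, f x ≠ 0 → x ∈ K ∧ x ∈ ⋃ i ∈ t, V i) :
    ∫ x in W, f x ∂μ = ∑ i ∈ t, ∫ x in V i, f x ∂μ := by
  rw [setIntegral_eq_of_subset_of_forall_sdiff_eq_zero hW (Set.iUnion₂_subset hVW) fun x hx =>
      by_contra fun hne => hx.2 (hsupp x hx.1 hne).2]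
  refine integral_biUnion_finset t hV hdisj fun i hi => ?_
  refine ((hf.continuousOn.integrableOn_compact hK).mono_set
    (Set.inter_subset_right (s := V i))).of_forall_sdiff_eq_zero (hV i hi) fun y hy => ?_
  exact by_contra fun hne => hy.2 ⟨hy.1, (hsupp y (hVW i hi hy.1) hne).1⟩

/-- Cut the fibre over `v` into finitely many disjoint pieces on which `h` is injective. -/
lemma exists_local_degree {h : E n → E n} (hh : ContDiff ℝ 1 h) {W K : Set (E n)} (hW : IsOpen W)
    (hK : IsCompact K) (hKW : K ⊆ W) {v : E n}
    (hv : ∀ x ∈ W, h x = v → (fderiv ℝ h x).det ≠ 0) {ε₀ : ℝ} (hε₀ : 0 < ε₀)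
    (hproper : ∀ x ∈ W, h x ∈ Metric.ball v ε₀ → x ∈ K) :
    ∃ N : ℤ, ∃ ε > 0, ∀ η : E n → ℝ, Continuous η → Function.support η ⊆ Metric.ball v ε →
      ∫ x in W, η (h x) * (fderiv ℝ h x).det = N * ∫ y, η y := by
  let P := {x | x ∈ K ∧ h x = v}
  have hlocal := fun x (hx : x ∈ P) =>
    exists_isOpen_setIntegral_comp_mul_det hh (hv x (hKW hx.1) hx.2)
  choose! U hU hxU hinj s hs using hlocal
  have hP : P.Finite := finite_fiber_of_locally_injOn
    (hK.inter_right (isClosed_eq hh.continuous continuous_const)) (fun _ hx => hx.2)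
    fun x hx => ⟨U x, hU x hx, hxU x hx, hinj x hx⟩
  obtain ⟨D, hD, hdisj⟩ := hP.t2_separation
  let V := fun x => U x ∩ (D x ∩ W)
  have hV : ∀ x ∈ P, IsOpen (V x) := fun x hx => (hU x hx).inter ((hD x).2.inter hW)
  have hxV : ∀ x ∈ P, x ∈ V x := fun x hx => ⟨hxU x hx, (hD x).1, hKW hx.1⟩
  have hpiece := (Filter.eventually_all_finite hP).2 fun x hx =>
    hs x hx (V x) Set.inter_subset_left (hV x hx) (hxV x hx)
  have hcover := eventually_preimage_ball_subset hh.continuous hK (isOpen_biUnion hV)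
    fun x hx hxv => Set.mem_biUnion ⟨hx, hxv⟩ (hxV x ⟨hx, hxv⟩)
  obtain ⟨ε, ⟨hpiece, hcover⟩, hε, hεε₀⟩ :=
    ((hpiece.and hcover).and (Ioc_mem_nhdsGT hε₀)).exists
  refine ⟨∑ x ∈ hP.toFinset, s x, ε, hε, fun η hη hsupp => ?_⟩
  have hcont : Continuous fun x => η (h x) * (fderiv ℝ h x).det := (hη.comp hh.continuous).mul
    (ContinuousLinearMap.continuous_det.comp (hh.continuous_fderiv (by simp)))
  have hmem : ∀ x ∈ W, η (h x) * (fderiv ℝ h x).det ≠ 0 →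
      x ∈ K ∧ x ∈ ⋃ p ∈ hP.toFinset, V p := by
    intro x hx hne
    have hball := hsupp (left_ne_zero_of_mul hne)
    have hxK := hproper x hx (Metric.ball_subset_ball hεε₀ hball)
    simpa only [hP.mem_toFinset] using And.intro hxK (hcover x hxK hball)
  rw [setIntegral_eq_sum_of_disjoint hcont hK hW.measurableSet
    (fun x hx => (hV x (hP.mem_toFinset.1 hx)).measurableSet)
    (fun x _ => Set.inter_subset_right.trans Set.inter_subset_right)
    (hP.coe_toFinset.symm ▸ hdisj.mono fun x => Set.inter_subset_right.trans Set.inter_subset_left)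
    hmem, Int.cast_sum, Finset.sum_mul]
  refine Finset.sum_congr rfl fun x hx => ?_
  have hxP := hP.mem_toFinset.1 hx
  exact hpiece x hxP η (by rwa [hxP.2])

end degree

lemma det_eq_det_of_basis {n : ℕ} (L : E n →L[ℝ] E n) :
    L.det = det (of fun i j => L (ee j) i) := by
  rw [ContinuousLinearMap.det, ← LinearMap.det_toMatrix (EuclideanSpace.basisFun (Fin n) ℝ).toBasis]
  congr 1
  ext i j
  simp [LinearMap.toMatrix_apply]

/-- The scalar part `a` of the quaternion `a + b i + c j + d k`, extended to all matrices. -/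
def scalPart : M →L[ℝ] ℝ :=
  LinearMap.toContinuousLinearMap
    { toFun := fun A => (A 0 0).re
      map_add' := fun A B => by simp
      map_smul' := fun c A => by simp }

/-- The vector part `(b, c, d)` of the quaternion `a + b i + c j + d k`, extended to all
matrices. -/
def vecPart : M →L[ℝ] E 3 :=
  LinearMap.toContinuousLinearMap
    { toFun := fun A => !₂[(A 0 0).im, (A 1 0).re, (A 1 0).im]
      map_add' := fun A B => by ext i; fin_cases i <;> simp
      map_smul' := fun c A => by ext i; fin_cases i <;> simp }

lemma scalPart_quat (a b c d : ℝ) : scalPart (quat a b c d) = a := rfl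

lemma vecPart_quat (a b c d : ℝ) : vecPart (quat a b c d) = !₂[b, c, d] := rfl

lemma scalPart_sq_add_norm_vecPart_sq {A : M} (hA : A ∈ specialUnitaryGroup (Fin 2) ℂ) :
    scalPart A ^ 2 + ‖vecPart A‖ ^ 2 = 1 := by
  obtain ⟨a, b, c, d, rfl⟩ := mem_quaternions_of_mem hA
  rw [← quat_mem_iff.1 hA, scalPart_quat, vecPart_quat, EuclideanSpace.norm_sq_eq]
  simp [Fin.sum_univ_three]
  ring

lemma scalPart_eq_neg_sqrt {A : M} (hA : A ∈ specialUnitaryGroup (Fin 2) ℂ)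
    (h : scalPart A < 0) : scalPart A = -√(1 - ‖vecPart A‖ ^ 2) := by
  rw [← scalPart_sq_add_norm_vecPart_sq hA, add_sub_cancel_right, Real.sqrt_sq_eq_abs,
    abs_of_neg h, neg_neg]

lemma eq_neg_one_of_vecPart_eq_zero {A : M} (hA : A ∈ specialUnitaryGroup (Fin 2) ℂ)
    (h : scalPart A < 0) (hv : vecPart A = 0) : A = -1 := by
  have ha := scalPart_eq_neg_sqrt hA h
  obtain ⟨a, b, c, d, rfl⟩ := mem_quaternions_of_mem hA
  rw [vecPart_quat] at hv
  obtain rfl : b = 0 := congrArg (· 0) hv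
  obtain rfl : c = 0 := congrArg (· 1) hv
  obtain rfl : d = 0 := congrArg (· 2) hv
  rw [vecPart_quat, hv, scalPart_quat, norm_zero] at ha
  rw [← quat_one, ← neg_one_smul ℝ, smul_quat, ha]
  simp

lemma exists_quat_of_norm_vecPart_lt_one {v : E 3} (hv : ‖v‖ < 1) :
    ∃ A ∈ specialUnitaryGroup (Fin 2) ℂ, scalPart A < 0 ∧ vecPart A = v := by
  have hpos : 0 < 1 - ‖v‖ ^ 2 := by nlinarith [norm_nonneg v]
  refine ⟨quat (-√(1 - ‖v‖ ^ 2)) (v 0) (v 1) (v 2), ?_, ?_, ?_⟩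
  · rw [quat_mem_iff, neg_sq, Real.sq_sqrt hpos.le, EuclideanSpace.norm_sq_eq]
    simp only [Real.norm_eq_abs, sq_abs, Fin.sum_univ_three]
    ring
  · exact neg_lt_zero.2 (Real.sqrt_pos.2 hpos)
  · rw [vecPart_quat]
    ext i
    fin_cases i <;> rfl

lemma det_vecPart_quat_mul {a b c d : ℝ} (h : a ^ 2 + b ^ 2 + c ^ 2 + d ^ 2 = 1)
    (p q r : Fin 3 → ℝ) :
    det (of fun i j => vecPart (quat a b c d * quat 0 (p j) (q j) (r j)) i) =
      a * det !![p 0, q 0, r 0; p 1, q 1, r 1; p 2, q 2, r 2] := by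
  simp only [quat_mul, vecPart_quat, det_fin_three, of_apply, cons_val', cons_val_zero,
    cons_val_one, cons_val_fin_one, cons_val]
  linear_combination (a * (p 0 * q 1 * r 2 - p 0 * r 1 * q 2 - q 0 * p 1 * r 2 + q 0 * r 1 * p 2
    + r 0 * p 1 * q 2 - r 0 * q 1 * p 2)) * h

namespace SmoothSU2

variable {H : E 3 → M}

lemma scalPart_mul_wzDensity (hH : SmoothSU2 H) (x : E 3) :
    scalPart (H x) * wzDensity H x = 12 * (fderiv ℝ (fun y => vecPart (H y)) x).det := by
  choose p q r hpqr using fun i => hH.isImQuat_leftMC i x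
  obtain ⟨a, b, c, d, habcd⟩ := hH.mem_quaternions x
  have hmem := hH.mem x
  rw [habcd, quat_mem_iff] at hmem
  have hfderiv : ∀ j, fderiv ℝ (fun y => vecPart (H y)) x (ee j) =
      vecPart (quat a b c d * quat 0 (p j) (q j) (r j)) := fun j => by
    rw [← hpqr, ← habcd, ← hH.pderiv_eq_mul_leftMC]
    exact pderiv_clm_comp vecPart (hH.differentiable x) j
  simp only [det_eq_det_of_basis, hfderiv, det_vecPart_quat_mul hmem, wzDensity_eq_triple, hpqr,
    triple_quat]
  rw [habcd, scalPart_quat]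
  ring

end SmoothSU2

/-- The open set where a map to the unit quaternions takes values in the hemisphere around `-1`. -/
def lowerSet (H : E 3 → M) : Set (E 3) := {x | scalPart (H x) < 0}

namespace SmoothSU2

variable {H : E 3 → M}

lemma isOpen_lowerSet (hH : SmoothSU2 H) : IsOpen (lowerSet H) :=
  isOpen_lt (scalPart.continuous.comp hH.smooth.continuous) continuous_const

lemma integral_comp_scalPart_mul_wzDensity (hH : SmoothSU2 H) {ψ : ℝ → ℝ}
    (hψ : ∀ s, 0 ≤ s → ψ s = 0) :
    ∫ x, scalPart (H x) * ψ (scalPart (H x)) * wzDensity H x = 12 * ∫ x in lowerSet H,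
      ψ (-√(1 - ‖vecPart (H x)‖ ^ 2)) * (fderiv ℝ (fun y => vecPart (H y)) x).det := by
  rw [← integral_const_mul, ← setIntegral_eq_integral_of_forall_compl_eq_zero (s := lowerSet H)]
  · refine setIntegral_congr_fun hH.isOpen_lowerSet.measurableSet fun x hx => ?_
    simp only [← scalPart_eq_neg_sqrt (hH.mem x) hx]
    linear_combination ψ (scalPart (H x)) * hH.scalPart_mul_wzDensity x
  · intro x hx
    rw [hψ _ (not_lt.1 hx), mul_zero, zero_mul]

lemma exists_local_degree_lowerSet (hH : SmoothSU2 H) {δ : ℝ} (hδ : 0 < δ) (hδ1 : δ < 1)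
    (hK : IsCompact {x | scalPart (H x) ≤ -δ}) (hreg : ∀ x, H x = -1 → wzDensity H x ≠ 0) :
    ∃ N : ℤ, ∃ ε > 0, ∀ η : E 3 → ℝ, Continuous η → Function.support η ⊆ Metric.ball 0 ε →
      ∫ x in lowerSet H, η (vecPart (H x)) * (fderiv ℝ (fun y => vecPart (H y)) x).det =
        N * ∫ y, η y := by
  have hδsq : 0 < 1 - δ ^ 2 := by nlinarith
  refine exists_local_degree ((vecPart.contDiff.comp hH.smooth).of_le (by simp))
    hH.isOpen_lowerSet hK (fun x hx => lt_of_le_of_lt hx (neg_lt_zero.2 hδ))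
    (fun x hx hv hdet => ?_) (Real.sqrt_pos.2 hδsq) fun x hx hball => ?_
  · have hzero := hH.scalPart_mul_wzDensity x
    rw [show (fderiv ℝ (fun y => vecPart (H y)) x).det = 0 from hdet, mul_zero] at hzero
    exact (mul_ne_zero (ne_of_lt hx) (hreg x (eq_neg_one_of_vecPart_eq_zero (hH.mem x) hx hv)))
      hzero
  · rw [mem_ball_zero_iff, Real.lt_sqrt (norm_nonneg _)] at hball
    have hsq := scalPart_sq_add_norm_vecPart_sq (hH.mem x)
    have hx' : scalPart (H x) < 0 := hx
    change scalPart (H x) ≤ -δ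
    change ‖vecPart (H x)‖ ^ 2 < 1 - δ ^ 2 at hball
    nlinarith

/-- By Sard's theorem. -/
lemma exists_regular_value (hH : SmoothSU2 H) :
    ∃ A ∈ specialUnitaryGroup (Fin 2) ℂ, scalPart A < 0 ∧ ∀ x, H x = A → wzDensity H x ≠ 0 := by
  have hdiff : Differentiable ℝ fun x => vecPart (H x) :=
    (vecPart.contDiff.comp hH.smooth).differentiable (by simp)
  have hnull : volume ((fun x => vecPart (H x)) ''
      {x | (fderiv ℝ (fun y => vecPart (H y)) x).det = 0}) = 0 :=
    addHaar_image_eq_zero_of_det_fderivWithin_eq_zero volume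
      (fun x _ => (hdiff x).hasFDerivAt.hasFDerivWithinAt) fun x hx => hx
  obtain ⟨v, hv, hreg⟩ : (Metric.ball (0 : E 3) 1 \ (fun x => vecPart (H x)) ''
      {x | (fderiv ℝ (fun y => vecPart (H y)) x).det = 0}).Nonempty := by
    refine nonempty_of_measure_ne_zero (μ := volume) ?_
    rw [measure_sdiff_null hnull]
    exact (Metric.measure_ball_pos volume (0 : E 3) one_pos).ne'
  obtain ⟨A, hA, hAneg, rfl⟩ := exists_quat_of_norm_vecPart_lt_one (mem_ball_zero_iff.1 hv)
  refine ⟨A, hA, hAneg, fun x hx hzero => hreg ⟨x, ?_, congrArg vecPart hx⟩⟩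
  have hdet := hH.scalPart_mul_wzDensity x
  rw [hzero, mul_zero, zero_eq_mul] at hdet
  exact hdet.resolve_left (by norm_num)

end SmoothSU2

/-! ### A model map of degree one -/

/-- The angle, as a function of the squared radius, in the model map of degree one. -/
def angle (t : ℝ) : ℝ := Real.pi * Real.smoothTransition (t - 1)

lemma contDiff_angle : ContDiff ℝ ∞ angle :=
  contDiff_const.mul (Real.smoothTransition.contDiff.comp (contDiff_id.sub contDiff_const))

lemma hasDerivAt_angle (t : ℝ) : HasDerivAt angle (deriv angle t) t :=
  (contDiff_angle.differentiable (by simp) t).hasDerivAt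

lemma angle_of_le {t : ℝ} (ht : t ≤ 1) : angle t = 0 := by
  rw [angle, Real.smoothTransition.zero_of_nonpos (by linarith), mul_zero]

lemma angle_of_ge {t : ℝ} (ht : 2 ≤ t) : angle t = Real.pi := by
  rw [angle, Real.smoothTransition.one_of_one_le (by linarith), mul_one]

/-- The radial factor `sin (angle t) / √t` of the vector part of the model map, where `t` is the
squared radius. The junk value at `t ≤ 0` is harmless as `angle` vanishes there. -/
def sincAngle (t : ℝ) : ℝ := Real.sin (angle t) / √t

lemma contDiff_sincAngle : ContDiff ℝ ∞ sincAngle := by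
  rw [contDiff_iff_contDiffAt]
  intro t
  rcases lt_or_ge t 1 with h | h
  · refine (contDiffAt_const (c := (0 : ℝ))).congr_of_eventuallyEq ?_
    filter_upwards [Iio_mem_nhds h] with s hs
    rw [sincAngle, angle_of_le (le_of_lt hs), Real.sin_zero, zero_div]
  · have ht : 0 < t := by linarith
    exact (Real.contDiff_sin.comp contDiff_angle).contDiffAt.div (contDiffAt_id.sqrt ht.ne')
      (Real.sqrt_ne_zero'.2 ht)

lemma hasDerivAt_sincAngle (t : ℝ) : HasDerivAt sincAngle (deriv sincAngle t) t :=
  (contDiff_sincAngle.differentiable (by simp) t).hasDerivAt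

lemma hasDerivAt_cos_angle (t : ℝ) :
    HasDerivAt (fun s => Real.cos (angle s)) (-Real.sin (angle t) * deriv angle t) t :=
  (Real.hasDerivAt_cos _).comp t (hasDerivAt_angle t)

lemma cos_sq_add_sincAngle_sq (t : ℝ) :
    Real.cos (angle t) ^ 2 + t * sincAngle t ^ 2 = 1 := by
  rcases le_or_gt t 0 with h | h
  · simp [sincAngle, angle_of_le (h.trans zero_le_one)]
  · rw [sincAngle, div_pow, Real.sq_sqrt h.le, mul_div_cancel₀ _ h.ne', Real.cos_sq_add_sin_sq]

lemma deriv_cos_sq_add_sincAngle_sq (t : ℝ) :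
    2 * Real.cos (angle t) * (-Real.sin (angle t) * deriv angle t) + sincAngle t ^ 2 +
      2 * t * sincAngle t * deriv sincAngle t = 0 := by
  have hderiv := ((hasDerivAt_cos_angle t).pow 2).add
    ((hasDerivAt_id t).mul ((hasDerivAt_sincAngle t).pow 2))
  have hone : ((fun s => Real.cos (angle s)) ^ 2 + id * sincAngle ^ 2) = fun _ => (1 : ℝ) :=
    funext cos_sq_add_sincAngle_sq
  have hzero := (hone ▸ hderiv).unique (hasDerivAt_const t 1)
  simp only [Nat.cast_ofNat, Nat.add_one_sub_one, pow_one, one_mul, id_eq, Pi.pow_apply] at hzero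
  linear_combination hzero

/-- A quaternion determined linearly by its scalar and vector parts. -/
def quatCLM : ℝ × E 3 →L[ℝ] M :=
  LinearMap.toContinuousLinearMap
    { toFun := fun p => quat p.1 (p.2 0) (p.2 1) (p.2 2)
      map_add' := fun _ _ => (quat_add ..).symm
      map_smul' := fun _ _ => (smul_quat ..).symm }

lemma norm_sq_eq_three (x : E 3) : ‖x‖ ^ 2 = x 0 ^ 2 + x 1 ^ 2 + x 2 ^ 2 := by
  rw [EuclideanSpace.real_norm_sq_eq, Fin.sum_univ_three]

/-- The model map of degree one to the unit quaternions, constant near the origin and near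
infinity. -/
def model (x : E 3) : M :=
  quatCLM (Real.cos (angle (‖x‖ ^ 2)), sincAngle (‖x‖ ^ 2) • x)

lemma scalPart_model (x : E 3) : scalPart (model x) = Real.cos (angle (‖x‖ ^ 2)) := rfl

lemma smoothSU2_model : SmoothSU2 model where
  smooth := by
    have hnorm : ContDiff ℝ ∞ fun x : E 3 => ‖x‖ ^ 2 := contDiff_norm_sq ℝ
    exact quatCLM.contDiff.comp ((Real.contDiff_cos.comp (contDiff_angle.comp hnorm)).prodMk
      ((contDiff_sincAngle.comp hnorm).smul contDiff_id))
  mem x := by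
    have hone := cos_sq_add_sincAngle_sq (‖x‖ ^ 2)
    nth_rw 2 [norm_sq_eq_three] at hone
    change quat _ _ _ _ ∈ _
    rw [quat_mem_iff, ← hone]
    simp only [PiLp.smul_apply, smul_eq_mul]
    ring

lemma hasCompactSupport_fderiv_model : HasCompactSupport (fderiv ℝ model) := by
  refine HasCompactSupport.intro (isCompact_closedBall (0 : E 3) 2) fun x hx => ?_
  have hx' : 2 < ‖x‖ := by simpa using hx
  have hconst : model =ᶠ[𝓝 x] fun _ => quatCLM (-1, 0) := by
    filter_upwards [(isOpen_lt continuous_const continuous_norm).mem_nhds hx'] with y hy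
    have hsq : 2 ≤ ‖y‖ ^ 2 := by nlinarith [show (2 : ℝ) < ‖y‖ from hy]
    rw [model, sincAngle, angle_of_ge hsq]
    simp
  rw [hconst.fderiv_eq, fderiv_const_apply]

lemma pderiv_model (i : Fin 3) (x : E 3) : pderiv i model x =
    quatCLM (-(2 * x i * (Real.sin (angle (‖x‖ ^ 2)) * deriv angle (‖x‖ ^ 2))),
      (2 * x i * deriv sincAngle (‖x‖ ^ 2)) • x + sincAngle (‖x‖ ^ 2) • ee i) := by
  have hnorm : HasFDerivAt (fun y : E 3 => ‖y‖ ^ 2) (2 • innerSL ℝ x) x :=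
    (hasStrictFDerivAt_norm_sq x).hasFDerivAt
  have hcos := (hasDerivAt_cos_angle (‖x‖ ^ 2)).comp_hasFDerivAt x hnorm
  have hsinc := (hasDerivAt_sincAngle (‖x‖ ^ 2)).comp_hasFDerivAt x hnorm
  have hderiv := hcos.prodMk (hsinc.smul (hasFDerivAt_id x))
  have hinner : inner ℝ x (ee i) = x i := by simp [EuclideanSpace.inner_single_right]
  refine (pderiv_clm_comp quatCLM hderiv.differentiableAt i).trans (congrArg quatCLM ?_)
  rw [pderiv, hderiv.fderiv]
  simp only [neg_mul, neg_smul, ContinuousLinearMap.prod_apply, _root_.neg_apply,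
    _root_.smul_apply, innerSL_apply_apply, hinner, nsmul_eq_mul, Nat.cast_ofNat, smul_eq_mul,
    Function.comp_apply, _root_.add_apply, ContinuousLinearMap.id_apply,
    ContinuousLinearMap.smulRight_apply, id_eq, Prod.mk.injEq]
  exact ⟨by ring, by module⟩

lemma leftMC_model (i : Fin 3) (x : E 3) :
    leftMC model x (ee i) =
      let α := Real.cos (angle (‖x‖ ^ 2))
      let β := sincAngle (‖x‖ ^ 2)
      let α' := Real.sin (angle (‖x‖ ^ 2)) * deriv angle (‖x‖ ^ 2)
      let γ := 2 * x i * (α * deriv sincAngle (‖x‖ ^ 2) + β * α')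
      let e : E 3 := ee i
      quat 0 (γ * x 0 + α * β * e 0 + β ^ 2 * (x 1 * e 2 - x 2 * e 1))
        (γ * x 1 + α * β * e 1 + β ^ 2 * (x 2 * e 0 - x 0 * e 2))
        (γ * x 2 + α * β * e 2 + β ^ 2 * (x 0 * e 1 - x 1 * e 0)) := by
  extract_lets α β α' γ e
  have hinner : x 0 * e 0 + x 1 * e 1 + x 2 * e 2 = x i := by
    fin_cases i <;> simp [e]
  have hconstraint := deriv_cos_sq_add_sincAngle_sq (‖x‖ ^ 2)
  nth_rw 5 [norm_sq_eq_three] at hconstraint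
  change (quat α (β * x 0) (β * x 1) (β * x 2))ᴴ * pderiv i model x = _
  rw [pderiv_model, conjTranspose_quat]
  refine (quat_mul ..).trans ?_
  simp only [PiLp.add_apply, PiLp.smul_apply, smul_eq_mul]
  congr 1
  · linear_combination x i * hconstraint + β * β * hinner
  all_goals ring

lemma wzDensity_model (x : E 3) : wzDensity model x =
    24 * (sincAngle (‖x‖ ^ 2) * Real.sin (angle (‖x‖ ^ 2)) * deriv angle (‖x‖ ^ 2)) := by
  have hunit := cos_sq_add_sincAngle_sq (‖x‖ ^ 2)
  have hconstraint := deriv_cos_sq_add_sincAngle_sq (‖x‖ ^ 2)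
  rw [wzDensity_eq_triple, leftMC_model, leftMC_model, leftMC_model, triple_quat, det_fin_three]
  simp only [EuclideanSpace.basisFun_apply, PiLp.single_eq_same, mul_one, ne_eq, Fin.reduceEq,
    not_false_eq_true, PiLp.single_eq_of_ne, mul_zero, one_ne_zero, sub_self, add_zero, sub_zero,
    zero_sub, mul_neg, zero_ne_one, of_apply, cons_val', cons_val_zero, cons_val_fin_one,
    cons_val_one, cons_val]
  generalize sincAngle (‖x‖ ^ 2) = β at *
  generalize deriv sincAngle (‖x‖ ^ 2) = β' at *
  generalize Real.cos (angle (‖x‖ ^ 2)) = α at *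
  generalize Real.sin (angle (‖x‖ ^ 2)) = σ at *
  generalize deriv angle (‖x‖ ^ 2) = θ' at *
  rw [norm_sq_eq_three] at hunit hconstraint
  have hdet : β ^ 2 * (α ^ 2 + (x 0 ^ 2 + x 1 ^ 2 + x 2 ^ 2) * β ^ 2) *
      (α * β + 2 * (x 0 ^ 2 + x 1 ^ 2 + x 2 ^ 2) * (α * β' + σ * θ' * β)) =
      2 * β * (σ * θ') := by
    rw [hunit]
    linear_combination α * β * hconstraint + 2 * β * (σ * θ') * hunit
  linear_combination 12 * hdet

lemma integral_comp_norm_three (f : ℝ → ℝ) :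
    ∫ x : E 3, f ‖x‖ = 4 * Real.pi * ∫ r in Set.Ioi (0 : ℝ), r ^ 2 * f r := by
  have hvol : volume.real (Metric.ball (0 : E 3) 1) = Real.pi * 4 / 3 := by
    rw [Measure.real, EuclideanSpace.volume_ball_fin_three]
    simp [ENNReal.toReal_ofReal (by positivity : 0 ≤ Real.pi * 4 / 3)]
  rw [integral_fun_norm_addHaar volume f, hvol, finrank_euclideanSpace_fin]
  simp only [nsmul_eq_mul, smul_eq_mul, Nat.cast_ofNat, Nat.add_one_sub_one]
  ring

lemma integral_comp_scalPart_model_mul_wzDensity {f : ℝ → ℝ} (hf : Continuous f) :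
    ∫ x, f (scalPart (model x)) * wzDensity model x =
      48 * Real.pi * ∫ θ in 0..Real.pi, f (Real.cos θ) * Real.sin θ ^ 2 := by
  let g := fun θ => f (Real.cos θ) * Real.sin θ ^ 2
  have hg : Continuous g := (hf.comp Real.continuous_cos).mul (Real.continuous_sin.pow 2)
  have hangle : ∀ r : ℝ, HasDerivAt (fun r => angle (r ^ 2)) (deriv angle (r ^ 2) * (2 * r)) r :=
    fun r => by
      have hsq : HasDerivAt (fun r : ℝ => r ^ 2) (2 * r) r := by simpa using hasDerivAt_pow 2 r
      exact HasDerivAt.comp (h₂ := angle) r (hasDerivAt_angle (r ^ 2)) hsq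
  have hradial : ∀ r ∈ Set.Ioi (0 : ℝ), r ^ 2 * (f (Real.cos (angle (r ^ 2))) *
      (24 * (sincAngle (r ^ 2) * Real.sin (angle (r ^ 2)) * deriv angle (r ^ 2)))) =
      12 * ((g ∘ fun r => angle (r ^ 2)) r * (deriv angle (r ^ 2) * (2 * r))) := by
    intro r hr
    have hr0 : (0 : ℝ) < r := hr
    simp only [g, sincAngle, Real.sqrt_sq hr0.le, Function.comp_apply]
    field_simp
    ring
  have hzero : ∀ r ∈ Set.Ioi (0 : ℝ) \ Set.Ioc 0 2,
      12 * ((g ∘ fun r => angle (r ^ 2)) r * (deriv angle (r ^ 2) * (2 * r))) = 0 := by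
    rintro r ⟨hr0, hr⟩
    have hr2 : 2 < r := not_le.1 fun h => hr ⟨hr0, h⟩
    simp [g, angle_of_ge (by nlinarith : 2 ≤ r ^ 2)]
  simp only [scalPart_model, wzDensity_model]
  rw [integral_comp_norm_three fun r => f (Real.cos (angle (r ^ 2))) *
      (24 * (sincAngle (r ^ 2) * Real.sin (angle (r ^ 2)) * deriv angle (r ^ 2))),
    setIntegral_congr_fun measurableSet_Ioi hradial,
    setIntegral_eq_of_subset_of_forall_sdiff_eq_zero measurableSet_Ioi
      Set.Ioc_subset_Ioi_self hzero, integral_const_mul,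
    ← intervalIntegral.integral_of_le zero_le_two,
    intervalIntegral.integral_comp_mul_deriv (fun r _ => hangle r) (by
      have := contDiff_angle.continuous_deriv (by simp)
      fun_prop) hg,
    angle_of_ge (by norm_num : (2 : ℝ) ≤ 2 ^ 2), angle_of_le (by norm_num : (0 : ℝ) ^ 2 ≤ 1)]
  ring

lemma integral_wzDensity_model : ∫ x, wzDensity model x = 24 * Real.pi ^ 2 := by
  have h := integral_comp_scalPart_model_mul_wzDensity (f := fun _ => 1) continuous_const
  simp only [one_mul, integral_sin_sq, Real.sin_zero, Real.sin_pi, zero_mul, sub_zero,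
    zero_add] at h
  rw [h]
  ring

lemma intervalIntegral_cos_mul_comp_cos_mul_sin_sq {ψ : ℝ → ℝ} (hψ : Continuous ψ)
    (h0 : ∀ s, 0 ≤ s → ψ s = 0) :
    ∫ θ in 0..Real.pi, Real.cos θ * ψ (Real.cos θ) * Real.sin θ ^ 2 =
      -∫ r in (0 : ℝ)..1, r ^ 2 * ψ (-√(1 - r ^ 2)) := by
  let g := fun θ => Real.cos θ * ψ (-Real.cos θ) * Real.sin θ ^ 2
  have hg : Continuous g := by fun_prop
  have hreflect : ∫ θ in 0..Real.pi, Real.cos θ * ψ (Real.cos θ) * Real.sin θ ^ 2 =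
      -∫ θ in 0..Real.pi, g θ := by
    have h := intervalIntegral.integral_comp_sub_left (a := 0) (b := Real.pi) g Real.pi
    rw [sub_self, sub_zero] at h
    rw [← h, ← intervalIntegral.integral_neg]
    simp [g, Real.cos_pi_sub, Real.sin_pi_sub]
  have hright : ∫ θ in (Real.pi / 2)..Real.pi, g θ = 0 := by
    refine (intervalIntegral.integral_congr fun θ hθ => ?_).trans intervalIntegral.integral_zero
    rw [Set.uIcc_of_le (by linarith [Real.pi_pos])] at hθ
    have hcos := Real.cos_nonpos_of_pi_div_two_le_of_le hθ.1 (by linarith [Real.pi_pos, hθ.2])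
    simp [g, h0 _ (neg_nonneg.2 hcos)]
  have hleft : ∫ r in (0 : ℝ)..1, r ^ 2 * ψ (-√(1 - r ^ 2)) = ∫ θ in 0..(Real.pi / 2), g θ := by
    have h := intervalIntegral.integral_comp_mul_deriv (a := 0) (b := Real.pi / 2)
      (g := fun r : ℝ => r ^ 2 * ψ (-√(1 - r ^ 2))) (fun θ _ => Real.hasDerivAt_sin θ)
      Real.continuous_cos.continuousOn (by fun_prop)
    rw [Real.sin_zero, Real.sin_pi_div_two] at h
    rw [← h]
    refine intervalIntegral.integral_congr fun θ hθ => ?_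
    rw [Set.uIcc_of_le (by positivity)] at hθ
    have hcos := Real.cos_nonneg_of_neg_pi_div_two_le_of_le (by linarith [Real.pi_pos, hθ.1]) hθ.2
    have hsqrt : √(1 - Real.sin θ ^ 2) = Real.cos θ := by
      rw [← Real.cos_sq', Real.sqrt_sq hcos]
    simp only [g, Function.comp_apply, hsqrt]
    ring
  rw [hreflect, hleft, ← intervalIntegral.integral_add_adjacent_intervals
    (hg.intervalIntegrable 0 (Real.pi / 2)) (hg.intervalIntegrable _ _), hright, add_zero]

lemma integral_comp_neg_sqrt {ψ : ℝ → ℝ} (hψ : Continuous ψ) (h0 : ∀ s, 0 ≤ s → ψ s = 0) :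
    ∫ y : E 3, ψ (-√(1 - ‖y‖ ^ 2)) =
      -(4 * Real.pi * ∫ θ in 0..Real.pi, Real.cos θ * ψ (Real.cos θ) * Real.sin θ ^ 2) := by
  have hzero : ∀ r ∈ Set.Ioi (0 : ℝ) \ Set.Ioc 0 1, r ^ 2 * ψ (-√(1 - r ^ 2)) = 0 := by
    rintro r ⟨hr0, hr⟩
    have hr1 : 1 < r := not_le.1 fun h => hr ⟨hr0, h⟩
    rw [Real.sqrt_eq_zero_of_nonpos (by nlinarith), neg_zero, h0 0 le_rfl, mul_zero]
  rw [integral_comp_norm_three fun r => ψ (-√(1 - r ^ 2)),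
    setIntegral_eq_of_subset_of_forall_sdiff_eq_zero measurableSet_Ioi
      Set.Ioc_subset_Ioi_self hzero, ← intervalIntegral.integral_of_le zero_le_one,
    intervalIntegral_cos_mul_comp_cos_mul_sin_sq hψ h0, mul_neg, neg_neg]

lemma integral_scalPart_model_mul_wzDensity {ψ : ℝ → ℝ} (hψ : Continuous ψ)
    (h0 : ∀ s, 0 ≤ s → ψ s = 0) :
    ∫ x, scalPart (model x) * ψ (scalPart (model x)) * wzDensity model x =
      -(12 * ∫ y : E 3, ψ (-√(1 - ‖y‖ ^ 2))) := by
  rw [integral_comp_scalPart_model_mul_wzDensity (f := fun s => s * ψ s) (by fun_prop),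
    integral_comp_neg_sqrt hψ h0]
  ring

lemma norm_lt_of_abs_one_sub_sqrt_lt {ε : ℝ} (hε : 0 < ε) {y : E 3}
    (hy : |1 - √(1 - ‖y‖ ^ 2)| < min (ε ^ 2 / 2) (1 / 2)) : ‖y‖ < ε := by
  obtain ⟨hε2, hhalf⟩ := lt_min_iff.1 ((le_abs_self _).trans_lt hy)
  have hpos : 0 < √(1 - ‖y‖ ^ 2) := by linarith
  have hsq := Real.sq_sqrt (Real.sqrt_pos.1 hpos).le
  refine lt_of_pow_lt_pow_left₀ 2 hε.le ?_
  nlinarith [Real.sqrt_le_one.2 (by linarith [sq_nonneg ‖y‖] : 1 - ‖y‖ ^ 2 ≤ 1)]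

lemma exists_contDiff_bump_neg_one {ε : ℝ} (hε : 0 < ε) :
    ∃ ψ : ℝ → ℝ, ContDiff ℝ ∞ ψ ∧ (∀ s, 0 ≤ s → ψ s = 0) ∧
      Function.support (fun y : E 3 => ψ (-√(1 - ‖y‖ ^ 2))) ⊆ Metric.ball 0 ε ∧
      0 < ∫ y : E 3, ψ (-√(1 - ‖y‖ ^ 2)) := by
  have hr : 0 < min (ε ^ 2 / 2) (1 / 2) := by positivity
  let ψ : ContDiffBump (-1 : ℝ) := ⟨_, _, half_pos hr, half_lt_self hr⟩
  have hψ : Continuous ψ := ψ.continuous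
  have hsupp : Function.support (fun y : E 3 => ψ (-√(1 - ‖y‖ ^ 2))) ⊆ Metric.ball 0 ε := by
    intro y hy
    have hdist : -√(1 - ‖y‖ ^ 2) ∈ Metric.ball (-1 : ℝ) ψ.rOut := ψ.support_eq ▸ hy
    rw [Metric.mem_ball, Real.dist_eq, neg_sub_neg] at hdist
    exact mem_ball_zero_iff.2 (norm_lt_of_abs_one_sub_sqrt_lt hε hdist)
  refine ⟨ψ, ψ.contDiff, fun s hs => ψ.zero_of_le_dist ?_, hsupp, ?_⟩
  · rw [Real.dist_eq, abs_of_nonneg (by linarith)]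
    have : ψ.rOut ≤ 1 / 2 := min_le_right _ _
    linarith
  · refine Continuous.integral_pos_of_hasCompactSupport_nonneg_nonzero (x := 0) (by fun_prop)
      (HasCompactSupport.intro (isCompact_closedBall 0 ε) fun y hy => ?_) (fun _ => ψ.nonneg) ?_
    · exact Function.notMem_support.1 fun h => hy (Metric.ball_subset_closedBall (hsupp h))
    · simp [ψ.one_of_mem_closedBall (Metric.mem_closedBall_self ψ.rIn_pos.le)]

lemma neg_mem_of_mem {A : M} (hA : A ∈ specialUnitaryGroup (Fin 2) ℂ) :
    -A ∈ specialUnitaryGroup (Fin 2) ℂ := by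
  rw [mem_specialUnitaryGroup_iff] at hA ⊢
  refine ⟨?_, by simp [det_neg, hA.2]⟩
  exact (-(⟨A, hA.1⟩ : unitaryGroup (Fin 2) ℂ)).2

lemma scalPart_conjTranspose (A : M) : scalPart Aᴴ = scalPart A := rfl

namespace SmoothSU2

variable {H : E 3 → M}

lemma exists_int_integral_wzDensity_of_regular_neg_one (hH : SmoothSU2 H)
    (hc : HasCompactSupport (fderiv ℝ H)) {δ : ℝ} (hδ : 0 < δ) (hδ1 : δ < 1)
    (hK : IsCompact {x | scalPart (H x) ≤ -δ}) (hreg : ∀ x, H x = -1 → wzDensity H x ≠ 0) :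
    ∃ N : ℤ, ∫ x, wzDensity H x = 24 * Real.pi ^ 2 * N := by
  obtain ⟨N, ε, hε, hdegree⟩ := hH.exists_local_degree_lowerSet hδ hδ1 hK hreg
  obtain ⟨ψ, hψ, hψ0, hsupp, hpos⟩ := exists_contDiff_bump_neg_one hε
  have hψc : Continuous ψ := hψ.continuous
  have hlocal := hH.integral_comp_scalPart_mul_wzDensity hψ0
  rw [hdegree _ (by fun_prop) hsupp] at hlocal
  have hmodel := integral_scalPart_model_mul_wzDensity hψc hψ0
  have hprop := hH.integral_mul_wzDensity_proportional smoothSU2_model hc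
    hasCompactSupport_fderiv_model (F := fun A => scalPart A * ψ (scalPart A))
    (scalPart.contDiff.mul (hψ.comp scalPart.contDiff))
  rw [hlocal, hmodel, integral_wzDensity_model] at hprop
  refine ⟨-N, mul_left_cancel₀ (mul_pos (by norm_num : (0 : ℝ) < 12) hpos).ne' ?_⟩
  push_cast
  linear_combination hprop

/-- Translating a regular value with negative scalar part to `-1` pushes the value `1` at infinity
off a neighbourhood of `-1`. -/
theorem exists_int_integral_wzDensity (hH : SmoothSU2 H)
    (hc : HasCompactSupport fun x => H x - 1) :
    ∃ N : ℤ, ∫ x, wzDensity H x = 24 * Real.pi ^ 2 * N := by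
  obtain ⟨A, hA, hneg, hreg⟩ := hH.exists_regular_value
  have hB : -Aᴴ ∈ specialUnitaryGroup (Fin 2) ℂ := neg_mem_of_mem (conjTranspose_mem hA)
  have htranslate := hH.mul_const hB
  have hfderiv : HasCompactSupport (fderiv ℝ fun x => H x * -Aᴴ) := by
    have h := (hc.comp_left (g := (· * -Aᴴ)) (zero_mul _)).fderiv (𝕜 := ℝ)
    have hsub : (fun B : M => B * -Aᴴ) ∘ (fun x => H x - 1) = fun x => H x * -Aᴴ - -Aᴴ :=
      funext fun x => by rw [Function.comp_apply, sub_mul, one_mul]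
    rw [hsub] at h
    convert h using 1
    exact funext fun x => (fderiv_sub_const _).symm
  have hcompact : IsCompact {x | scalPart (H x * -Aᴴ) ≤ -(1 / 2)} := by
    refine hc.isCompact.of_isClosed_subset (isClosed_le
      (scalPart.continuous.comp htranslate.smooth.continuous) continuous_const) fun x hx => ?_
    by_contra hnot
    have hone : H x = 1 :=
      sub_eq_zero.1 (image_eq_zero_of_notMem_tsupport (f := fun x => H x - 1) hnot)
    rw [Set.mem_ofPred_eq, hone, one_mul, map_neg, scalPart_conjTranspose] at hx
    linarith
  obtain ⟨N, hN⟩ := htranslate.exists_int_integral_wzDensity_of_regular_neg_one hfderiv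
    (by norm_num) (by norm_num) hcompact fun x hx => by
      rw [hH.wzDensity_mul_const hB]
      refine hreg x ?_
      have h := congrArg (· * A) hx
      simpa [Matrix.mul_assoc, conjTranspose_mul_self_of_mem hA] using h
  exact ⟨N, by simpa only [hH.wzDensity_mul_const hB] using hN⟩

end SmoothSU2

/-! ### Fillings of the same map -/

lemma integrableOn_of_isBounded {X : Type*} [MetricSpace X] [ProperSpace X]
    [MeasurableSpace X] [OpensMeasurableSpace X] {μ : Measure X} [IsFiniteMeasureOnCompacts μ]
    {f : X → ℝ} (hf : Continuous f) {s : Set X} (hs : Bornology.IsBounded s) :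
    IntegrableOn f s μ :=
  (hf.continuousOn.integrableOn_compact hs.isCompact_closure).mono_set subset_closure

section convex

variable {n : ℕ} {s : Set (E n)}

lemma closure_compl_closure_of_convex (hs : Convex ℝ s) (ho : IsOpen s) :
    closure (closure s)ᶜ = sᶜ := by
  rcases s.eq_empty_or_nonempty with rfl | hne
  · simp
  · have hint : (interior s).Nonempty := by rwa [ho.interior_eq]
    rw [closure_compl, hs.interior_closure_eq_interior_of_nonempty_interior hint, ho.interior_eq]

lemma eq_zero_of_notMem_of_convex {V : Type*} [TopologicalSpace V] [T1Space V] [Zero V]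
    (hs : Convex ℝ s) (ho : IsOpen s) {f : E n → V} (hf : Continuous f)
    (h0 : ∀ x ∉ closure s, f x = 0) {x : E n} (hx : x ∉ s) : f x = 0 := by
  have hsub : closure (closure s)ᶜ ⊆ f ⁻¹' {0} :=
    closure_minimal (fun x hx => h0 x hx) (isClosed_singleton.preimage hf)
  rw [closure_compl_closure_of_convex hs ho] at hsub
  exact hsub hx

lemma fderiv_eq_zero_of_notMem_closure {V : Type*} [NormedAddCommGroup V] [NormedSpace ℝ V]
    {f : E n → V} {c : V} (hf : ∀ x ∉ s, f x = c) {x : E n} (hx : x ∉ closure s) :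
    fderiv ℝ f x = 0 := by
  have hconst : f =ᶠ[𝓝 x] fun _ => c := by
    filter_upwards [isClosed_closure.isOpen_compl.mem_nhds hx] with y hy
    exact hf y fun h => hy (subset_closure h)
  rw [hconst.fderiv_eq, fderiv_const_apply]

lemma setIntegral_pderiv_eq_zero (hs : Convex ℝ s) (ho : IsOpen s) (hb : Bornology.IsBounded s)
    {f : E n → ℝ} (hf : ContDiff ℝ 1 f) (h0 : ∀ x ∉ s, f x = 0) (i : Fin n) :
    ∫ x in s, pderiv i f x = 0 := by
  have hcont : Continuous (pderiv i f) :=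
    (hf.continuous_fderiv (by simp)).clm_apply continuous_const
  have hsupp : HasCompactSupport f := HasCompactSupport.intro hb.isCompact_closure fun x hx =>
    h0 x fun h => hx (subset_closure h)
  rw [← integral_pderiv_eq_zero hf hsupp i]
  refine setIntegral_eq_integral_of_forall_compl_eq_zero fun x hx => ?_
  exact eq_zero_of_notMem_of_convex hs ho hcont
    (fun y hy => by rw [pderiv, fderiv_eq_zero_of_notMem_closure h0 hy, _root_.zero_apply]) hx

lemma SmoothSU2.leftMC_eq_zero_of_notMem {H : E n → M} (hH : SmoothSU2 H) (hs : Convex ℝ s)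
    (ho : IsOpen s) (h1 : ∀ x ∉ s, H x = 1) (i : Fin n) {x : E n} (hx : x ∉ s) :
    leftMC H x (ee i) = 0 :=
  eq_zero_of_notMem_of_convex hs ho (hH.contDiff_leftMC i).continuous
    (fun y hy => by
      change (H y)ᴴ * fderiv ℝ H y (ee i) = 0
      have hfderiv : fderiv ℝ H y = 0 := fderiv_eq_zero_of_notMem_closure h1 hy
      exact (congrArg (fun L : E n →L[ℝ] M => (H y)ᴴ * L (ee i)) hfderiv).trans
        (Matrix.mul_zero _)) hx

end convex

lemma crossCoeff_eq_zero {n : ℕ} {G H : E n → M} {x : E n} {i j : Fin n}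
    (hi : leftMC G x (ee i) = 0) (hj : leftMC G x (ee j) = 0) : crossCoeff G H i j x = 0 := by
  rw [crossCoeff, hi, hj, Matrix.zero_mul, Matrix.zero_mul, sub_self, trace_zero, Complex.zero_re]

namespace SmoothSU2

variable {G H : E 3 → M} {s : Set (E 3)}

lemma setIntegral_wzDensity_mul (hG : SmoothSU2 G) (hH : SmoothSU2 H)
    (hb : Bornology.IsBounded s) :
    ∫ x in s, wzDensity (fun y => G y * H y) x =
      (∫ x in s, wzDensity G x) + (∫ x in s, wzDensity H x) -
        3 * ∑ k, ∫ x in s, pderiv k (crossCoeff G H (k + 1) (k + 2)) x := by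
  have hintG := integrableOn_of_isBounded (μ := volume) hG.continuous_wzDensity hb
  have hintH := integrableOn_of_isBounded (μ := volume) hH.continuous_wzDensity hb
  have hintk : ∀ k ∈ Finset.univ,
      IntegrableOn (pderiv k (crossCoeff G H (k + 1) (k + 2))) s := fun k _ =>
    integrableOn_of_isBounded (contDiff_pderiv (hG.contDiff_crossCoeff hH _ _) k).continuous hb
  simp only [wzDensity_mul hG hH, divergence]
  rw [integral_sub (hintG.fun_add hintH) ((integrable_finsetSum _ hintk).const_mul 3),
    integral_add hintG hintH, integral_const_mul, integral_finsetSum _ hintk]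

lemma setIntegral_wzDensity_mul_of_eq_one (hG : SmoothSU2 G) (hH : SmoothSU2 H)
    (hs : Convex ℝ s) (ho : IsOpen s) (hb : Bornology.IsBounded s) (h1 : ∀ x ∉ s, G x = 1) :
    ∫ x in s, wzDensity (fun y => G y * H y) x =
      (∫ x, wzDensity G x) + ∫ x in s, wzDensity H x := by
  have hMC := fun i x (hx : x ∉ s) => hG.leftMC_eq_zero_of_notMem hs ho h1 i hx
  have hexact : ∀ k, ∫ x in s, pderiv k (crossCoeff G H (k + 1) (k + 2)) x = 0 := fun k =>
    setIntegral_pderiv_eq_zero hs ho hb ((hG.contDiff_crossCoeff hH _ _).of_le (by simp))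
      (fun x hx => crossCoeff_eq_zero (hMC _ x hx) (hMC _ x hx)) k
  have hwhole : ∫ x in s, wzDensity G x = ∫ x, wzDensity G x :=
    setIntegral_eq_integral_of_forall_compl_eq_zero fun x hx => by
      rw [wzDensity_eq_triple, hMC 0 x hx, triple, Matrix.zero_mul, trace_zero, Complex.zero_re,
        mul_zero]
  simp only [hG.setIntegral_wzDensity_mul hH hb, hwhole, hexact, Finset.sum_const_zero, mul_zero,
    sub_zero]

end SmoothSU2

lemma core_eq_ball (n : ℕ) : core n = Metric.ball (0 : E n) √(1 / 2) := by
  ext x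
  rw [mem_ball_zero_iff, Real.lt_sqrt (norm_nonneg x)]
  rfl

lemma isBounded_core (n : ℕ) : Bornology.IsBounded (core n) :=
  core_eq_ball n ▸ Metric.isBounded_ball

lemma convex_core (n : ℕ) : Convex ℝ (core n) :=
  core_eq_ball n ▸ convex_ball _ _

lemma hasCompactSupport_sub_one {n : ℕ} {H : E n → M} (h1 : ∀ x ∉ core n, H x = 1) :
    HasCompactSupport fun x => H x - 1 :=
  HasCompactSupport.intro (isBounded_core n).isCompact_closure fun x hx => by
    rw [h1 x fun h => hx (subset_closure h), sub_self]

lemma ballIntegral_eq_core (G : GB) {F : E 3 → M} (hF : ContDiff ℝ ∞ F)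
    (hG : ∀ x : Ball 3, F x = ((G : Ball 3 → SU2) x : M)) : ballIntegral G =
      -(1 / (24 * Real.pi ^ 2)) * ∫ x in core 3, wzDensity (fun y => F (flat y)) x := by
  rw [ballIntegral_eq G hG, setIntegral_wzDensity_flat (hF.differentiable (by simp))]

theorem exists_int_ballIntegral_sub {G₁ G₂ : GB}
    (h : ∀ x : Ball 3, ‖(x : E 3)‖ = 1 → (G₁ : Ball 3 → SU2) x = (G₂ : Ball 3 → SU2) x) :
    ∃ N : ℤ, ballIntegral G₁ - ballIntegral G₂ = N := by
  obtain ⟨F₁, hF₁, hG₁⟩ := G₁.2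
  obtain ⟨F₂, hF₂, hG₂⟩ := G₂.2
  have hflat₁ := smoothSU2_comp_flat hF₁ hG₁
  have hflat₂ := smoothSU2_comp_flat hF₂ hG₂
  have hquot := hflat₁.mul hflat₂.conjTranspose
  have hone : ∀ x ∉ core 3, F₁ (flat x) * (F₂ (flat x))ᴴ = 1 := by
    intro x hx
    have hnorm := norm_flat_eq_one hx
    have hmem : flat x ∈ Ball 3 := by simpa using hnorm.le
    rw [hG₁ ⟨_, hmem⟩, h ⟨_, hmem⟩ hnorm, ← hG₂ ⟨_, hmem⟩]
    exact hflat₂.mul_conjTranspose_self x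
  have hfactor : (fun y => F₁ (flat y) * (F₂ (flat y))ᴴ * F₂ (flat y)) = fun y => F₁ (flat y) :=
    funext fun y => by
      rw [Matrix.mul_assoc, hflat₂.conjTranspose_mul_self y, Matrix.mul_one]
  obtain ⟨N, hN⟩ := hquot.exists_int_integral_wzDensity (hasCompactSupport_sub_one hone)
  have hmul := hquot.setIntegral_wzDensity_mul_of_eq_one hflat₂ (convex_core 3) isOpen_core
    (isBounded_core 3) hone
  rw [hfactor, hN] at hmul
  refine ⟨-N, ?_⟩
  rw [ballIntegral_eq_core G₁ hF₁ hG₁, ballIntegral_eq_core G₂ hF₂ hG₂, hmul]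
  push_cast
  field_simp
  ring

namespace IsFilling

variable {q : E 2 → E 3} {g : GDS1}

lemma eq_on_sphere {G₁ G₂ : GB} (h₁ : IsFilling q g G₁) (h₂ : IsFilling q g G₂) (x : Ball 3)
    (hx : ‖(x : E 3)‖ = 1) : (G₁ : Ball 3 → SU2) x = (G₂ : Ball 3 → SU2) x := by
  have hxS : (x : E 3) ∈ S2 := by simpa using hx
  obtain ⟨hin₁, hout₁⟩ := h₁ ⟨x, hxS⟩
  obtain ⟨hin₂, hout₂⟩ := h₂ ⟨x, hxS⟩
  by_cases hq : (x : E 3) ∈ q '' Metric.ball 0 1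
  · obtain ⟨z, hz, hzx⟩ := hq
    have hz' : ‖z‖ < 1 := by simpa using hz
    have hzD : z ∈ Ball 2 := Metric.ball_subset_closedBall hz
    exact (hin₁ ⟨z, hzD⟩ hz' hzx).trans (hin₂ ⟨z, hzD⟩ hz' hzx).symm
  · exact (hout₁ hq).trans (hout₂ hq).symm

end IsFilling

lemma wzCochain_eq {q : E 2 → E 3} {g : GDS1} {G : GB} (hG : IsFilling q g G) :
    wzCochain q g = ((ballIntegral G : ℝ) : AddCircle (1 : ℝ)) := by
  have hexists : ∃ G : GB, IsFilling q g G := ⟨G, hG⟩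
  rw [wzCochain, dif_pos hexists]
  obtain ⟨N, hN⟩ := exists_int_ballIntegral_sub (hexists.choose_spec.eq_on_sphere hG)
  rw [← sub_eq_zero, ← AddCircle.coe_sub, hN, AddCircle.coe_eq_zero_iff]
  exact ⟨N, by simp⟩

/-! ### Contracting a punctured `SU(2)` -/

/-- The normalization of a nonzero quaternion. -/
def unitize (A : M) : M := (√A.det.re)⁻¹ • A

lemma det_re_pos {A : M} (hA : A ∈ quaternions) (h0 : A ≠ 0) : 0 < A.det.re := by
  obtain ⟨a, b, c, d, rfl⟩ := hA
  rw [det_quat, Complex.ofReal_re]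
  by_contra! hle
  have hzero : a = 0 ∧ b = 0 ∧ c = 0 ∧ d = 0 := by
    refine ⟨?_, ?_, ?_, ?_⟩ <;> nlinarith [sq_nonneg a, sq_nonneg b, sq_nonneg c, sq_nonneg d]
  obtain ⟨rfl, rfl, rfl, rfl⟩ := hzero
  refine h0 ?_
  rw [← mul_zero (0 : ℝ), ← smul_quat, zero_smul]

lemma sqrt_smul_unitize {A : M} (hd : 0 < A.det.re) : √A.det.re • unitize A = A :=
  smul_inv_smul₀ (Real.sqrt_pos.2 hd).ne' A

lemma unitize_mem {A : M} (hA : A ∈ quaternions) (h0 : A ≠ 0) :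
    unitize A ∈ specialUnitaryGroup (Fin 2) ℂ := by
  have hd := det_re_pos hA h0
  obtain ⟨a, b, c, d, rfl⟩ := hA
  rw [unitize, smul_quat, quat_mem_iff]
  rw [det_quat, Complex.ofReal_re] at hd ⊢
  have hinv : (√(a ^ 2 + b ^ 2 + c ^ 2 + d ^ 2))⁻¹ ^ 2 * (a ^ 2 + b ^ 2 + c ^ 2 + d ^ 2) = 1 := by
    rw [inv_pow, Real.sq_sqrt hd.le, inv_mul_cancel₀ hd.ne']
  linear_combination hinv

lemma unitize_of_mem {A : M} (hA : A ∈ specialUnitaryGroup (Fin 2) ℂ) : unitize A = A := by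
  rw [unitize, show A.det = 1 from hA.2, Complex.one_re, Real.sqrt_one, inv_one, one_smul]

lemma contDiff_det_re : ContDiff ℝ ∞ fun A : M => A.det.re := by
  have hentry : ∀ i j, ContDiff ℝ ∞ fun A : M => A i j := fun i j =>
    (LinearMap.toContinuousLinearMap
      { toFun := fun A : M => A i j
        map_add' := fun _ _ => rfl
        map_smul' := fun _ _ => rfl } : M →L[ℝ] ℂ).contDiff
  simp only [det_fin_two]
  exact Complex.reCLM.contDiff.comp
    (((hentry 0 0).mul (hentry 1 1)).sub ((hentry 0 1).mul (hentry 1 0)))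

lemma contDiffAt_unitize {V : Type*} [NormedAddCommGroup V] [NormedSpace ℝ V] {A : V → M} {x : V}
    (hA : ContDiffAt ℝ ∞ A x) (hd : 0 < (A x).det.re) :
    ContDiffAt ℝ ∞ (fun y => unitize (A y)) x := by
  have hdet : ContDiffAt ℝ ∞ (fun y => (A y).det.re) x := contDiff_det_re.contDiffAt.comp x hA
  exact ((hdet.sqrt hd.ne').inv (Real.sqrt_pos.2 hd).ne').smul hA

section contraction

variable {c w : M}

lemma lineMap_mem_quaternions (hc : c ∈ specialUnitaryGroup (Fin 2) ℂ)
    (hw : w ∈ specialUnitaryGroup (Fin 2) ℂ) (s : ℝ) :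
    AffineMap.lineMap c w s ∈ quaternions := by
  rw [AffineMap.lineMap_apply_module]
  exact add_mem (quaternions.smul_mem (mem_quaternions_of_mem hc) _)
    (quaternions.smul_mem (mem_quaternions_of_mem hw) _)

lemma lineMap_ne_zero (hc : c ∈ specialUnitaryGroup (Fin 2) ℂ)
    (hw : w ∈ specialUnitaryGroup (Fin 2) ℂ) (hne : w ≠ -c) (s : ℝ) :
    AffineMap.lineMap c w s ≠ 0 := by
  rw [AffineMap.lineMap_apply_module]
  intro h
  have hopp : (1 - s) • c = -(s • w) := eq_neg_of_add_eq_zero_left h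
  have hsq : (1 - s) ^ 2 = s ^ 2 := by
    have hdet := congrArg det hopp
    simp only [← neg_smul, det_smul_of_tower, show c.det = 1 from hc.2, show w.det = 1 from hw.2,
      Fintype.card_fin, neg_sq] at hdet
    exact smul_left_injective ℝ (one_ne_zero (α := ℂ)) hdet
  have hs : 1 - s = s := by linarith
  have hs0 : s ≠ 0 := by
    rintro rfl
    norm_num at hs
  rw [hs, ← smul_neg] at hopp
  exact hne (by rw [smul_right_injective M hs0 hopp, neg_neg])

/-- A contraction of `SU(2) ∖ {-c}` to `1` that fixes `1`: the normalized segment from `c` to `w`,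
divided by that from `c` to `1`. -/
def contraction (c : M) (s : ℝ) (w : M) : M :=
  (unitize (AffineMap.lineMap c 1 s))ᴴ * unitize (AffineMap.lineMap c w s)

lemma unitize_lineMap_mem (hc : c ∈ specialUnitaryGroup (Fin 2) ℂ)
    (hw : w ∈ specialUnitaryGroup (Fin 2) ℂ) (hne : w ≠ -c) (s : ℝ) :
    unitize (AffineMap.lineMap c w s) ∈ specialUnitaryGroup (Fin 2) ℂ :=
  unitize_mem (lineMap_mem_quaternions hc hw s) (lineMap_ne_zero hc hw hne s)

lemma contraction_mem (hc : c ∈ specialUnitaryGroup (Fin 2) ℂ) (hc1 : 1 ≠ -c)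
    (hw : w ∈ specialUnitaryGroup (Fin 2) ℂ) (hne : w ≠ -c) (s : ℝ) :
    contraction c s w ∈ specialUnitaryGroup (Fin 2) ℂ :=
  mul_mem (conjTranspose_mem (unitize_lineMap_mem hc (one_mem _) hc1 s))
    (unitize_lineMap_mem hc hw hne s)

lemma contraction_one_right (hc : c ∈ specialUnitaryGroup (Fin 2) ℂ) (hc1 : 1 ≠ -c) (s : ℝ) :
    contraction c s 1 = 1 :=
  conjTranspose_mul_self_of_mem (unitize_lineMap_mem hc (one_mem _) hc1 s)

lemma contraction_zero (hc : c ∈ specialUnitaryGroup (Fin 2) ℂ) (w : M) :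
    contraction c 0 w = 1 := by
  rw [contraction, AffineMap.lineMap_apply_zero, AffineMap.lineMap_apply_zero, unitize_of_mem hc,
    conjTranspose_mul_self_of_mem hc]

lemma contraction_one (hw : w ∈ specialUnitaryGroup (Fin 2) ℂ) : contraction c 1 w = w := by
  rw [contraction, AffineMap.lineMap_apply_one, AffineMap.lineMap_apply_one, unitize_of_mem hw,
    unitize_of_mem (one_mem _), conjTranspose_one, Matrix.one_mul]

lemma contDiffAt_contraction {V : Type*} [NormedAddCommGroup V] [NormedSpace ℝ V]
    (hc : c ∈ specialUnitaryGroup (Fin 2) ℂ) (hc1 : 1 ≠ -c) {χ : V → ℝ} {U : V → M} {x : V}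
    (hχ : ContDiffAt ℝ ∞ χ x) (hU : ContDiffAt ℝ ∞ U x)
    (hUx : U x ∈ specialUnitaryGroup (Fin 2) ℂ) (hne : U x ≠ -c) :
    ContDiffAt ℝ ∞ (fun y => contraction c (χ y) (U y)) x := by
  have hline : ∀ {T : V → M}, ContDiffAt ℝ ∞ T x → T x ∈ specialUnitaryGroup (Fin 2) ℂ →
      T x ≠ -c → ContDiffAt ℝ ∞ (fun y => unitize (AffineMap.lineMap c (T y) (χ y))) x := by
    intro T hT hTx hTc
    refine contDiffAt_unitize ?_
      (det_re_pos (lineMap_mem_quaternions hc hTx _) (lineMap_ne_zero hc hTx hTc _))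
    simp only [AffineMap.lineMap_apply_module]
    exact ((contDiffAt_const.sub hχ).smul contDiffAt_const).add (hχ.smul hT)
  exact (contDiff_conjTranspose.contDiffAt.comp x
    (hline (contDiffAt_const (c := (1 : M))) (one_mem _) hc1)).mul (hline hU hUx hne)

end contraction

lemma exists_mem_specialUnitaryGroup_forall_ne {n : ℕ} (hn : n < 3) {F : E n → M}
    (hF : ContDiff ℝ ∞ F) : ∃ A ∈ specialUnitaryGroup (Fin 2) ℂ, ∀ x, F x ≠ A := by
  let coords : M →L[ℝ] ℝ × E 3 := scalPart.prod vecPart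
  let f : ℝ × E n → ℝ × E 3 := fun z => z.1 • coords (F z.2)
  have hf : ContDiff ℝ 1 f :=
    (contDiff_fst.smul (coords.contDiff.comp (hF.comp contDiff_snd))).of_le (by simp)
  have hdim : Module.finrank ℝ (ℝ × E n) < Module.finrank ℝ (ℝ × E 3) := by
    simp only [Module.finrank_prod, Module.finrank_self, finrank_euclideanSpace_fin]
    lia
  obtain ⟨p, hp⟩ := (hf.dense_compl_range_of_finrank_lt_finrank hdim).nonempty
  let A := quat p.1 (p.2 0) (p.2 1) (p.2 2)
  have hA : coords A = p := Prod.ext rfl (by ext i; fin_cases i <;> rfl)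
  have hquat : A ∈ quaternions := ⟨_, _, _, _, rfl⟩
  have h0 : A ≠ 0 := fun h => hp ⟨0, by
    change (0 : ℝ) • coords (F 0) = p
    rw [zero_smul, ← hA, h, map_zero]⟩
  refine ⟨unitize A, unitize_mem hquat h0, fun x hx => hp ⟨(√A.det.re, x), ?_⟩⟩
  change √A.det.re • coords (F x) = p
  rw [hx, ← map_smul, sqrt_smul_unitize (det_re_pos hquat h0), hA]

/-- A smooth cutoff of the radius, `0` near the origin and `1` near the unit sphere. -/
def cutoff (r : ℝ) : ℝ := Real.smoothTransition (4 * r - 1)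

lemma contDiff_cutoff : ContDiff ℝ ∞ cutoff :=
  Real.smoothTransition.contDiff.comp ((contDiff_const.mul contDiff_id).sub contDiff_const)

lemma cutoff_of_le {r : ℝ} (hr : r ≤ 1 / 4) : cutoff r = 0 :=
  Real.smoothTransition.zero_of_nonpos (by linarith)

lemma cutoff_of_ge {r : ℝ} (hr : 1 / 2 ≤ r) : cutoff r = 1 :=
  Real.smoothTransition.one_of_one_le (by linarith)

/-! ### Homotopies on a cylinder -/

/-- The projection of `ℝ³` to its last two coordinates. -/
def tail : E 3 →L[ℝ] E 2 :=
  LinearMap.toContinuousLinearMap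
    { toFun := fun z => !₂[z 1, z 2]
      map_add' := fun a b => by ext i; fin_cases i <;> simp
      map_smul' := fun c a => by ext i; fin_cases i <;> simp }

lemma tail_apply (z : E 3) : tail z = !₂[z 1, z 2] := rfl

lemma tail_ee_zero : tail (ee 0) = 0 := by
  ext i; fin_cases i <;> simp [tail_apply]

lemma tail_ee_one : tail (ee 1) = ee 0 := by
  ext i; fin_cases i <;> simp [tail_apply]

lemma tail_ee_two : tail (ee 2) = ee 1 := by
  ext i; fin_cases i <;> simp [tail_apply]

/-- The point of `ℝ³` with first coordinate `r` and last coordinates `x`. -/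
def cons (r : ℝ) (x : E 2) : E 3 := !₂[r, x 0, x 1]

@[simp] lemma cons_zero (r : ℝ) (x : E 2) : cons r x 0 = r := by simp [cons]

@[simp] lemma tail_cons (r : ℝ) (x : E 2) : tail (cons r x) = x := by
  ext i; fin_cases i <;> simp [tail_apply, cons]

@[simp] lemma cons_tail (z : E 3) : cons (z 0) (tail z) = z := by
  ext i; fin_cases i <;> simp [tail_apply, cons]

lemma cons_eq_smul_add (r : ℝ) (x : E 2) :
    cons r x = r • ee 0 + (x 0 • ee 1 + x 1 • ee 2) := by
  ext i; fin_cases i <;> simp [cons]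

lemma hasDerivAt_cons (x : E 2) (r : ℝ) : HasDerivAt (fun s => cons s x) (ee 0) r := by
  simp only [cons_eq_smul_add]
  simpa using ((hasDerivAt_id r).smul_const (ee 0 : E 3)).add_const (x 0 • ee 1 + x 1 • ee 2)

lemma continuous_cons : Continuous fun p : ℝ × E 2 => cons p.1 p.2 := by
  simp only [cons_eq_smul_add]
  fun_prop

/-- The splitting of `ℝ³` into the first and the last two coordinates. -/
def splitEquiv : E 3 ≃ᵐ ℝ × E 2 :=
  (MeasurableEquiv.toLp 2 (Fin 3 → ℝ)).symm.trans
    ((MeasurableEquiv.piFinSuccAbove (fun _ : Fin 3 => ℝ) 0).trans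
      ((MeasurableEquiv.refl ℝ).prodCongr (MeasurableEquiv.toLp 2 (Fin 2 → ℝ))))

lemma splitEquiv_apply (z : E 3) : splitEquiv z = (z 0, tail z) := by
  refine Prod.ext rfl ?_
  ext i; fin_cases i <;> rfl

lemma measurePreserving_splitEquiv : MeasurePreserving splitEquiv :=
  ((MeasurePreserving.id volume).prod (PiLp.volume_preserving_toLp (Fin 2))).comp
    ((volume_preserving_piFinSuccAbove (fun _ : Fin 3 => ℝ) 0).comp
      (EuclideanSpace.volume_preserving_symm_measurableEquiv_toLp (Fin 3)))

/-- The open half-infinite cylinder over `core 2`. -/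
def halfCyl : Set (E 3) := {z | 0 < z 0} ∩ tail ⁻¹' core 2

/-- The cylinder of height `1` over `core 2`. -/
def cyl : Set (E 3) := {z | z 0 < 1} ∩ halfCyl

lemma convex_halfCyl : Convex ℝ halfCyl :=
  ((convex_Ioi 0).linear_preimage (EuclideanSpace.proj 0 : E 3 →L[ℝ] ℝ).toLinearMap).inter
    ((convex_core 2).linear_preimage tail.toLinearMap)

lemma isOpen_halfCyl : IsOpen halfCyl :=
  (isOpen_lt continuous_const (by fun_prop)).inter (isOpen_core.preimage tail.continuous)

lemma convex_cyl : Convex ℝ cyl :=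
  ((convex_Iio 1).linear_preimage (EuclideanSpace.proj 0 : E 3 →L[ℝ] ℝ).toLinearMap).inter
    convex_halfCyl

lemma isOpen_cyl : IsOpen cyl :=
  (isOpen_lt (by fun_prop) continuous_const).inter isOpen_halfCyl

lemma isBounded_cyl : Bornology.IsBounded cyl := by
  refine isBounded_iff_forall_norm_le.2 ⟨2, fun z hz => ?_⟩
  have hlt : z 0 < 1 := hz.1
  have hpos : 0 < z 0 := hz.2.1
  have htail : ‖tail z‖ ^ 2 < 1 / 2 := hz.2.2
  have hnorm : ‖z‖ ^ 2 = z 0 ^ 2 + ‖tail z‖ ^ 2 := by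
    simp [EuclideanSpace.norm_sq_eq, Fin.sum_univ_three, tail_apply, add_assoc]
  nlinarith

lemma cyl_eq_preimage : cyl = splitEquiv ⁻¹' (Set.Ioo 0 1 ×ˢ core 2) := by
  ext z
  simp only [cyl, halfCyl, Set.mem_inter_iff, Set.mem_ofPred_eq, Set.mem_preimage,
    splitEquiv_apply, Set.mem_prod, Set.mem_Ioo]
  tauto

lemma setIntegral_cyl_pderiv_zero {f : E 3 → ℝ} (hf : ContDiff ℝ 1 f) :
    ∫ z in cyl, pderiv 0 f z = ∫ x in core 2, (f (cons 1 x) - f (cons 0 x)) := by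
  have hcont : Continuous (pderiv 0 f) :=
    (hf.continuous_fderiv (by simp)).clm_apply continuous_const
  have hsplit : ∫ z in cyl, pderiv 0 f z =
      ∫ p in Set.Ioo (0 : ℝ) 1 ×ˢ core 2, pderiv 0 f (cons p.1 p.2) := by
    rw [cyl_eq_preimage, ← measurePreserving_splitEquiv.setIntegral_preimage_emb
      splitEquiv.measurableEmbedding]
    simp only [splitEquiv_apply, cons_tail]
  have hint : IntegrableOn (fun p : ℝ × E 2 => pderiv 0 f (cons p.1 p.2))
      (Set.Ioo (0 : ℝ) 1 ×ˢ core 2) :=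
    integrableOn_of_isBounded (hcont.comp continuous_cons)
      ((Metric.isBounded_Ioo 0 1).prod (isBounded_core 2))
  rw [IntegrableOn, Measure.volume_eq_prod, ← Measure.prod_restrict] at hint
  rw [hsplit, Measure.volume_eq_prod, ← Measure.prod_restrict, integral_prod_symm _ hint]
  congr 1
  ext1 x
  rw [← integral_Ioc_eq_integral_Ioo, ← intervalIntegral.integral_of_le zero_le_one]
  refine intervalIntegral.integral_eq_sub_of_hasDerivAt (f := fun r => f (cons r x))
    (fun r _ => ?_) ?_
  · exact ((hf.differentiable one_ne_zero) (cons r x)).hasFDerivAt.comp_hasDerivAt r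
      (hasDerivAt_cons x r)
  · exact (hcont.comp (continuous_cons.comp (Continuous.prodMk_left x))).intervalIntegrable 0 1

/-- A homotopy along the first coordinate from the constant map `1` to `V`, supported in the
half-infinite cylinder and equal to `V` from height `1/2` on. -/
structure IsCylinderHomotopy (V : E 2 → M) (K : E 3 → M) : Prop where
  smoothSU2 : SmoothSU2 K
  eq_one : ∀ z ∉ halfCyl, K z = 1
  eq_end : ∀ z, 1 / 2 ≤ z 0 → K z = V (tail z)

namespace IsCylinderHomotopy

variable {V W : E 2 → M} {K L : E 3 → M}

lemma eventuallyEq (hK : IsCylinderHomotopy V K) {z : E 3} (hz : 1 / 2 < z 0) :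
    K =ᶠ[𝓝 z] V ∘ tail := by
  have hopen : IsOpen {w : E 3 | 1 / 2 < w 0} := isOpen_lt continuous_const (by fun_prop)
  filter_upwards [hopen.mem_nhds hz] with w hw using hK.eq_end w (le_of_lt hw)

lemma leftMC_eq (hK : IsCylinderHomotopy V K) (hV : Differentiable ℝ V) {z : E 3}
    (hz : 1 / 2 < z 0) : leftMC K z = (leftMC V (tail z)).comp tail :=
  leftMC_comp (hV _) tail.hasFDerivAt (hK.eventuallyEq hz)

lemma rightMC_eq (hK : IsCylinderHomotopy V K) (hV : Differentiable ℝ V) {z : E 3}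
    (hz : 1 / 2 < z 0) : rightMC K z = (rightMC V (tail z)).comp tail :=
  rightMC_comp (hV _) tail.hasFDerivAt (hK.eventuallyEq hz)

lemma crossCoeff_eq (hK : IsCylinderHomotopy V K) (hL : IsCylinderHomotopy W L)
    (hV : Differentiable ℝ V) (hW : Differentiable ℝ W) {z : E 3} (hz : 1 / 2 < z 0)
    (i j : Fin 3) : crossCoeff K L i j z =
      (trace (leftMC V (tail z) (tail (ee i)) * rightMC W (tail z) (tail (ee j)) -
        leftMC V (tail z) (tail (ee j)) * rightMC W (tail z) (tail (ee i)))).re := by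
  rw [crossCoeff, hK.leftMC_eq hV hz, hL.rightMC_eq hW hz]
  rfl

lemma crossCoeff_eq_zero_of_notMem_halfCyl (hK : IsCylinderHomotopy V K) {z : E 3}
    (hz : z ∉ halfCyl) (i j : Fin 3) : crossCoeff K L i j z = 0 :=
  have hMC := fun i =>
    hK.smoothSU2.leftMC_eq_zero_of_notMem convex_halfCyl isOpen_halfCyl hK.eq_one i hz
  crossCoeff_eq_zero (hMC i) (hMC j)

lemma crossCoeff_eq_zero_of_notMem_cyl (hK : IsCylinderHomotopy V K)
    (hL : IsCylinderHomotopy W L) (hV : Differentiable ℝ V) (hW : Differentiable ℝ W)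
    {i j : Fin 3} (hij : i = 0 ∨ j = 0) {z : E 3} (hz : z ∉ cyl) : crossCoeff K L i j z = 0 := by
  by_cases hhalf : z ∈ halfCyl
  · have hz1 : 1 ≤ z 0 := not_lt.1 fun h => hz ⟨h, hhalf⟩
    rw [hK.crossCoeff_eq hL hV hW (by linarith)]
    rcases hij with rfl | rfl <;> simp only [tail_ee_zero, map_zero, Matrix.zero_mul,
      Matrix.mul_zero, sub_self, trace_zero, Complex.zero_re]
  · exact hK.crossCoeff_eq_zero_of_notMem_halfCyl hhalf i j

lemma setIntegral_pderiv_zero_crossCoeff (hK : IsCylinderHomotopy V K)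
    (hL : IsCylinderHomotopy W L) (hV : Differentiable ℝ V) (hW : Differentiable ℝ W) :
    ∫ z in cyl, pderiv 0 (crossCoeff K L 1 2) z = ∫ x in core 2, crossDensity V W x := by
  rw [setIntegral_cyl_pderiv_zero
    ((hK.smoothSU2.contDiff_crossCoeff hL.smoothSU2 1 2).of_le (by simp))]
  congr 1
  ext1 x
  have hbot : cons 0 x ∉ halfCyl := fun h => lt_irrefl (0 : ℝ) (by simpa using h.1)
  have htop : (1 / 2 : ℝ) < cons 1 x 0 := by rw [cons_zero]; norm_num
  rw [hK.crossCoeff_eq_zero_of_notMem_halfCyl hbot, hK.crossCoeff_eq hL hV hW htop, tail_ee_one,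
    tail_ee_two, tail_cons, sub_zero, crossDensity_eq_crossCoeff, crossCoeff]

lemma setIntegral_wzDensity_mul (hK : IsCylinderHomotopy V K) (hL : IsCylinderHomotopy W L)
    (hV : Differentiable ℝ V) (hW : Differentiable ℝ W) :
    ∫ z in cyl, wzDensity (fun y => K y * L y) z =
      (∫ z in cyl, wzDensity K z) + (∫ z in cyl, wzDensity L z) -
        3 * ∫ x in core 2, crossDensity V W x := by
  have hside : ∀ i j k : Fin 3, i = 0 ∨ j = 0 →
      ∫ z in cyl, pderiv k (crossCoeff K L i j) z = 0 := fun i j k hij =>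
    setIntegral_pderiv_eq_zero convex_cyl isOpen_cyl isBounded_cyl
      ((hK.smoothSU2.contDiff_crossCoeff hL.smoothSU2 _ _).of_le (by simp))
      (fun z hz => hK.crossCoeff_eq_zero_of_notMem_cyl hL hV hW hij hz) k
  rw [hK.smoothSU2.setIntegral_wzDensity_mul hL.smoothSU2 isBounded_cyl, Fin.sum_univ_three,
    hside (1 + 1) (1 + 2) 1 (.inr rfl), hside (2 + 1) (2 + 2) 2 (.inl rfl), add_zero, add_zero,
    ← hK.setIntegral_pderiv_zero_crossCoeff hL hV hW]
  rfl

end IsCylinderHomotopy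

lemma isCylinderHomotopy_contraction {V : E 2 → M} (hV : SmoothSU2 V) (h1 : ∀ x ∉ core 2, V x = 1)
    {c : M} (hc : c ∈ specialUnitaryGroup (Fin 2) ℂ) (hc1 : 1 ≠ -c) (hne : ∀ x, V x ≠ -c) :
    IsCylinderHomotopy V fun z => contraction c (cutoff (z 0)) (V (tail z)) where
  smoothSU2 := by
    refine ⟨contDiff_iff_contDiffAt.2 fun z => ?_, fun z =>
      contraction_mem hc hc1 (hV.mem _) (hne _) _⟩
    have hheight : ContDiff ℝ ∞ fun z : E 3 => cutoff (z 0) :=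
      contDiff_cutoff.comp (EuclideanSpace.proj 0 : E 3 →L[ℝ] ℝ).contDiff
    exact contDiffAt_contraction hc hc1 hheight.contDiffAt
      (hV.smooth.comp tail.contDiff).contDiffAt (hV.mem _) (hne _)
  eq_one z hz := by
    by_cases htail : tail z ∈ core 2
    · have hz0 : z 0 ≤ 0 := not_lt.1 fun h => hz ⟨h, htail⟩
      rw [cutoff_of_le (by linarith), contraction_zero hc]
    · rw [h1 _ htail, contraction_one_right hc hc1]
  eq_end z hz := by rw [cutoff_of_ge hz, contraction_one (hV.mem _)]

/-! ### Cone coordinates -/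

lemma det_of_comp (v : E 3) (L : E 2 →L[ℝ] E 3) (A : E 2 →L[ℝ] E 2) :
    det (of ![v.ofLp, (L (A (ee 0))).ofLp, (L (A (ee 1))).ofLp]) =
      A.det * det (of ![v.ofLp, (L (ee 0)).ofLp, (L (ee 1)).ofLp]) := by
  have hbasis : ∀ w : E 2, L w = w 0 • L (ee 0) + w 1 • L (ee 1) := fun w => by
    rw [← map_smul L, ← map_smul L, ← map_add L]
    congr 1
    ext i; fin_cases i <;> simp
  rw [hbasis (A (ee 0)), hbasis (A (ee 1)), det_eq_det_of_basis]
  simp only [det_fin_three, det_fin_two, of_apply, cons_val, PiLp.add_apply, PiLp.smul_apply,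
    smul_eq_mul]
  ring

/-- Polar coordinates on the cone over the image of `q`, with the disk parametrized by `flat`. -/
def cone (q : E 2 → E 3) (z : E 3) : E 3 := z 0 • q (flat (tail z))

/-- The derivative of `cone q`. -/
def coneDeriv (q : E 2 → E 3) (z : E 3) : E 3 →L[ℝ] E 3 :=
  z 0 • ((fderiv ℝ q (flat (tail z))).comp ((flatDeriv (tail z)).comp tail)) +
    (EuclideanSpace.proj 0 : E 3 →L[ℝ] ℝ).smulRight (q (flat (tail z)))

lemma coneDeriv_apply (q : E 2 → E 3) (z v : E 3) : coneDeriv q z v =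
    z 0 • fderiv ℝ q (flat (tail z)) (flatDeriv (tail z) (tail v)) +
      v 0 • q (flat (tail z)) := rfl

lemma flat_tail_mem_ball {z : E 3} (hz : z ∈ cyl) : flat (tail z) ∈ Metric.ball (0 : E 2) 1 :=
  mem_ball_zero_iff.2 (norm_flat_lt_one_iff.2 hz.2.2)

namespace IsCollapse

variable {q : E 2 → E 3}

lemma hasFDerivAt_cone (hq : IsCollapse q) {z : E 3} (hz : z ∈ cyl) :
    HasFDerivAt (cone q) (coneDeriv q z) z := by
  have hqAt : HasFDerivAt q (fderiv ℝ q (flat (tail z))) (flat (tail z)) :=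
    ((hq.smooth.contDiffAt (Metric.isOpen_ball.mem_nhds (flat_tail_mem_ball hz))).differentiableAt
      (by simp)).hasFDerivAt
  exact (EuclideanSpace.proj 0 : E 3 →L[ℝ] ℝ).hasFDerivAt.smul
    (hqAt.comp z ((hasFDerivAt_flat (tail z)).comp z tail.hasFDerivAt))

lemma det_coneDeriv_pos (hq : IsCollapse q) {z : E 3} (hz : z ∈ cyl) :
    0 < (coneDeriv q z).det := by
  have hpos := mul_pos (pow_pos (show 0 < z 0 from hz.2.1) 2)
    (mul_pos (det_flatDeriv_pos hz.2.2) (hq.oriented _ (flat_tail_mem_ball hz)))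
  refine hpos.trans_eq ?_
  have hzero : coneDeriv q z (ee 0) = q (flat (tail z)) := by
    rw [coneDeriv_apply, tail_ee_zero]
    simp
  have hone : coneDeriv q z (ee 1) =
      z 0 • fderiv ℝ q (flat (tail z)) (flatDeriv (tail z) (ee 0)) := by
    rw [coneDeriv_apply, tail_ee_one]
    simp
  have htwo : coneDeriv q z (ee 2) =
      z 0 • fderiv ℝ q (flat (tail z)) (flatDeriv (tail z) (ee 1)) := by
    rw [coneDeriv_apply, tail_ee_two]
    simp
  rw [← det_of_comp, det_eq_det_of_basis]
  simp only [det_fin_three, of_apply, cons_val, hzero, hone, htwo, PiLp.smul_apply, smul_eq_mul]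
  ring

lemma norm_apply (hq : IsCollapse q) {x : E 2} (hx : x ∈ Metric.ball (0 : E 2) 1) : ‖q x‖ = 1 :=
  mem_sphere_zero_iff_norm.1 (hq.mapsTo hx)

lemma norm_cone (hq : IsCollapse q) {z : E 3} (hz : z ∈ cyl) : ‖cone q z‖ = z 0 := by
  rw [cone, norm_smul, hq.norm_apply (flat_tail_mem_ball hz), mul_one, Real.norm_eq_abs,
    abs_of_pos hz.2.1]

lemma injOn_cone (hq : IsCollapse q) : Set.InjOn (cone q) cyl := by
  intro z hz w hw h
  have hradius : z 0 = w 0 := by rw [← hq.norm_cone hz, ← hq.norm_cone hw, h]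
  rw [cone, cone, hradius] at h
  have hflat := hq.injOn (flat_tail_mem_ball hz) (flat_tail_mem_ball hw)
    (smul_right_injective _ (show 0 < w 0 from hw.2.1).ne' h)
  rw [← cons_tail z, ← cons_tail w, hradius, injOn_flat hz.2.2 hw.2.2 hflat]

lemma image_cone_subset (hq : IsCollapse q) : cone q '' cyl ⊆ Metric.ball 0 1 := by
  rintro _ ⟨z, hz, rfl⟩
  rw [mem_ball_zero_iff, hq.norm_cone hz]
  exact hz.1

lemma measurableSet_image_cone (hq : IsCollapse q) : MeasurableSet (cone q '' cyl) :=
  measurable_image_of_fderivWithin isOpen_cyl.measurableSet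
    (fun _ hz => (hq.hasFDerivAt_cone hz).hasFDerivWithinAt) hq.injOn_cone

end IsCollapse

lemma mem_image_cone {q : E 2 → E 3} {y : E 3} (hy : y ≠ 0) (hy1 : ‖y‖ < 1)
    (hyq : ‖y‖⁻¹ • y ∈ q '' Metric.ball 0 1) : y ∈ cone q '' cyl := by
  obtain ⟨x, hx, hxy⟩ := hyq
  rw [← image_flat] at hx
  obtain ⟨u, hu, rfl⟩ := hx
  refine ⟨cons ‖y‖ u, ⟨by simpa using hy1, by simpa using hy, by simpa using hu⟩, ?_⟩
  rw [cone, tail_cons, cons_zero, hxy, smul_inv_smul₀ (norm_ne_zero_iff.2 hy)]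

lemma SmoothSU2.ae_wzDensity_eq_zero {G : E 3 → M} (hG : SmoothSU2 G) {S : Set (E 3)}
    (hS : MeasurableSet S) (h1 : ∀ x ∈ S, G x = 1) :
    ∀ᵐ x ∂volume.restrict S, wzDensity G x = 0 := by
  have hlin : ApproximatesLinearOn (fun y => vecPart (G y)) (0 : E 3 →L[ℝ] E 3) S 0 := by
    intro x hx y hy
    simp [h1 x hx, h1 y hy]
  have hdiff : Differentiable ℝ fun y => vecPart (G y) :=
    vecPart.differentiable.comp hG.differentiable
  filter_upwards [hlin.norm_fderiv_sub_le volume hS (fderiv ℝ fun y => vecPart (G y))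
    fun x _ => (hdiff x).hasFDerivAt.hasFDerivWithinAt, ae_restrict_mem hS] with x hx hxS
  have hfderiv : fderiv ℝ (fun y => vecPart (G y)) x = 0 := by simpa using hx
  have hscal : scalPart (1 : M) = 1 := Complex.one_re
  have hwz := hG.scalPart_mul_wzDensity x
  rw [h1 x hxS, hscal, hfderiv, one_mul] at hwz
  rw [hwz, det_eq_det_of_basis, det_fin_three]
  simp

namespace SmoothSU2

/-- The restriction to the ball of a smooth map from `ℝ³` to `SU(2)`. -/
def toGB {G : E 3 → M} (hG : SmoothSU2 G) : GB :=
  ⟨fun x => ⟨G x, hG.mem x⟩, G, hG.smooth, fun _ => rfl⟩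

lemma ballIntegral_toGB {G : E 3 → M} (hG : SmoothSU2 G) : ballIntegral hG.toGB =
    -(1 / (24 * Real.pi ^ 2)) * ∫ x in Metric.ball (0 : E 3) 1, wzDensity G x :=
  ballIntegral_eq hG.toGB fun _ => rfl

end SmoothSU2

/-- A filling of the map induced by `g` through `q` that is defined on all of `ℝ³` and equal to `1`
on the rays that do not meet the image of `q`. -/
structure IsRadialFilling (q : E 2 → E 3) (g : GDS1) (G : E 3 → M) : Prop where
  smoothSU2 : SmoothSU2 G
  eq_apply : ∀ x : Ball 2, ‖(x : E 2)‖ < 1 → G (q x) = (((g : GD) : Ball 2 → SU2) x : M)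
  eq_one : ∀ y ≠ 0, ‖y‖⁻¹ • y ∉ q '' Metric.ball 0 1 → G y = 1

namespace IsRadialFilling

variable {q : E 2 → E 3} {g h : GDS1} {G H : E 3 → M}

lemma mul (hG : IsRadialFilling q g G) (hH : IsRadialFilling q h H) :
    IsRadialFilling q (g * h) fun y => G y * H y where
  smoothSU2 := hG.smoothSU2.mul hH.smoothSU2
  eq_apply x hx := by
    rw [hG.eq_apply x hx, hH.eq_apply x hx]
    rfl
  eq_one y hy hyq := by rw [hG.eq_one y hy hyq, hH.eq_one y hy hyq, Matrix.mul_one]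

lemma isFilling (hG : IsRadialFilling q g G) : IsFilling q g hG.smoothSU2.toGB := by
  refine fun y => ⟨fun x hx hxy => Subtype.ext ?_, fun hyq => Subtype.ext (hG.eq_one y ?_ ?_)⟩
  · exact (congrArg G hxy.symm).trans (hG.eq_apply x hx)
  · exact ne_zero_of_mem_unit_sphere y
  · rwa [mem_sphere_zero_iff_norm.1 y.2, inv_one, one_smul]

lemma setIntegral_ball_wzDensity (hG : IsRadialFilling q g G) (hq : IsCollapse q) {K : E 3 → M}
    (hK : ∀ z ∈ cyl, K z = G (cone q z)) :
    ∫ y in Metric.ball (0 : E 3) 1, wzDensity G y = ∫ z in cyl, wzDensity K z := by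
  have hS : MeasurableSet ((Metric.ball (0 : E 3) 1 \ cone q '' cyl) \ {0}) :=
    (Metric.isOpen_ball.measurableSet.diff hq.measurableSet_image_cone).diff
      (measurableSet_singleton 0)
  have hzero := hG.smoothSU2.ae_wzDensity_eq_zero hS fun y hy => hG.eq_one y hy.2 fun hyq =>
    hy.1.2 (mem_image_cone hy.2 (mem_ball_zero_iff.1 hy.1.1) hyq)
  rw [ae_restrict_iff' hS] at hzero
  rw [← setIntegral_wzDensity_image isOpen_cyl (fun _ hz => hq.hasFDerivAt_cone hz) hq.injOn_cone
    (fun _ hz => hq.det_coneDeriv_pos hz) hG.smoothSU2.differentiable hK]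
  refine setIntegral_eq_of_subset_of_ae_sdiff_eq_zero
    Metric.isOpen_ball.measurableSet.nullMeasurableSet hq.image_cone_subset ?_
  filter_upwards [hzero, compl_mem_ae_iff.2 (measure_singleton (μ := volume) (0 : E 3))]
    with y hy hy0 hyS using hy ⟨hyS, hy0⟩

lemma ballIntegral_eq (hG : IsRadialFilling q g G) (hq : IsCollapse q) {K : E 3 → M}
    (hK : ∀ z ∈ cyl, K z = G (cone q z)) : ballIntegral hG.smoothSU2.toGB =
      -(1 / (24 * Real.pi ^ 2)) * ∫ z in cyl, wzDensity K z := by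
  rw [hG.smoothSU2.ballIntegral_toGB, hG.setIntegral_ball_wzDensity hq hK]

end IsRadialFilling

/-- The extension of a map on the sphere to `ℝ³` that contracts it to `1` along the rays. -/
def radialExtension (c : M) (U : E 3 → M) (y : E 3) : M :=
  contraction c (cutoff ‖y‖) (U (‖y‖⁻¹ • y))

section radialExtension

variable {c : M} {U : E 3 → M}

lemma radialExtension_smul {r : ℝ} (hr : 0 < r) {y : E 3} (hy : ‖y‖ = 1) :
    radialExtension c U (r • y) = contraction c (cutoff r) (U y) := by
  rw [radialExtension, norm_smul, hy, mul_one, Real.norm_of_nonneg hr.le, inv_smul_smul₀ hr.ne']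

lemma radialExtension_of_norm_le (hc : c ∈ specialUnitaryGroup (Fin 2) ℂ) {y : E 3}
    (hy : ‖y‖ ≤ 1 / 4) : radialExtension c U y = 1 := by
  rw [radialExtension, cutoff_of_le hy, contraction_zero hc]

lemma smul_norm_inv_mem_sphere {y : E 3} (hy : y ≠ 0) : ‖y‖⁻¹ • y ∈ S2 :=
  mem_sphere_zero_iff_norm.2 (norm_smul_inv_norm (𝕜 := ℝ) hy)

lemma smoothSU2_radialExtension (hc : c ∈ specialUnitaryGroup (Fin 2) ℂ) (hc1 : 1 ≠ -c)
    (hU : ContDiff ℝ ∞ U) (hmem : ∀ y ∈ S2, U y ∈ specialUnitaryGroup (Fin 2) ℂ)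
    (hne : ∀ y ∈ S2, U y ≠ -c) : SmoothSU2 (radialExtension c U) := by
  refine ⟨contDiff_iff_contDiffAt.2 fun y => ?_, fun y => ?_⟩
  · rcases lt_or_ge ‖y‖ (1 / 4) with hsmall | hlarge
    · refine (contDiffAt_const (c := (1 : M))).congr_of_eventuallyEq ?_
      filter_upwards [(isOpen_lt continuous_norm continuous_const).mem_nhds hsmall] with w hw
      exact radialExtension_of_norm_le hc (le_of_lt hw)
    · have hnorm : 0 < ‖y‖ := by linarith
      have hy := smul_norm_inv_mem_sphere (norm_pos_iff.1 hnorm)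
      have hsmooth : ContDiffAt ℝ ∞ (fun w : E 3 => ‖w‖) y :=
        contDiffAt_norm ℝ (norm_pos_iff.1 hnorm)
      exact contDiffAt_contraction hc hc1 (contDiff_cutoff.contDiffAt.comp y hsmooth)
        (hU.contDiffAt.comp y ((hsmooth.inv hnorm.ne').smul contDiffAt_id)) (hmem _ hy) (hne _ hy)
  · rcases eq_or_ne y 0 with rfl | hy
    · rw [radialExtension_of_norm_le hc (by simp)]
      exact one_mem _
    · have hyS := smul_norm_inv_mem_sphere hy
      exact contraction_mem hc hc1 (hmem _ hyS) (hne _ hyS) _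

end radialExtension

lemma exists_center (g : GDS1) : ∃ c ∈ specialUnitaryGroup (Fin 2) ℂ, (1 : M) ≠ -c ∧
    ∀ x, (((g : GD) : Ball 2 → SU2) x : M) ≠ -c := by
  obtain ⟨F, hF, hg⟩ := (g : GD).2
  obtain ⟨A, hA, hmiss⟩ := exists_mem_specialUnitaryGroup_forall_ne (by norm_num) hF
  have hbdry : (ee 0 : E 2) ∈ Ball 2 := by simp
  refine ⟨-A, neg_mem_of_mem hA, ?_, fun x => ?_⟩
  · have hone := g.2 ⟨ee 0, hbdry⟩ (by simp)
    rw [neg_neg, ← OneMemClass.coe_one (specialUnitaryGroup (Fin 2) ℂ), ← hone, ← hg]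
    exact hmiss _
  · rw [neg_neg, ← hg]
    exact hmiss _

lemma exists_isRadialFilling {q : E 2 → E 3} (hq : IsCollapse q) (g : GDS1) {c : M}
    (hc : c ∈ specialUnitaryGroup (Fin 2) ℂ) (hc1 : 1 ≠ -c)
    (hgc : ∀ x, (((g : GD) : Ball 2 → SU2) x : M) ≠ -c) :
    ∃ G : E 3 → M, IsRadialFilling q g G ∧ ∀ r > 0, ∀ x : Ball 2, ‖(x : E 2)‖ < 1 →
      G (r • q x) = contraction c (cutoff r) (((g : GD) : Ball 2 → SU2) x) := by
  obtain ⟨u, ⟨U, hU, hUu⟩, hu⟩ := hq.smooth_induced g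
  have hmem : ∀ y ∈ S2, U y ∈ specialUnitaryGroup (Fin 2) ℂ := fun y hy => by
    rw [hUu ⟨y, hy⟩]
    exact (u ⟨y, hy⟩).2
  have hUq : ∀ x : Ball 2, ‖(x : E 2)‖ < 1 → U (q x) = (((g : GD) : Ball 2 → SU2) x : M) :=
    fun x hx => by
      have hqx := hq.mapsTo (mem_ball_zero_iff.2 hx)
      rw [hUu ⟨q x, hqx⟩, (hu ⟨q x, hqx⟩).1 x hx rfl]
  have hU1 : ∀ y ∈ S2, y ∉ q '' Metric.ball 0 1 → U y = 1 := fun y hy hyq => by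
    rw [hUu ⟨y, hy⟩, (hu ⟨y, hy⟩).2 hyq, OneMemClass.coe_one]
  have hne : ∀ y ∈ S2, U y ≠ -c := fun y hy => by
    by_cases hyq : y ∈ q '' Metric.ball 0 1
    · obtain ⟨x, hx, rfl⟩ := hyq
      rw [hUq ⟨x, Metric.ball_subset_closedBall hx⟩ (mem_ball_zero_iff.1 hx)]
      exact hgc _
    · rwa [hU1 y hy hyq]
  have hray : ∀ r > 0, ∀ x : Ball 2, ‖(x : E 2)‖ < 1 → radialExtension c U (r • q x) =
      contraction c (cutoff r) (((g : GD) : Ball 2 → SU2) x) := fun r hr x hx => by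
    rw [radialExtension_smul hr (hq.norm_apply (mem_ball_zero_iff.2 hx)), hUq x hx]
  refine ⟨radialExtension c U, ⟨smoothSU2_radialExtension hc hc1 hU hmem hne, fun x hx => ?_,
    fun y hy hyq => ?_⟩, hray⟩
  · rw [← one_smul ℝ (q x), hray 1 one_pos x hx, cutoff_of_ge (by norm_num),
      contraction_one (((g : GD) : Ball 2 → SU2) x).2]
  · rw [radialExtension, hU1 _ (smul_norm_inv_mem_sphere hy) hyq, contraction_one_right hc hc1]

lemma comp_flat_eq_one {g : GDS1} {F : E 2 → M}
    (hg : ∀ x : Ball 2, F x = (((g : GD) : Ball 2 → SU2) x : M)) {x : E 2} (hx : x ∉ core 2) :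
    F (flat x) = 1 := by
  rw [hg ⟨flat x, by simpa using norm_flat_le x⟩, g.2 ⟨flat x, _⟩ (norm_flat_eq_one hx)]
  rfl

lemma exists_isRadialFilling_isCylinderHomotopy {q : E 2 → E 3} (hq : IsCollapse q) {g : GDS1}
    {F : E 2 → M} (hF : ContDiff ℝ ∞ F)
    (hg : ∀ x : Ball 2, F x = (((g : GD) : Ball 2 → SU2) x : M)) :
    ∃ G K, IsRadialFilling q g G ∧ IsCylinderHomotopy (fun x => F (flat x)) K ∧
      ∀ z ∈ cyl, K z = G (cone q z) := by
  obtain ⟨c, hc, hc1, hgc⟩ := exists_center g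
  obtain ⟨G, hG, hray⟩ := exists_isRadialFilling hq g hc hc1 hgc
  have hne : ∀ x : E 2, F (flat x) ≠ -c := fun x => by
    rw [hg ⟨flat x, by simpa using norm_flat_le x⟩]
    exact hgc _
  refine ⟨G, _, hG, isCylinderHomotopy_contraction (smoothSU2_comp_flat hF hg)
    (fun _ => comp_flat_eq_one hg) hc hc1 hne, fun z hz => ?_⟩
  have hball := flat_tail_mem_ball hz
  have hcone := hray (z 0) hz.2.1 ⟨flat (tail z), Metric.ball_subset_closedBall hball⟩
    (mem_ball_zero_iff.1 hball)
  rw [← hg] at hcone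
  exact hcone.symm

theorem exists_isFilling {q : E 2 → E 3} (hq : IsCollapse q) (g : GDS1) :
    ∃ G : GB, IsFilling q g G := by
  obtain ⟨F, hF, hg⟩ := (g : GD).2
  obtain ⟨G, -, hG, -⟩ := exists_isRadialFilling_isCylinderHomotopy hq hF hg
  exact ⟨_, hG.isFilling⟩

theorem neg_coboundary_wzCochain {q : E 2 → E 3} (hq : IsCollapse q) (g h : GDS1) :
    -coboundary (wzCochain q) g h = ((cocycle (g : GD) (h : GD) : ℝ) : AddCircle (1 : ℝ)) := by
  obtain ⟨F, hF, hFg⟩ := (g : GD).2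
  obtain ⟨L, hL, hLh⟩ := (h : GD).2
  obtain ⟨G, K, hG, hK, hKG⟩ := exists_isRadialFilling_isCylinderHomotopy hq hF hFg
  obtain ⟨H, N, hH, hN, hNH⟩ := exists_isRadialFilling_isCylinderHomotopy hq hL hLh
  have hF' := hF.differentiable (by simp)
  have hL' := hL.differentiable (by simp)
  have hflat : Differentiable ℝ (flat : E 2 → E 2) := contDiff_flat.differentiable (by simp)
  have hKN : ∀ z ∈ cyl, K z * N z = G (cone q z) * H (cone q z) := fun z hz => by
    rw [hKG z hz, hNH z hz]
  have hcocycle : cocycle (g : GD) (h : GD) = ballIntegral (hG.mul hH).smoothSU2.toGB -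
      ballIntegral hG.smoothSU2.toGB - ballIntegral hH.smoothSU2.toGB := by
    rw [cocycle_eq _ _ hFg hLh, setIntegral_crossDensity_flat hF' hL', hG.ballIntegral_eq hq hKG,
      hH.ballIntegral_eq hq hNH, (hG.mul hH).ballIntegral_eq hq hKN,
      hK.setIntegral_wzDensity_mul hN (hF'.comp hflat) (hL'.comp hflat)]
    field_simp
    ring
  rw [coboundary, wzCochain_eq hG.isFilling, wzCochain_eq hH.isFilling,
    wzCochain_eq (hG.mul hH).isFilling, hcocycle, AddCircle.coe_sub, AddCircle.coe_sub]
  abel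

/-! ### A polar cap -/

/-- The inverse of `flat` on the open unit disk. -/
def unflat : E 2 → E 2 := Function.invFunOn flat (core 2)

lemma exists_flat_eq {x : E 2} (hx : x ∈ Metric.ball (0 : E 2) 1) : ∃ u ∈ core 2, flat u = x := by
  rwa [← image_flat] at hx

lemma unflat_mem {x : E 2} (hx : x ∈ Metric.ball (0 : E 2) 1) : unflat x ∈ core 2 :=
  Function.invFunOn_mem (exists_flat_eq hx)

lemma flat_unflat {x : E 2} (hx : x ∈ Metric.ball (0 : E 2) 1) : flat (unflat x) = x :=
  Function.invFunOn_eq (exists_flat_eq hx)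

lemma unflat_flat {u : E 2} (hu : u ∈ core 2) : unflat (flat u) = u := by
  have hball : flat u ∈ Metric.ball (0 : E 2) 1 :=
    mem_ball_zero_iff.2 (norm_flat_lt_one_iff.2 hu)
  exact injOn_flat (unflat_mem hball) hu (flat_unflat hball)

lemma contDiffAt_unflat {x : E 2} (hx : x ∈ Metric.ball (0 : E 2) 1) :
    ContDiffAt ℝ ∞ unflat x := by
  obtain ⟨u, hu, rfl⟩ := exists_flat_eq hx
  have hflat : ContDiffAt ℝ ∞ (flat : E 2 → E 2) u := contDiff_flat.contDiffAt
  have hderiv : HasFDerivAt flat ((flatDeriv u).toContinuousLinearEquivOfDetNeZero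
      (det_flatDeriv_pos hu).ne' : E 2 →L[ℝ] E 2) u := hasFDerivAt_flat u
  have hinverse := hflat.to_localInverse hderiv (by simp)
  have hright := (hflat.hasStrictFDerivAt' hderiv (by simp)).eventually_right_inverse
  have hcore : ∀ᶠ y in 𝓝 (flat u), hflat.localInverse hderiv (by simp) y ∈ core 2 := by
    refine hinverse.continuousAt.eventually_mem ?_
    rw [hflat.localInverse_apply_image]
    exact isOpen_core.mem_nhds hu
  refine hinverse.congr_of_eventuallyEq ?_
  filter_upwards [hright, hcore] with y hy hyc
  rw [← unflat_flat hyc]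
  exact congrArg unflat hy.symm

/-- The inclusion of the plane `y₂ = 0` into `ℝ³`. -/
def planeEmbedding : E 2 →L[ℝ] E 3 :=
  LinearMap.toContinuousLinearMap
    { toFun := fun u => !₂[u 0, u 1, 0]
      map_add' := fun a b => by ext i; fin_cases i <;> simp
      map_smul' := fun c a => by ext i; fin_cases i <;> simp }

lemma planeEmbedding_apply (u : E 2) : planeEmbedding u = !₂[u 0, u 1, 0] := rfl

/-- The projection of `ℝ³` to its first two coordinates. -/
def planeProj : E 3 →L[ℝ] E 2 :=
  LinearMap.toContinuousLinearMap
    { toFun := fun y => !₂[y 0, y 1]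
      map_add' := fun a b => by ext i; fin_cases i <;> simp
      map_smul' := fun c a => by ext i; fin_cases i <;> simp }

lemma planeProj_apply (y : E 3) : planeProj y = !₂[y 0, y 1] := rfl

/-- The parametrization of the upper hemisphere as a graph over the unit disk. -/
def hemisphere (u : E 2) : E 3 := planeEmbedding u + √(1 - ‖u‖ ^ 2) • ee 2

@[simp] lemma hemisphere_zero (u : E 2) : hemisphere u 0 = u 0 := by
  simp [hemisphere, planeEmbedding_apply]

@[simp] lemma hemisphere_one (u : E 2) : hemisphere u 1 = u 1 := by
  simp [hemisphere, planeEmbedding_apply]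

@[simp] lemma hemisphere_two (u : E 2) : hemisphere u 2 = √(1 - ‖u‖ ^ 2) := by
  simp [hemisphere, planeEmbedding_apply]

lemma planeProj_hemisphere (u : E 2) : planeProj (hemisphere u) = u := by
  ext i; fin_cases i <;> simp [planeProj_apply]

lemma norm_planeProj_sq (y : E 3) : ‖planeProj y‖ ^ 2 = ‖y‖ ^ 2 - y 2 ^ 2 := by
  simp [EuclideanSpace.real_norm_sq_eq, Fin.sum_univ_three, planeProj_apply]

lemma hemisphere_planeProj {y : E 3} (hy : ‖y‖ = 1) (h2 : 0 ≤ y 2) :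
    hemisphere (planeProj y) = y := by
  ext i
  fin_cases i
  · simp [planeProj_apply]
  · simp [planeProj_apply]
  · simp [norm_planeProj_sq, hy, Real.sqrt_sq h2]

lemma half_lt_one_sub_norm_sq {u : E 2} (hu : u ∈ core 2) : 1 / 2 < 1 - ‖u‖ ^ 2 := by
  have : ‖u‖ ^ 2 < 1 / 2 := hu
  linarith

lemma norm_hemisphere {u : E 2} (hu : u ∈ core 2) : ‖hemisphere u‖ = 1 := by
  have hsq := norm_planeProj_sq (hemisphere u)
  rw [planeProj_hemisphere, hemisphere_two,
    Real.sq_sqrt (one_half_pos.trans (half_lt_one_sub_norm_sq hu)).le] at hsq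
  rw [← sq_eq_sq₀ (norm_nonneg _) zero_le_one]
  linarith

lemma contDiffAt_hemisphere {u : E 2} (hu : u ∈ core 2) : ContDiffAt ℝ ∞ hemisphere u := by
  have hpos := one_half_pos.trans (half_lt_one_sub_norm_sq hu)
  have hradicand : ContDiffAt ℝ ∞ (fun v : E 2 => 1 - ‖v‖ ^ 2) u :=
    contDiffAt_const.sub (contDiff_norm_sq ℝ).contDiffAt
  exact planeEmbedding.contDiff.contDiffAt.add ((hradicand.sqrt hpos.ne').smul contDiffAt_const)

/-- The derivative of `hemisphere` on the open unit disk. -/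
def hemisphereDeriv (u : E 2) : E 2 →L[ℝ] E 3 :=
  planeEmbedding + (-(√(1 - ‖u‖ ^ 2))⁻¹ • innerSL ℝ u).smulRight (ee 2)

lemma hasFDerivAt_hemisphere {u : E 2} (hu : u ∈ core 2) :
    HasFDerivAt hemisphere (hemisphereDeriv u) u := by
  have hpos := one_half_pos.trans (half_lt_one_sub_norm_sq hu)
  have hradicand : HasFDerivAt (fun v : E 2 => 1 - ‖v‖ ^ 2) (-(2 • innerSL ℝ u)) u :=
    (hasStrictFDerivAt_norm_sq u).hasFDerivAt.const_sub 1
  have hcoeff : (1 / (2 * √(1 - ‖u‖ ^ 2))) • -(2 • innerSL ℝ u) =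
      -(√(1 - ‖u‖ ^ 2))⁻¹ • innerSL ℝ u := by
    rw [smul_neg, neg_smul, ← Nat.cast_smul_eq_nsmul ℝ, smul_smul]
    congr 2
    field_simp
    norm_num
  rw [hemisphereDeriv, ← hcoeff]
  exact planeEmbedding.hasFDerivAt.add ((hradicand.sqrt hpos.ne').smul_const (ee 2 : E 3))

lemma det_hemisphereDeriv_pos {u : E 2} (hu : u ∈ core 2) :
    0 < Matrix.det (Matrix.of ![(hemisphere u).ofLp, (hemisphereDeriv u (ee 0)).ofLp,
      (hemisphereDeriv u (ee 1)).ofLp]) := by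
  have hpos := one_half_pos.trans (half_lt_one_sub_norm_sq hu)
  have hsqrt : 0 < √(1 - ‖u‖ ^ 2) := Real.sqrt_pos.2 hpos
  have hsq : √(1 - ‖u‖ ^ 2) ^ 2 = 1 - (u 0 ^ 2 + u 1 ^ 2) := by
    rw [Real.sq_sqrt hpos.le, EuclideanSpace.real_norm_sq_eq, Fin.sum_univ_two]
  have hrow_zero : (hemisphereDeriv u (ee 0)).ofLp = ![1, 0, -(√(1 - ‖u‖ ^ 2))⁻¹ * u 0] := by
    ext j
    fin_cases j <;>
      simp [hemisphereDeriv, planeEmbedding_apply, EuclideanSpace.inner_single_right]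
  have hrow_one : (hemisphereDeriv u (ee 1)).ofLp = ![0, 1, -(√(1 - ‖u‖ ^ 2))⁻¹ * u 1] := by
    ext j
    fin_cases j <;>
      simp [hemisphereDeriv, planeEmbedding_apply, EuclideanSpace.inner_single_right]
  refine (inv_pos.2 hsqrt).trans_eq ?_
  rw [hrow_zero, hrow_one, det_fin_three]
  simp only [of_apply, cons_val, hemisphere_zero, hemisphere_one, hemisphere_two]
  field_simp
  linear_combination -hsq

/-- A collapse: the hemisphere over `core 2`, parametrized by the open unit disk through `flat`. -/
def cap (x : E 2) : E 3 := hemisphere (unflat x)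

lemma image_cap : cap '' Metric.ball 0 1 = hemisphere '' core 2 := by
  rw [← image_flat, Set.image_image]
  exact Set.image_congr fun u hu => congrArg hemisphere (unflat_flat hu)

lemma contDiffAt_cap {x : E 2} (hx : x ∈ Metric.ball (0 : E 2) 1) : ContDiffAt ℝ ∞ cap x :=
  (contDiffAt_hemisphere (unflat_mem hx)).comp x (contDiffAt_unflat hx)

lemma injOn_cap : Set.InjOn cap (Metric.ball 0 1) := by
  intro x hx y hy h
  have hunflat : unflat x = unflat y := by
    simpa only [cap, planeProj_hemisphere] using congrArg planeProj h
  rw [← flat_unflat hx, ← flat_unflat hy, hunflat]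

lemma det_fderiv_cap_pos {x : E 2} (hx : x ∈ Metric.ball (0 : E 2) 1) :
    0 < Matrix.det (Matrix.of ![(cap x).ofLp, (fderiv ℝ cap x (ee 0)).ofLp,
      (fderiv ℝ cap x (ee 1)).ofLp]) := by
  obtain ⟨u, hu, rfl⟩ := exists_flat_eq hx
  have hcap := ((contDiffAt_cap hx).differentiableAt (by simp)).hasFDerivAt
  have hcomp : HasFDerivAt hemisphere ((fderiv ℝ cap (flat u)).comp (flatDeriv u)) u := by
    refine (hcap.comp u (hasFDerivAt_flat u)).congr_of_eventuallyEq ?_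
    filter_upwards [isOpen_core.mem_nhds hu] with v hv
    exact congrArg hemisphere (unflat_flat hv).symm
  have hdet := det_hemisphereDeriv_pos hu
  rw [(hasFDerivAt_hemisphere hu).unique hcomp, ContinuousLinearMap.comp_apply,
    ContinuousLinearMap.comp_apply, det_of_comp] at hdet
  rw [cap, unflat_flat hu]
  exact (mul_pos_iff_of_pos_left (det_flatDeriv_pos hu)).1 hdet

/-- The map that `F` induces on the sphere through `cap`, extended to `ℝ³`. -/
def capExtend (F : E 2 → M) (y : E 3) : M :=
  1 + Real.smoothTransition (2 * y 2) • (F (flat (planeProj y)) - 1)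

lemma contDiff_capExtend {F : E 2 → M} (hF : ContDiff ℝ ∞ F) : ContDiff ℝ ∞ (capExtend F) := by
  have htransition : ContDiff ℝ ∞ fun y : E 3 => Real.smoothTransition (2 * y 2) :=
    Real.smoothTransition.contDiff.comp
      (contDiff_const.mul (EuclideanSpace.proj 2 : E 3 →L[ℝ] ℝ).contDiff)
  exact contDiff_const.add
    (htransition.smul ((hF.comp (contDiff_flat.comp planeProj.contDiff)).sub contDiff_const))

lemma capExtend_hemisphere (F : E 2 → M) {u : E 2} (hu : u ∈ core 2) :
    capExtend F (hemisphere u) = F (flat u) := by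
  have hhalf := half_lt_one_sub_norm_sq hu
  have hheight : 1 / 2 ≤ √(1 - ‖u‖ ^ 2) := Real.le_sqrt_of_sq_le (by linarith)
  rw [capExtend, planeProj_hemisphere, hemisphere_two,
    Real.smoothTransition.one_of_one_le (by linarith), one_smul, add_sub_cancel]

lemma capExtend_of_notMem {g : GDS1} {F : E 2 → M}
    (hg : ∀ x : Ball 2, F x = (((g : GD) : Ball 2 → SU2) x : M)) {y : E 3} (hy : ‖y‖ = 1)
    (hyq : y ∉ hemisphere '' core 2) : capExtend F y = 1 := by
  rcases le_or_gt (y 2) 0 with hlower | hupper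
  · rw [capExtend, Real.smoothTransition.zero_of_nonpos (by linarith), zero_smul, add_zero]
  · have hproj : planeProj y ∉ core 2 :=
      fun hcore => hyq ⟨_, hcore, hemisphere_planeProj hy hupper.le⟩
    rw [capExtend, comp_flat_eq_one hg hproj, sub_self, smul_zero, add_zero]

lemma exists_induces_cap (g : GDS1) : ∃ u ∈ smoothMaps S2, Induces cap g u := by
  obtain ⟨F, hF, hg⟩ := (g : GD).2
  have hmem : ∀ y : S2, capExtend F y ∈ specialUnitaryGroup (Fin 2) ℂ := by
    intro y
    by_cases hy : (y : E 3) ∈ hemisphere '' core 2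
    · obtain ⟨u, hu, huy⟩ := hy
      rw [← huy, capExtend_hemisphere F hu]
      exact (smoothSU2_comp_flat hF hg).mem u
    · rw [capExtend_of_notMem hg (mem_sphere_zero_iff_norm.1 y.2) hy]
      exact one_mem _
  refine ⟨fun y => ⟨capExtend F y, hmem y⟩, ⟨capExtend F, contDiff_capExtend hF, fun _ => rfl⟩,
    fun y => ⟨fun x hx hxy => Subtype.ext ?_, fun hy => Subtype.ext ?_⟩⟩
  · have hball : (x : E 2) ∈ Metric.ball (0 : E 2) 1 := mem_ball_zero_iff.2 hx
    change capExtend F y = _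
    rw [← hxy, cap, capExtend_hemisphere F (unflat_mem hball), flat_unflat hball, hg]
  · rw [image_cap] at hy
    exact capExtend_of_notMem hg (mem_sphere_zero_iff_norm.1 y.2) hy

theorem isCollapse_cap : IsCollapse cap where
  smooth _ hx := (contDiffAt_cap hx).contDiffWithinAt
  mapsTo _ hx := mem_sphere_zero_iff_norm.2 (norm_hemisphere (unflat_mem hx))
  injOn := injOn_cap
  oriented _ hx := det_fderiv_cap_pos hx
  smooth_induced := exists_induces_cap

end

end Mickelsson

open Mickelsson in
theorem mainTheorem2 :
    (∃ q : E 2 → E 3, IsCollapse q) ∧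
    ∀ q : E 2 → E 3, IsCollapse q →
      (∀ g : GDS1, ∃ G : GB, IsFilling q g G) ∧
      (∀ (g : GDS1) (G : GB), IsFilling q g G →
        wzCochain q g = ((ballIntegral G : ℝ) : AddCircle (1 : ℝ))) ∧
      ∀ g h : GDS1,
        -coboundary (wzCochain q) g h = ((cocycle (g : GD) (h : GD) : ℝ) : AddCircle (1 : ℝ)) :=
  ⟨⟨cap, isCollapse_cap⟩, fun _ hq =>
    ⟨exists_isFilling hq, fun _ _ hG => wzCochain_eq hG, neg_coboundary_wzCochain hq⟩⟩
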